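/- Let $\Sigma^*$ be the set of finite bit strings, identified with $\mathbb{N}$ by the length-lexicographic bijection. A (prefix-free) machine is a program $M$ for a partial computable function $\Sigma^*\to\Sigma^*$ whose domain is prefix-free, i.e. no string in the domain is a proper prefix of another string in the domain. A machine $U$ is universal if for every machine $V$ there is a constant $c$ such that for all strings $s,t$ with $V(s)=t$ there is a string $s'$ with $|s'|\le |s|+c$ and $U(s')=t$. Let PA be first-order Peano Arithmetic in the language $\{0,1,+,\cdot,<\}$. For a program $U$ let $\mathrm{Univ}(U)$ be the sentence of arithmetic, obtained by the standard arithmetization of computations, which says that $U$ is a (prefix-free) universal machine; $U$ is called provably universal if $\mathrm{PA}\vdash\mathrm{Univ}(U)$. Theorem. (1) There exists a universal machine $U$ that is provably universal. (2) There exists a universal machine $V$ that is not provably universal, i.e. $\mathrm{PA}\nvdash\mathrm{Univ}(V)$. -/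

import Mathlib

namespace ProvUniv

open FirstOrder FirstOrder.Language

/-! ### First-order provability

A natural deduction calculus for classical first-order logic with equality, over Mathlib's
first-order formulas. The free variables are indexed by `ℕ`. -/

section Calculus

variable {L : FirstOrder.Language.{0, 0}}

/-- The result of replacing the outermost bound variable `&0` by the term `t`; the other bound
variables are renumbered. -/
def inst {α : Type} (t : L.Term α) : ∀ {k : ℕ}, L.BoundedFormula α (k + 1) → L.BoundedFormula α k
  | _, .falsum => .falsum
  | _, .equal t₁ t₂ => .equal (t₁.subst (σ t)) (t₂.subst (σ t))
  | _, .rel R ts => .rel R fun i => (ts i).subst (σ t)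
  | _, .imp φ ψ => .imp (inst t φ) (inst t ψ)
  | _, .all φ => .all (inst t φ)
where
  /-- The substitution of terms for variables that underlies `inst`. -/
  σ (t : L.Term α) {k : ℕ} : α ⊕ Fin (k + 1) → L.Term (α ⊕ Fin k) :=
    Sum.elim (fun a => .var (.inl a)) (Fin.cases (t.relabel Sum.inl) fun j => .var (.inr j))

/-- Renames every free variable `x_i` to `x_{i+1}`, so that `x_0` is not free in the result. -/
def shift {k : ℕ} (φ : L.BoundedFormula ℕ k) : L.BoundedFormula ℕ k :=
  φ.subst fun i => .var (i + 1)

/-- A sentence, regarded as a formula in which free variables are permitted. -/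
def ofSentence (φ : L.Sentence) : L.Formula ℕ :=
  BoundedFormula.subst φ Empty.elim

/-- `Derives T Γ φ`: there is a natural deduction proof of `φ` from the axioms `T` and the open
assumptions `Γ`. In `allI` the variable `x_0` is fresh, because all the free variables of the
assumptions and of `φ` have been shifted. -/
inductive Derives (T : L.Theory) : List (L.Formula ℕ) → L.Formula ℕ → Prop
  | ax {Γ : List (L.Formula ℕ)} {φ : L.Sentence} : φ ∈ T → Derives T Γ (ofSentence φ)
  | hyp {Γ : List (L.Formula ℕ)} {φ : L.Formula ℕ} : φ ∈ Γ → Derives T Γ φ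
  | impI {Γ : List (L.Formula ℕ)} {φ ψ : L.Formula ℕ} :
      Derives T (φ :: Γ) ψ → Derives T Γ (φ ⟹ ψ)
  | impE {Γ : List (L.Formula ℕ)} {φ ψ : L.Formula ℕ} :
      Derives T Γ (φ ⟹ ψ) → Derives T Γ φ → Derives T Γ ψ
  | raa {Γ : List (L.Formula ℕ)} {φ : L.Formula ℕ} :
      Derives T ((φ ⟹ ⊥) :: Γ) ⊥ → Derives T Γ φ
  | allI {Γ : List (L.Formula ℕ)} {φ : L.BoundedFormula ℕ 1} :
      Derives T (Γ.map shift) (inst (.var 0) (shift φ)) → Derives T Γ (∀' φ)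
  | allE {Γ : List (L.Formula ℕ)} {φ : L.BoundedFormula ℕ 1} (t : L.Term ℕ) :
      Derives T Γ (∀' φ) → Derives T Γ (inst t φ)
  | eqRefl {Γ : List (L.Formula ℕ)} (t : L.Term ℕ) : Derives T Γ (t.equal t)
  | eqSubst {Γ : List (L.Formula ℕ)} (φ : L.BoundedFormula ℕ 1) {s t : L.Term ℕ} :
      Derives T Γ (s.equal t) → Derives T Γ (inst s φ) → Derives T Γ (inst t φ)

/-- `T ⊢ φ`: the sentence `φ` has a proof from the axioms `T`. -/
def Provable (T : L.Theory) (φ : L.Sentence) : Prop :=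
  Derives T [] (ofSentence φ)

end Calculus

/-! ### Peano Arithmetic -/

/-- The function symbols `0`, `1`, `+`, `·`. -/
inductive ArithFunc : ℕ → Type
  | zero : ArithFunc 0
  | one : ArithFunc 0
  | add : ArithFunc 2
  | mul : ArithFunc 2

/-- The relation symbol `<`. -/
inductive ArithRel : ℕ → Type
  | lt : ArithRel 2

/-- The first-order language of arithmetic. -/
def LA : FirstOrder.Language.{0, 0} := ⟨ArithFunc, ArithRel⟩

instance {α : Type} : Zero (LA.Term α) := ⟨Constants.term (L := LA) ArithFunc.zero⟩
instance {α : Type} : One (LA.Term α) := ⟨Constants.term (L := LA) ArithFunc.one⟩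
instance {α : Type} : Add (LA.Term α) := ⟨Functions.apply₂ (L := LA) ArithFunc.add⟩
instance {α : Type} : Mul (LA.Term α) := ⟨Functions.apply₂ (L := LA) ArithFunc.mul⟩

/-- The atomic formula `s < t`. -/
def ltF {α : Type} {n : ℕ} (s t : LA.Term (α ⊕ Fin n)) : LA.BoundedFormula α n :=
  Relations.boundedFormula₂ (L := LA) ArithRel.lt s t

/-- The atomic formula `s = t`. -/
abbrev eqF {α : Type} {n : ℕ} (s t : LA.Term (α ⊕ Fin n)) : LA.BoundedFormula α n :=
  Term.bdEqual s t

infix:64 " ≺ " => ltF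
infix:64 " ≐ " => eqF

/-- The numeral of `n`: the closed term `(⋯((1 + 1) + 1) + ⋯ + 1)`. -/
def numeral {α : Type} : ℕ → LA.Term α
  | 0 => 0
  | 1 => 1
  | n + 2 => (numeral (n + 1) : LA.Term α) + 1

/-- The free variable number `i`. -/
abbrev x {α : Type} {n : ℕ} (i : α) : LA.Term (α ⊕ Fin n) := .var (.inl i)

/-- The bound variable number `j`, counted from the outermost quantifier. -/
abbrev y {α : Type} {n : ℕ} (j : Fin n) : LA.Term (α ⊕ Fin n) := .var (.inr j)

/-- Conjunction. -/
abbrev conj {α : Type} {n : ℕ} (φ ψ : LA.BoundedFormula α n) : LA.BoundedFormula α n := φ ⊓ ψ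

/-- Disjunction. -/
abbrev disj {α : Type} {n : ℕ} (φ ψ : LA.BoundedFormula α n) : LA.BoundedFormula α n := φ ⊔ ψ

infixr:69 " ⋏ " => conj
infixr:68 " ⋎ " => disj

/-- The axioms of the theory of (the nonnegative parts of) discretely ordered rings. -/
inductive PAMinus : LA.Theory
  | addAssoc : PAMinus (∀' ∀' ∀' ((y 0 + y 1) + y 2 ≐ y 0 + (y 1 + y 2)))
  | addComm : PAMinus (∀' ∀' (y 0 + y 1 ≐ y 1 + y 0))
  | mulAssoc : PAMinus (∀' ∀' ∀' ((y 0 * y 1) * y 2 ≐ y 0 * (y 1 * y 2)))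
  | mulComm : PAMinus (∀' ∀' (y 0 * y 1 ≐ y 1 * y 0))
  | distrib : PAMinus (∀' ∀' ∀' (y 0 * (y 1 + y 2) ≐ y 0 * y 1 + y 0 * y 2))
  | zero : PAMinus (∀' ((y 0 + 0 ≐ y 0) ⋏ (y 0 * 0 ≐ 0)))
  | one : PAMinus (∀' (y 0 * 1 ≐ y 0))
  | ltTrans : PAMinus (∀' ∀' ∀' ((y 0 ≺ y 1) ⋏ (y 1 ≺ y 2) ⟹ (y 0 ≺ y 2)))
  | ltIrrefl : PAMinus (∀' ∼(y 0 ≺ y 0))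
  | ltTri : PAMinus (∀' ∀' ((y 0 ≺ y 1) ⋎ (y 0 ≐ y 1) ⋎ (y 1 ≺ y 0)))
  | ltAdd : PAMinus (∀' ∀' ∀' ((y 0 ≺ y 1) ⟹ (y 0 + y 2 ≺ y 1 + y 2)))
  | ltMul : PAMinus (∀' ∀' ∀' ((0 ≺ y 2) ⋏ (y 0 ≺ y 1) ⟹ (y 0 * y 2 ≺ y 1 * y 2)))
  | sub : PAMinus (∀' ∀' ((y 0 ≺ y 1) ⟹ ∃' (y 0 + y 2 ≐ y 1)))
  | discrete : PAMinus ((0 ≺ 1) ⋏ ∀' ((0 ≺ y 0) ⟹ (1 ≺ y 0) ⋎ (1 ≐ y 0)))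
  | nonneg : PAMinus (∀' ((0 ≺ y 0) ⋎ (0 ≐ y 0)))

/-- `φ(v + 1)`, where `v` is the outermost bound variable `&0` of `φ`. -/
def atSucc {α : Type} {k : ℕ} (φ : LA.BoundedFormula α k) : LA.BoundedFormula α k :=
  φ.mapTermRel (g := id)
    (fun _ t => t.subst
      (Sum.elim (fun a => x a) fun j => if (j : ℕ) = 0 then y j + 1 else y j))
    (fun _ => id) fun _ => id

/-- The universal closure of a formula. -/
def closure {n : ℕ} (φ : LA.Formula (Fin n)) : LA.Sentence :=
  BoundedFormula.alls (n := n) (BoundedFormula.relabel (Sum.inr : Fin n → Empty ⊕ Fin n) φ)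

/-- The induction axiom for a formula `φ`, whose parameters are its free variables. -/
def inductionAxiom {n : ℕ} (φ : LA.BoundedFormula (Fin n) 1) : LA.Sentence :=
  closure (inst 0 φ ⋏ ∀' (φ ⟹ atSucc φ) ⟹ ∀' φ)

/-- Peano Arithmetic. -/
def PA : LA.Theory :=
  PAMinus ∪ {σ | ∃ (n : ℕ) (φ : LA.BoundedFormula (Fin n) 1), σ = inductionAxiom φ}

/-! ### Machines

A machine is a program for a partial computable function on `ℕ`, run on bit strings through the
canonical bijection between bit strings and natural numbers. -/

/-- The number of a bit string in the length-lexicographic order `ε, 0, 1, 00, 01, …`: the binary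
numeral `1s` denotes `strNum s + 1`. -/
def strNum (s : List Bool) : ℕ :=
  s.foldl (fun n b => 2 * n + 1 + b.toNat) 0

/-- The program `M` halts on the string `s`, with output the string `t`. -/
def Computes (M : Nat.Partrec.Code) (s t : List Bool) : Prop :=
  strNum t ∈ M.eval (strNum s)

/-- The domain of `M` is a prefix-free set of strings. -/
def IsPrefixFree (M : Nat.Partrec.Code) : Prop :=
  ∀ s s' t t' : List Bool, Computes M s t → Computes M s' t' → s <+: s' → s = s'

/-- `U` is a universal prefix-free machine. -/
def IsUniversal (U : Nat.Partrec.Code) : Prop :=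
  IsPrefixFree U ∧ ∀ V : Nat.Partrec.Code, IsPrefixFree V →
    ∃ c : ℕ, ∀ s t : List Bool, Computes V s t →
      ∃ s' : List Bool, Computes U s' t ∧ s'.length ≤ s.length + c

/-! ### Universality as a sentence of arithmetic

The parameters of each formula are its free variables `x 0, x 1, …`. -/

/-- The formula `φ(t₀, …, t_{m-1})`. -/
def app {m n : ℕ} {α : Type} (φ : LA.Formula (Fin m)) (t : Fin m → LA.Term (α ⊕ Fin n)) :
    LA.BoundedFormula α n :=
  BoundedFormula.relabel (n := n) (k := 0) id (BoundedFormula.subst φ t)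

/-- `x 0` is the number of the pair `(x 1, x 2)` (the pairing function is `Nat.pair`). -/
def pairF : LA.Formula (Fin 3) :=
  ((x 1 ≺ x 2) ⋏ (x 0 ≐ x 2 * x 2 + x 1)) ⋎
    (∼(x 1 ≺ x 2) ⋏ (x 0 ≐ x 1 * x 1 + x 1 + x 2))

/-- `x 3` is the entry number `x 2` of the sequence with the Gödel β-code `(x 0, x 1)`, that is,
the remainder of `x 0` modulo `1 + (x 2 + 1) * x 1`. -/
def betaF : LA.Formula (Fin 4) :=
  ∃' ((x 0 ≐ y 0 * (1 + (x 2 + 1) * x 1) + x 3) ⋏ (x 3 ≺ 1 + (x 2 + 1) * x 1))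

/-- Entry number `x 2` of the sequence coded by `(x 0, x 1)` is the triple `(x 3, x 4, x 5)`. -/
def entryF : LA.Formula (Fin 6) :=
  ∃' ∃' (app betaF ![x 0, x 1, x 2, y 0] ⋏ app pairF ![y 0, x 3, y 1] ⋏
    app pairF ![y 1, x 4, x 5])

/-- Some entry before number `x 2` of the sequence coded by `(x 0, x 1)` is the triple
`(x 3, x 4, x 5)`. -/
def beforeF : LA.Formula (Fin 6) :=
  ∃' ((y 0 ≺ x 2) ⋏ app entryF ![x 0, x 1, y 0, x 3, x 4, x 5])

/-- The claim "program number `x 3` on input `x 4` halts with output `x 5`" follows in one step,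
according to the form of the program, from claims that occur as triples before entry `x 2` of the
sequence coded by `(x 0, x 1)`. The clauses are those of `Nat.Partrec.Code.eval`; programs are
numbered by `Nat.Partrec.Code.encodeCode`. -/
def stepF : LA.Formula (Fin 6) :=
  -- `zero`
  ((x 3 ≐ 0) ⋏ (x 5 ≐ 0)) ⋎
  -- `succ`
  ((x 3 ≐ 1) ⋏ (x 5 ≐ x 4 + 1)) ⋎
  -- `left`
  ((x 3 ≐ numeral 2) ⋏ ∃' app pairF ![x 4, x 5, y 0]) ⋎
  -- `right`
  ((x 3 ≐ numeral 3) ⋏ ∃' app pairF ![x 4, y 0, x 5]) ⋎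
  -- `pair f g`: `y 0 = f`, `y 1 = g`, with values `y 3` and `y 4`
  (∃' ∃' ∃' ∃' ∃' (app pairF ![y 2, y 0, y 1] ⋏ (x 3 ≐ numeral 4 * y 2 + numeral 4) ⋏
    app beforeF ![x 0, x 1, x 2, y 0, x 4, y 3] ⋏
    app beforeF ![x 0, x 1, x 2, y 1, x 4, y 4] ⋏ app pairF ![x 5, y 3, y 4])) ⋎
  -- `comp f g`: `y 0 = f`, `y 1 = g`, and `y 3` is the value of `g`
  (∃' ∃' ∃' ∃' (app pairF ![y 2, y 0, y 1] ⋏ (x 3 ≐ numeral 4 * y 2 + numeral 6) ⋏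
    app beforeF ![x 0, x 1, x 2, y 1, x 4, y 3] ⋏
    app beforeF ![x 0, x 1, x 2, y 0, y 3, x 5])) ⋎
  -- `prec f g` on input `(y 3, 0)`
  (∃' ∃' ∃' ∃' (app pairF ![y 2, y 0, y 1] ⋏ (x 3 ≐ numeral 4 * y 2 + numeral 5) ⋏
    app pairF ![x 4, y 3, 0] ⋏ app beforeF ![x 0, x 1, x 2, y 0, y 3, x 5])) ⋎
  -- `prec f g` on input `(y 3, y 4 + 1)`: `y 5 = (y 3, y 4)`, and `y 6` is the value there
  (∃' ∃' ∃' ∃' ∃' ∃' ∃' ∃' ∃' (app pairF ![y 2, y 0, y 1] ⋏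
    (x 3 ≐ numeral 4 * y 2 + numeral 5) ⋏
    app pairF ![x 4, y 3, y 4 + 1] ⋏ app pairF ![y 5, y 3, y 4] ⋏
    app beforeF ![x 0, x 1, x 2, x 3, y 5, y 6] ⋏
    app pairF ![y 7, y 4, y 6] ⋏ app pairF ![y 8, y 3, y 7] ⋏
    app beforeF ![x 0, x 1, x 2, y 1, y 8, x 5])) ⋎
  -- `rfind' f` on input `(y 1, x 5)`, where `f` has the value `0`
  (∃' ∃' ((x 3 ≐ numeral 4 * y 0 + numeral 7) ⋏ app pairF ![x 4, y 1, x 5] ⋏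
    app beforeF ![x 0, x 1, x 2, y 0, x 4, 0])) ⋎
  -- `rfind' f` on input `(y 1, y 2)`, where `f` has the value `y 3 + 1`: `y 4 = (y 1, y 2 + 1)`
  (∃' ∃' ∃' ∃' ∃' ((x 3 ≐ numeral 4 * y 0 + numeral 7) ⋏ app pairF ![x 4, y 1, y 2] ⋏
    app beforeF ![x 0, x 1, x 2, y 0, x 4, y 3 + 1] ⋏
    app pairF ![y 4, y 1, y 2 + 1] ⋏ app beforeF ![x 0, x 1, x 2, x 3, y 4, x 5]))

/-- "Program number `x 0` on input `x 1` halts with output `x 2`": this claim is the last entry,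
number `y 2`, of a sequence of claims that follow from earlier claims of the sequence. -/
def evalF : LA.Formula (Fin 3) :=
  ∃' ∃' ∃' (
    ∀' ((y 3 ≺ y 2 + 1) ⟹ ∃' ∃' ∃' (app entryF ![y 0, y 1, y 3, y 4, y 5, y 6] ⋏
      app stepF ![y 0, y 1, y 3, y 4, y 5, y 6])) ⋏
    app entryF ![y 0, y 1, y 2, x 0, x 1, x 2])

/-- `x 1 = 2 ^ x 0`. -/
def expF : LA.Formula (Fin 2) :=
  ∃' ∃' (app betaF ![y 0, y 1, 0, 1] ⋏
    ∀' ((y 2 ≺ x 0) ⟹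
      ∃' (app betaF ![y 0, y 1, y 2, y 3] ⋏ app betaF ![y 0, y 1, y 2 + 1, y 3 + y 3])) ⋏
    app betaF ![y 0, y 1, x 0, x 1])

/-- The string number `x 0` has length `x 1`. -/
def lengthF : LA.Formula (Fin 2) :=
  ∃' (app expF ![x 1, y 0] ⋏ ∼(x 0 + 1 ≺ y 0) ⋏ (x 0 + 1 ≺ y 0 + y 0))

/-- The string number `x 0` is a prefix of the string number `x 1`: the binary numeral `x 1 + 1`
arises from the binary numeral `x 0 + 1` by appending `y 0` binary digits. -/
def prefixF : LA.Formula (Fin 2) :=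
  ∃' ∃' ∃' (app expF ![y 0, y 1] ⋏ (y 2 ≺ y 1) ⋏ (x 1 + 1 ≐ (x 0 + 1) * y 1 + y 2))

/-- "The domain of program number `x 0` is prefix-free." -/
def prefixFreeF : LA.Formula (Fin 1) :=
  ∀' ∀' ∀' ∀' (app evalF ![x 0, y 0, y 2] ⋏ app evalF ![x 0, y 1, y 3] ⋏
    app prefixF ![y 0, y 1] ⟹ (y 0 ≐ y 1))

/-- "Program number `x 0` is a universal prefix-free machine": the variables are the other machine
`y 0`, the constant `y 1`, the strings `s = y 2`, `t = y 3` and `s' = y 4`, and the lengths `y 5`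
of `s` and `y 6` of `s'`. -/
def universalF : LA.Formula (Fin 1) :=
  prefixFreeF ⋏
    ∀' (app prefixFreeF ![y 0] ⟹
      ∃' ∀' ∀' (app evalF ![y 0, y 2, y 3] ⟹
        ∃' ∃' ∃' (app evalF ![x 0, y 4, y 3] ⋏ app lengthF ![y 2, y 5] ⋏
          app lengthF ![y 4, y 6] ⋏ (y 6 ≺ y 5 + y 1 + 1))))

/-- The sentence of arithmetic that says that `U` is a universal prefix-free machine. -/
def universalSentence (U : Nat.Partrec.Code) : LA.Sentence :=
  app (n := 0) universalF fun _ => numeral U.encodeCode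

/-- PA proves that `U` is a universal prefix-free machine. -/
def ProvablyUniversal (U : Nat.Partrec.Code) : Prop :=
  Provable PA (universalSentence U)

end ProvUniv

namespace ProvUniv

open FirstOrder FirstOrder.Language

/-! ### Substitution -/

section Substitution

variable {L : FirstOrder.Language.{0, 0}} {α β γ : Type}

/-! Both parts rest on Gödel's completeness theorem. By `provable_iff`, provability in PA is truth
in all models of PA, and a model is the same thing as a discretely ordered semiring with induction
for its definable predicates (`PeanoModel`). Statements about PA-proofs thereby become ordinary
mathematics inside an arbitrary, possibly nonstandard, model: pairing, Gödel's β-function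
(`exists_code`), and the evaluation relation `Ev`, which is governed by its clauses (`ev_iff_step`)
and by induction along computations (`Ev.induct`).

For the first part, a machine U reads a string 0ᵉ1s and simulates machine e on s, but only after
making e prefix-free by force. It enumerates the certified runs (s, t, k) of e and accepts a run
only if no run with a smaller number has a different input comparable with s. The accepted inputs
are prefix-free whatever e is, and if the domain of e is prefix-free then nothing is rejected, so U
is universal with the constant e + 1. This argument uses nothing beyond PA, so it works in every
model and for nonstandard e as well; `exists_provablyUniversal` carries it out. One actual program
has to do this in all models simultaneously. The classes `UF`, `UD` and `US` provide it: they
describe functions, decidable relations and enumerable relations that are given by the same program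
in every model, and `US.exists_code` turns an enumerable relation into a program that selects a
value.

For the second part, truth is compared with provability through the halting problem. Given a
universal U, let V e copy U on input n unless the program e has halted on input 0 within the bound
n. If e diverges, V e computes the same function as U and is universal; if e halts, V e has a finite
domain and is not universal. Suppose every universal machine were provably universal. The theorems
of PA can be enumerated and PA is true in ℕ, so a program halts on V e exactly when e diverges
(`exists_enumeration`), and the complement of the halting problem would be recursively enumerable.

The enumeration needs a calculus on numbers of formulas. It is presented as a set generated from
axioms by rules (`Gen`), which makes it enumerable by the closure properties of `US`. Its soundness
(`NDer.sound`) and its simulation of formal derivations (`Der.nDer`) are needed in ℕ only. -/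

theorem term_subst_subst (t : L.Term α) (f : α → L.Term β) (g : β → L.Term γ) :
    (t.subst f).subst g = t.subst fun a => (f a).subst g := by
  induction t with
  | var => rfl
  | func F ts ih => simp [ih]

theorem term_subst_relabel (t : L.Term α) (f : α → β) (g : β → L.Term γ) :
    (t.relabel f).subst g = t.subst (g ∘ f) := by
  induction t with
  | var => rfl
  | func F ts ih => simp [ih]

theorem term_relabel_subst (t : L.Term α) (f : α → L.Term β) (g : β → γ) :
    (t.subst f).relabel g = t.subst fun a => (f a).relabel g := by
  induction t with
  | var => rfl
  | func F ts ih => simp [ih]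

theorem term_subst_var (t : L.Term α) : t.subst Term.var = t := by
  induction t with
  | var => rfl
  | func F ts ih => simp [ih]

/-- The substitution on terms that underlies `BoundedFormula.subst`. -/
def substLift (f : α → L.Term β) (n : ℕ) : α ⊕ Fin n → L.Term (β ⊕ Fin n) :=
  Sum.elim (Term.relabel Sum.inl ∘ f) (Term.var ∘ Sum.inr)

theorem subst_falsum (f : α → L.Term β) (n : ℕ) :
    (BoundedFormula.falsum : L.BoundedFormula α n).subst f = .falsum := rfl

theorem subst_equal (f : α → L.Term β) {n : ℕ} (s t : L.Term (α ⊕ Fin n)) :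
    (BoundedFormula.equal s t).subst f =
      .equal (s.subst (substLift f n)) (t.subst (substLift f n)) := rfl

theorem subst_rel (f : α → L.Term β) {n l : ℕ} (R : L.Relations l)
    (ts : Fin l → L.Term (α ⊕ Fin n)) :
    (BoundedFormula.rel R ts).subst f = .rel R fun i => (ts i).subst (substLift f n) := rfl

theorem subst_imp (f : α → L.Term β) {n : ℕ} (φ ψ : L.BoundedFormula α n) :
    (φ ⟹ ψ).subst f = (φ.subst f ⟹ ψ.subst f) := rfl

theorem subst_all (f : α → L.Term β) {n : ℕ} (φ : L.BoundedFormula α (n + 1)) :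
    (∀' φ).subst f = ∀' (φ.subst f) := rfl

theorem substLift_subst (f : α → L.Term β) (g : β → L.Term γ) (n : ℕ) :
    (fun a => (substLift f n a).subst (substLift g n)) =
      substLift (fun a => (f a).subst g) n := by
  funext a
  rcases a with a | a
  · simp only [substLift, Sum.elim_inl, Function.comp, term_subst_relabel, term_relabel_subst]
    rfl
  · rfl

theorem subst_subst {n : ℕ} (φ : L.BoundedFormula α n) (f : α → L.Term β) (g : β → L.Term γ) :
    (φ.subst f).subst g = φ.subst fun a => (f a).subst g := by
  induction φ with
  | falsum => rfl
  | equal => simp only [subst_equal, term_subst_subst, substLift_subst]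
  | rel => simp only [subst_rel, term_subst_subst, substLift_subst]
  | imp _ _ h₁ h₂ => rw [subst_imp, subst_imp, subst_imp, h₁, h₂]
  | all _ h => rw [subst_all, subst_all, subst_all, h]

theorem inst_σ_subst (t : L.Term α) (f : α → L.Term β) (k : ℕ) :
    (fun a => (inst.σ t a).subst (substLift f k)) =
      fun a => (substLift f (k + 1) a).subst (inst.σ (t.subst f)) := by
  funext a
  rcases a with a | a
  · simp only [substLift, inst.σ, Sum.elim_inl, Function.comp, term_subst_relabel, Term.subst]
    refine Eq.trans (b := (f a).subst (Term.var ∘ Sum.inl)) ?_ rfl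
    rw [← term_subst_relabel, term_subst_var]
  · refine Fin.cases ?_ (fun j => ?_) a
    · simp only [substLift, inst.σ, Sum.elim_inr, Function.comp, Term.subst, Fin.cases_zero,
        term_subst_relabel, term_relabel_subst]
      rfl
    · simp only [substLift, inst.σ, Sum.elim_inr, Function.comp, Term.subst, Fin.cases_succ]

/-- Free and bound variables are different summands, so no capture can occur; only the instantiated
term has to be substituted into as well. -/
theorem inst_subst (t : L.Term α) (f : α → L.Term β) : ∀ {k : ℕ} (φ : L.BoundedFormula α (k + 1)),
    (inst t φ).subst f = inst (t.subst f) (φ.subst f)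
  | _, .falsum => by simp only [inst, subst_falsum]
  | _, .equal _ _ => by
    simp only [inst, subst_equal, term_subst_subst, inst_σ_subst]
  | _, .rel _ _ => by
    simp only [inst, subst_rel, term_subst_subst, inst_σ_subst]
  | _, .imp φ ψ => by
    rw [inst, subst_imp, subst_imp, inst, inst_subst t f φ, inst_subst t f ψ]
  | _, .all φ => by
    rw [inst, subst_all, subst_all, inst, inst_subst t f φ]

/-- The formula depends only on the substitution of terms for the variables below `N`. -/
def FreeBelow (N : ℕ) {k : ℕ} (φ : L.BoundedFormula ℕ k) : Prop :=
  ∀ σ τ : ℕ → L.Term ℕ, (∀ i < N, σ i = τ i) → φ.subst σ = φ.subst τ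

theorem FreeBelow.mono {N N' k : ℕ} (h : N ≤ N') {φ : L.BoundedFormula ℕ k}
    (hφ : FreeBelow N φ) : FreeBelow N' φ :=
  fun σ τ e => hφ σ τ fun i hi => e i (hi.trans_le h)

theorem exists_term_bound {k : ℕ} (t : L.Term (ℕ ⊕ Fin k)) : ∃ N : ℕ, ∀ σ τ : ℕ → L.Term ℕ,
    (∀ i < N, σ i = τ i) → t.subst (substLift σ k) = t.subst (substLift τ k) := by
  induction t with
  | var a =>
    rcases a with a | a
    · exact ⟨a + 1, fun σ τ h => by simp [substLift, h a (Nat.lt_succ_self a)]⟩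
    · exact ⟨0, fun σ τ h => rfl⟩
  | @func l F ts ih =>
    choose N hN using ih
    refine ⟨Finset.univ.sup N, fun σ τ h => ?_⟩
    simp only [Term.subst]
    congr 1
    funext i
    exact hN i σ τ fun j hj => h j (hj.trans_le (Finset.le_sup (f := N) (Finset.mem_univ i)))

/-- Only finitely many variables occur in a formula. This is the source of fresh variables in the
Henkin construction. -/
theorem exists_freeBelow {k : ℕ} (φ : L.BoundedFormula ℕ k) : ∃ N, FreeBelow N φ := by
  induction φ with
  | falsum => exact ⟨0, fun _ _ _ => rfl⟩
  | equal s t =>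
    obtain ⟨N, hN⟩ := exists_term_bound s
    obtain ⟨N', hN'⟩ := exists_term_bound t
    refine ⟨max N N', fun σ τ h => ?_⟩
    rw [subst_equal, subst_equal, hN σ τ fun i hi => h i (by omega),
      hN' σ τ fun i hi => h i (by omega)]
  | rel R ts =>
    choose N hN using fun i => exists_term_bound (ts i)
    refine ⟨Finset.univ.sup N, fun σ τ h => ?_⟩
    simp only [subst_rel]
    congr 1
    funext i
    exact hN i σ τ fun j hj => h j (hj.trans_le (Finset.le_sup (f := N) (Finset.mem_univ i)))
  | imp φ ψ h₁ h₂ =>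
    obtain ⟨N, hN⟩ := h₁
    obtain ⟨N', hN'⟩ := h₂
    refine ⟨max N N', fun σ τ h => ?_⟩
    rw [subst_imp, subst_imp, hN σ τ fun i hi => h i (by omega),
      hN' σ τ fun i hi => h i (by omega)]
  | all φ h =>
    obtain ⟨N, hN⟩ := h
    exact ⟨N, fun σ τ h => by rw [subst_all, subst_all, hN σ τ h]⟩

theorem subst_shift {k : ℕ} (φ : L.BoundedFormula ℕ k) (σ : ℕ → L.Term β) :
    (shift φ).subst σ = φ.subst fun i => σ (i + 1) :=
  subst_subst _ _ _

theorem ofSentence_subst (φ : L.Sentence) (σ : ℕ → L.Term ℕ) :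
    (ofSentence φ).subst σ = ofSentence φ := by
  rw [ofSentence, subst_subst]
  congr 1
  funext a
  exact a.elim

end Substitution

/-! ### The calculus over a set of open axioms -/

section Calculus

variable {L : FirstOrder.Language.{0, 0}}

/-- The calculus `Derives`, over a set of axioms that may have free variables. -/
inductive Der (A : Set (L.Formula ℕ)) : List (L.Formula ℕ) → L.Formula ℕ → Prop
  | ax {Γ : List (L.Formula ℕ)} {φ : L.Formula ℕ} : φ ∈ A → Der A Γ φ
  | hyp {Γ : List (L.Formula ℕ)} {φ : L.Formula ℕ} : φ ∈ Γ → Der A Γ φ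
  | impI {Γ : List (L.Formula ℕ)} {φ ψ : L.Formula ℕ} : Der A (φ :: Γ) ψ → Der A Γ (φ ⟹ ψ)
  | impE {Γ : List (L.Formula ℕ)} {φ ψ : L.Formula ℕ} :
      Der A Γ (φ ⟹ ψ) → Der A Γ φ → Der A Γ ψ
  | raa {Γ : List (L.Formula ℕ)} {φ : L.Formula ℕ} : Der A ((φ ⟹ ⊥) :: Γ) ⊥ → Der A Γ φ
  | allI {Γ : List (L.Formula ℕ)} {φ : L.BoundedFormula ℕ 1} :
      Der A (Γ.map shift) (inst (.var 0) (shift φ)) → Der A Γ (∀' φ)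
  | allE {Γ : List (L.Formula ℕ)} {φ : L.BoundedFormula ℕ 1} (t : L.Term ℕ) :
      Der A Γ (∀' φ) → Der A Γ (inst t φ)
  | eqRefl {Γ : List (L.Formula ℕ)} (t : L.Term ℕ) : Der A Γ (t.equal t)
  | eqSubst {Γ : List (L.Formula ℕ)} (φ : L.BoundedFormula ℕ 1) {s t : L.Term ℕ} :
      Der A Γ (s.equal t) → Der A Γ (inst s φ) → Der A Γ (inst t φ)

/-- Allowing open axioms lets one soundness and one completeness proof serve both PA and `openPA`,
the version that is later coded by numbers. -/
theorem derives_iff_der {T : L.Theory} {Γ : List (L.Formula ℕ)} {φ : L.Formula ℕ} :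
    Derives T Γ φ ↔ Der (ofSentence '' T) Γ φ := by
  constructor
  · intro h
    induction h with
    | ax h => exact .ax ⟨_, h, rfl⟩
    | hyp h => exact .hyp h
    | impI _ h => exact .impI h
    | impE _ _ h₁ h₂ => exact .impE h₁ h₂
    | raa _ h => exact .raa h
    | allI _ h => exact .allI h
    | allE t _ h => exact .allE t h
    | eqRefl t => exact .eqRefl t
    | eqSubst φ _ _ h₁ h₂ => exact .eqSubst φ h₁ h₂
  · intro h
    induction h with
    | ax h => obtain ⟨ψ, h, rfl⟩ := h; exact .ax h
    | hyp h => exact .hyp h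
    | impI _ h => exact .impI h
    | impE _ _ h₁ h₂ => exact .impE h₁ h₂
    | raa _ h => exact .raa h
    | allI _ h => exact .allI h
    | allE t _ h => exact .allE t h
    | eqRefl t => exact .eqRefl t
    | eqSubst φ _ _ h₁ h₂ => exact .eqSubst φ h₁ h₂

/-! ### Soundness -/

section Soundness

variable {M : Type} [L.Structure M] {α : Type}

theorem realize_inst_σ (t : L.Term α) (v : α → M) {k : ℕ} (xs : Fin k → M) :
    (fun a => (inst.σ t a).realize (Sum.elim v xs)) =
      Sum.elim v (Fin.cons (t.realize v) xs : Fin (k + 1) → M) := by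
  funext a
  rcases a with a | a
  · rfl
  · refine Fin.cases ?_ (fun j => ?_) a
    · simp [inst.σ, Function.comp_def]
    · simp [inst.σ]

theorem cons_snoc {k : ℕ} (a b : M) (xs : Fin k → M) :
    (Fin.snoc (Fin.cons a xs : Fin (k + 1) → M) b : Fin (k + 2) → M) =
      Fin.cons a (Fin.snoc xs b : Fin (k + 1) → M) :=
  (Fin.cons_snoc_eq_snoc_cons (β := M) a xs b).symm

/-- The instantiated variable is the first entry of the tuple of bound values, while a quantifier
appends its value at the end; by `cons_snoc` the two do not interfere. -/
theorem realize_inst (t : L.Term α) (v : α → M) : ∀ {k : ℕ} (φ : L.BoundedFormula α (k + 1))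
    (xs : Fin k → M),
    (inst t φ).Realize v xs ↔ φ.Realize v (Fin.cons (t.realize v) xs : Fin (k + 1) → M)
  | _, .falsum, _ => by simp only [inst, BoundedFormula.Realize]
  | _, .equal _ _, _ => by
    simp only [inst, BoundedFormula.Realize, Term.realize_subst, realize_inst_σ]
  | _, .rel _ _, _ => by
    simp only [inst, BoundedFormula.Realize, Term.realize_subst, realize_inst_σ]
  | _, .imp φ ψ, xs => by
    simp only [inst, BoundedFormula.realize_imp, realize_inst t v φ, realize_inst t v ψ]
  | _, .all φ, xs => by
    simp only [inst, BoundedFormula.realize_all, realize_inst t v φ, cons_snoc]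

theorem realize_shift {k : ℕ} (φ : L.BoundedFormula ℕ k) (v : ℕ → M) (xs : Fin k → M) :
    (shift φ).Realize v xs ↔ φ.Realize (fun i => v (i + 1)) xs := by
  simp [shift, BoundedFormula.realize_subst]

theorem realize_ofSentence (φ : L.Sentence) (v : ℕ → M) : (ofSentence φ).Realize v ↔ M ⊨ φ := by
  simp only [ofSentence, Formula.Realize, BoundedFormula.realize_subst, Sentence.Realize]
  rw [Subsingleton.elim (fun a => _) (default : Empty → M)]

theorem cons_default (a : M) (xs : Fin 0 → M) :
    (Fin.cons a xs : Fin 1 → M) = Fin.snoc (default : Fin 0 → M) a := by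
  funext i
  rw [show i = Fin.last 0 from Subsingleton.elim (α := Fin 1) _ _, Fin.snoc_last]
  rfl

theorem Der.sound {A : Set (L.Formula ℕ)} (hA : ∀ φ ∈ A, ∀ v : ℕ → M, φ.Realize v)
    {Γ : List (L.Formula ℕ)} {φ : L.Formula ℕ} (h : Der A Γ φ) :
    ∀ v : ℕ → M, (∀ ψ ∈ Γ, ψ.Realize v) → φ.Realize v := by
  induction h with
  | ax h => exact fun v _ => hA _ h v
  | hyp h => exact fun v hv => hv _ h
  | impI _ h => exact fun v hv hφ => h v (by simpa using ⟨hφ, hv⟩)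
  | impE _ _ h₁ h₂ => exact fun v hv => h₁ v hv (h₂ v hv)
  | raa _ h => exact fun v hv => by_contra fun hφ => h v (by simpa using ⟨hφ, hv⟩)
  | @allI Γ φ _ h =>
    intro v hv
    rw [Formula.Realize, BoundedFormula.realize_all]
    intro a
    -- The value `a` goes to the fresh variable and the old values move up by one, so the shifted
    -- assumptions keep their truth values.
    have := h (fun i => Nat.casesOn i a v) (by
      simp only [List.mem_map, forall_exists_index, and_imp, forall_apply_eq_imp_iff₂]
      exact fun ψ hψ => (realize_shift _ _ _).2 (hv ψ hψ))
    rw [Formula.Realize, realize_inst, realize_shift, cons_default] at this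
    exact this
  | allE t _ h =>
    intro v hv
    rw [Formula.Realize, realize_inst, cons_default]
    exact h v hv _
  | eqRefl t => exact fun v _ => by simp [Formula.realize_equal]
  | eqSubst φ _ _ h₁ h₂ =>
    intro v hv
    have e := h₁ v hv
    have := h₂ v hv
    rw [Formula.realize_equal] at e
    rw [Formula.Realize, realize_inst] at this ⊢
    rwa [← e]

end Soundness

/-! ### Admissible rules -/

section Admissible

variable {A : Set (L.Formula ℕ)}

theorem Der.weaken {Γ : List (L.Formula ℕ)} {φ : L.Formula ℕ} (h : Der A Γ φ) :
    ∀ {Δ : List (L.Formula ℕ)}, Γ ⊆ Δ → Der A Δ φ := by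
  induction h with
  | ax h => exact fun _ => .ax h
  | hyp h => exact fun s => .hyp (s h)
  | impI _ h => exact fun s => .impI (h (List.cons_subset_cons _ s))
  | impE _ _ h₁ h₂ => exact fun s => .impE (h₁ s) (h₂ s)
  | raa _ h => exact fun s => .raa (h (List.cons_subset_cons _ s))
  | allI _ h => exact fun s => .allI (h (List.map_subset _ s))
  | allE t _ h => exact fun s => .allE t (h s)
  | eqRefl t => exact fun _ => .eqRefl t
  | eqSubst φ _ _ h₁ h₂ => exact fun s => .eqSubst φ (h₁ s) (h₂ s)

theorem term_equal_subst (s t : L.Term ℕ) (σ : ℕ → L.Term ℕ) :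
    (s.equal t).subst σ = (s.subst σ).equal (t.subst σ) := by
  simp only [Term.equal, Term.bdEqual, subst_equal, term_subst_relabel, term_relabel_subst]
  rfl

/-- Closure of the axioms under substitution is what makes the axiom case work, since axioms may
have free variables. -/
theorem Der.subst (hA : ∀ φ ∈ A, ∀ σ : ℕ → L.Term ℕ, φ.subst σ ∈ A) {Γ : List (L.Formula ℕ)}
    {φ : L.Formula ℕ} (h : Der A Γ φ) :
    ∀ σ : ℕ → L.Term ℕ, Der A (Γ.map fun ψ => ψ.subst σ) (φ.subst σ) := by
  induction h with
  | ax h => exact fun σ => .ax (hA _ h σ)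
  | hyp h => exact fun σ => .hyp (List.mem_map_of_mem h)
  | impI _ h => exact fun σ => .impI (h σ)
  | impE _ _ h₁ h₂ => exact fun σ => .impE (h₁ σ) (h₂ σ)
  | raa _ h => exact fun σ => .raa (h σ)
  | @allI Γ φ _ h =>
    intro σ
    refine Der.allI (φ := φ.subst σ) ?_
    -- Under `allI` the substitution is lifted: the fresh variable stays fixed and the substituted
    -- terms are shifted away from it.
    have := h (fun i => Nat.casesOn i (.var 0) fun j => (σ j).subst fun i => .var (i + 1))
    rw [inst_subst, subst_shift, List.map_map] at this
    rw [shift, subst_subst, List.map_map]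
    convert this using 2
    · funext ψ
      simp only [Function.comp, shift, subst_subst]
      rfl
    · rfl
  | allE t _ h => exact fun σ => by rw [inst_subst]; exact .allE _ (h σ)
  | eqRefl t => exact fun σ => by rw [term_equal_subst]; exact .eqRefl _
  | eqSubst φ _ _ h₁ h₂ =>
    intro σ
    have := h₁ σ
    rw [term_equal_subst] at this
    rw [inst_subst]
    refine .eqSubst _ this ?_
    rw [← inst_subst]
    exact h₂ σ

theorem Der.allI_fresh (hA : ∀ φ ∈ A, ∀ σ : ℕ → L.Term ℕ, φ.subst σ ∈ A)
    {Γ : List (L.Formula ℕ)} {φ : L.BoundedFormula ℕ 1} {z : ℕ} (hΓ : ∀ ψ ∈ Γ, FreeBelow z ψ)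
    (hφ : FreeBelow z φ) (h : Der A Γ (inst (.var z) φ)) : Der A Γ (∀' φ) := by
  refine .allI ?_
  -- This renaming acts as the shift on the variables below `z` and sends `z` to the variable 0, so
  -- it produces the premise of `allI`.
  have := h.subst hA fun i => if i = z then .var 0 else .var (i + 1)
  rw [inst_subst] at this
  convert this using 1
  · refine List.map_congr_left fun ψ hψ => hΓ ψ hψ _ _ fun i hi => ?_
    rw [if_neg hi.ne]
  · congr 1
    · simp
    · refine hφ _ _ fun i hi => ?_
      rw [if_neg hi.ne]

theorem Der.cut {Γ : List (L.Formula ℕ)} {φ ψ : L.Formula ℕ} (h₁ : Der A Γ φ)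
    (h₂ : Der A (φ :: Γ) ψ) : Der A Γ ψ :=
  .impE (.impI h₂) h₁

theorem Der.efq {Γ : List (L.Formula ℕ)} {φ : L.Formula ℕ} (h : Der A Γ ⊥) : Der A Γ φ :=
  .raa (h.weaken (List.subset_cons_self _ _))

end Admissible

end Calculus

/-! ### Completeness -/

section Completeness

instance : Countable (Σ l, LA.Functions l) := by
  let f : (Σ l, LA.Functions l) → ℕ := fun p => match p with
    | ⟨_, .zero⟩ => 0
    | ⟨_, .one⟩ => 1
    | ⟨_, .add⟩ => 2
    | ⟨_, .mul⟩ => 3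
  refine Function.Injective.countable (f := f) ?_
  rintro ⟨_, _ | _⟩ ⟨_, _ | _⟩ h <;> first | rfl | (exfalso; revert h; decide)

instance : Countable (Σ l, LA.Relations l) := by
  refine Function.Injective.countable (f := fun _ => 0) ?_
  rintro ⟨_, ⟨⟩⟩ ⟨_, ⟨⟩⟩ _
  rfl

instance : Countable LA.Symbols :=
  inferInstanceAs (Countable ((Σ l, LA.Functions l) ⊕ (Σ l, LA.Relations l)))

/-- A maximal consistent set of formulas with witnesses. -/
structure IsHenkin (A : Set (LA.Formula ℕ)) (S : Set (LA.Formula ℕ)) : Prop where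
  consistent : ∀ Γ : List (LA.Formula ℕ), (∀ φ ∈ Γ, φ ∈ S) → ¬Der A Γ ⊥
  maximal : ∀ φ : LA.Formula ℕ, φ ∈ S ∨ (φ ⟹ ⊥) ∈ S
  witness : ∀ φ : LA.BoundedFormula ℕ 1, (∀' φ) ∉ S → ∃ z : ℕ, inst (.var z) φ ∉ S

variable {A : Set (LA.Formula ℕ)}

theorem exists_freeBelow_list (Γ : List (LA.Formula ℕ)) :
    ∃ N, ∀ φ ∈ Γ, FreeBelow N φ := by
  induction Γ with
  | nil => exact ⟨0, by simp⟩
  | cons φ Γ ih =>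
    obtain ⟨N, hN⟩ := ih
    obtain ⟨N', hN'⟩ := exists_freeBelow φ
    refine ⟨max N N', ?_⟩
    simp only [List.mem_cons, forall_eq_or_imp]
    exact ⟨hN'.mono (le_max_right _ _), fun ψ hψ => (hN ψ hψ).mono (le_max_left _ _)⟩

/-- One step of the Henkin construction: `ψ` is decided, and a refuted universal statement receives
a counterexample. Contexts are finite, so a variable can serve as the witness and no new constants
are needed. -/
theorem exists_henkin_extension (hA : ∀ φ ∈ A, ∀ σ : ℕ → LA.Term ℕ, φ.subst σ ∈ A)
    {Γ : List (LA.Formula ℕ)} (hΓ : ¬Der A Γ ⊥) (ψ : LA.Formula ℕ) :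
    ∃ Δ : List (LA.Formula ℕ), Γ ⊆ Δ ∧ ¬Der A Δ ⊥ ∧ (ψ ∈ Δ ∨ ((ψ ⟹ ⊥) ∈ Δ ∧
      ∀ θ : LA.BoundedFormula ℕ 1, ψ = ∀' θ → ∃ z : ℕ, (inst (.var z) θ ⟹ ⊥) ∈ Δ)) := by
  by_cases h : Der A (ψ :: Γ) ⊥
  · have h' : ¬Der A ((ψ ⟹ ⊥) :: Γ) ⊥ := fun h' => hΓ (Der.cut (.raa h') h)
    by_cases hψ : ∃ θ : LA.BoundedFormula ℕ 1, ψ = ∀' θ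
    · obtain ⟨θ, rfl⟩ := hψ
      obtain ⟨N, hN⟩ := exists_freeBelow_list (((∀' θ) ⟹ ⊥) :: Γ)
      obtain ⟨N', hN'⟩ := exists_freeBelow θ
      refine ⟨(inst (.var (max N N')) θ ⟹ ⊥) :: ((∀' θ) ⟹ ⊥) :: Γ,
        fun φ hφ => by simp [hφ], fun hd => h' ?_, Or.inr ⟨by simp, ?_⟩⟩
      -- If the counterexample were inconsistent, `θ` would be derivable at a fresh variable, hence
      -- also its generalization, whose negation is in the context.
      · refine .impE (.hyp List.mem_cons_self) (Der.allI_fresh hA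
          (fun φ hφ => (hN φ hφ).mono (le_max_left _ _)) (hN'.mono (le_max_right _ _)) (.raa hd))
      · intro θ' e
        cases e
        exact ⟨_, List.mem_cons_self⟩
    · exact ⟨_, List.subset_cons_self _ _, h', Or.inr ⟨List.mem_cons_self,
        fun θ e => (hψ ⟨θ, e⟩).elim⟩⟩
  · exact ⟨_, List.subset_cons_self _ _, h, Or.inl List.mem_cons_self⟩

/-- The extension step is iterated along an enumeration of the countably many formulas. A derivation
uses finitely many assumptions, all of them present at some stage, so the union is consistent. -/
theorem exists_isHenkin (hA : ∀ φ ∈ A, ∀ σ : ℕ → LA.Term ℕ, φ.subst σ ∈ A)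
    {Γ : List (LA.Formula ℕ)} (hΓ : ¬Der A Γ ⊥) :
    ∃ S, IsHenkin A S ∧ ∀ φ ∈ Γ, φ ∈ S := by
  obtain ⟨e, he⟩ := exists_surjective_nat (LA.Formula ℕ)
  choose next hsub hcons hmem using
    fun (Δ : {Δ : List (LA.Formula ℕ) // ¬Der A Δ ⊥}) ψ => exists_henkin_extension hA Δ.2 ψ
  let c : ℕ → {Δ : List (LA.Formula ℕ) // ¬Der A Δ ⊥} := fun n =>
    Nat.rec ⟨Γ, hΓ⟩ (fun n Δ => ⟨next Δ (e n), hcons Δ (e n)⟩) n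
  have hc : ∀ n, (c n).1 ⊆ (c (n + 1)).1 := fun n => hsub (c n) (e n)
  have hmono : ∀ {m n}, m ≤ n → (c m).1 ⊆ (c n).1 := by
    intro m n h
    induction h with
    | refl => exact List.Subset.refl _
    | step _ ih => exact List.Subset.trans ih (hc _)
  have hlist : ∀ Δ : List (LA.Formula ℕ), (∀ φ ∈ Δ, ∃ n, φ ∈ (c n).1) → ∃ n, Δ ⊆ (c n).1 := by
    intro Δ
    induction Δ with
    | nil => exact fun _ => ⟨0, by simp⟩
    | cons φ Δ ih =>
      intro h
      obtain ⟨n, hn⟩ := ih fun ψ hψ => h ψ (List.mem_cons_of_mem _ hψ)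
      obtain ⟨m, hm⟩ := h φ List.mem_cons_self
      exact ⟨max m n, List.cons_subset.2 ⟨hmono (le_max_left _ _) hm,
        List.Subset.trans hn (hmono (le_max_right _ _))⟩⟩
  have hcon : ∀ Δ : List (LA.Formula ℕ), (∀ φ ∈ Δ, ∃ n, φ ∈ (c n).1) → ¬Der A Δ ⊥ := by
    intro Δ h hd
    obtain ⟨n, hn⟩ := hlist Δ h
    exact (c n).2 (hd.weaken hn)
  refine ⟨{φ | ∃ n, φ ∈ (c n).1}, ⟨hcon, fun φ => ?_, fun φ hφ => ?_⟩, fun φ hφ => ⟨0, hφ⟩⟩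
  · obtain ⟨n, rfl⟩ := he φ
    exact (hmem (c n) (e n)).imp (fun h => ⟨n + 1, h⟩) fun h => ⟨n + 1, h.1⟩
  · obtain ⟨n, hn⟩ := he (∀' φ)
    have := hmem (c n) (e n)
    rw [hn] at this
    obtain h | ⟨-, h⟩ := this
    · exact (hφ ⟨n + 1, by rw [← hn] at h ⊢; exact h⟩).elim
    · obtain ⟨z, hz⟩ := h φ rfl
      refine ⟨z, fun hz' => hcon [inst (.var z) φ, inst (.var z) φ ⟹ ⊥] ?_ ?_⟩
      · simp only [List.mem_cons, List.not_mem_nil, or_false, forall_eq_or_imp, forall_eq]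
        exact ⟨hz', n + 1, by rw [← hn] at hz; exact hz⟩
      · exact .impE (φ := inst (.var z) φ) (.hyp (by simp)) (.hyp (by simp))

namespace IsHenkin

variable {S : Set (LA.Formula ℕ)} (hS : IsHenkin A S)

include hS

theorem mem_of_der {Γ : List (LA.Formula ℕ)} (hΓ : ∀ φ ∈ Γ, φ ∈ S) {φ : LA.Formula ℕ}
    (h : Der A Γ φ) : φ ∈ S := by
  refine (hS.maximal φ).resolve_right fun h' => hS.consistent ((φ ⟹ ⊥) :: Γ) ?_ ?_
  · simpa using ⟨h', hΓ⟩
  · exact .impE (.hyp List.mem_cons_self) (h.weaken (List.subset_cons_self _ _))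

theorem bot_notMem : (⊥ : LA.Formula ℕ) ∉ S := fun h =>
  hS.consistent [⊥] (by simpa using h) (.hyp (by simp))

theorem imp_mem_iff {φ ψ : LA.Formula ℕ} : (φ ⟹ ψ) ∈ S ↔ (φ ∈ S → ψ ∈ S) := by
  constructor
  · intro h h'
    exact hS.mem_of_der (Γ := [φ ⟹ ψ, φ]) (by simpa using ⟨h, h'⟩)
      (.impE (φ := φ) (.hyp (by simp)) (.hyp (by simp)))
  · intro h
    rcases hS.maximal φ with hφ | hφ
    · exact hS.mem_of_der (Γ := [ψ]) (by simpa using h hφ) (.impI (.hyp (by simp)))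
    · exact hS.mem_of_der (Γ := [φ ⟹ ⊥]) (by simpa using hφ)
        (.impI (.efq (.impE (φ := φ) (.hyp (by simp)) (.hyp (by simp)))))

theorem all_mem_iff {φ : LA.BoundedFormula ℕ 1} : (∀' φ) ∈ S ↔ ∀ t, inst t φ ∈ S := by
  constructor
  · intro h t
    exact hS.mem_of_der (Γ := [∀' φ]) (by simpa using h) (.allE t (.hyp (by simp)))
  · intro h
    by_contra h'
    obtain ⟨z, hz⟩ := hS.witness φ h'
    exact hz (h _)

theorem eq_refl_mem (t : LA.Term ℕ) : t.equal t ∈ S :=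
  hS.mem_of_der (Γ := []) (by simp) (.eqRefl t)

theorem eq_subst_mem (φ : LA.BoundedFormula ℕ 1) {s t : LA.Term ℕ} (h : s.equal t ∈ S)
    (h' : inst s φ ∈ S) : inst t φ ∈ S :=
  hS.mem_of_der (Γ := [s.equal t, inst s φ]) (by simpa using ⟨h, h'⟩)
    (.eqSubst φ (s := s) (.hyp (by simp)) (.hyp (by simp)))

omit hS in
theorem relabel_subst_inst_σ {k : ℕ} (s u : LA.Term ℕ) :
    (s.relabel (Sum.inl : ℕ → ℕ ⊕ Fin (k + 1))).subst (inst.σ u) =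
      s.relabel (Sum.inl : ℕ → ℕ ⊕ Fin k) := by
  rw [term_subst_relabel, ← term_subst_var (s.relabel Sum.inl), term_subst_relabel]
  rfl

omit hS in
theorem inst_var (u : LA.Term ℕ) :
    (inst.σ u (Sum.inr 0) : LA.Term (ℕ ⊕ Fin 0)) = u.relabel Sum.inl := rfl

omit hS in
theorem add_eq {α : Type} (s t : LA.Term α) :
    s + t = Term.func (L := LA) ArithFunc.add ![s, t] := rfl

omit hS in
theorem mul_eq {α : Type} (s t : LA.Term α) :
    s * t = Term.func (L := LA) ArithFunc.mul ![s, t] := rfl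

omit hS in
theorem term_add_subst {α β : Type} (s t : LA.Term α) (f : α → LA.Term β) :
    (s + t).subst f = s.subst f + t.subst f := by
  simp only [add_eq, Term.subst]
  congr 1
  funext i
  fin_cases i <;> rfl

omit hS in
theorem term_mul_subst {α β : Type} (s t : LA.Term α) (f : α → LA.Term β) :
    (s * t).subst f = s.subst f * t.subst f := by
  simp only [mul_eq, Term.subst]
  congr 1
  funext i
  fin_cases i <;> rfl

omit hS in
theorem term_add_relabel {α β : Type} (s t : LA.Term α) (f : α → β) :
    (s + t).relabel f = s.relabel f + t.relabel f := by
  simp only [add_eq, Term.relabel]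
  congr 1
  funext i
  fin_cases i <;> rfl

omit hS in
theorem term_mul_relabel {α β : Type} (s t : LA.Term α) (f : α → β) :
    (s * t).relabel f = s.relabel f * t.relabel f := by
  simp only [mul_eq, Term.relabel]
  congr 1
  funext i
  fin_cases i <;> rfl

theorem eq_symm_mem {s t : LA.Term ℕ} (h : s.equal t ∈ S) : t.equal s ∈ S := by
  have := hS.eq_subst_mem (.equal (y 0) (s.relabel Sum.inl)) h
  simp only [inst, relabel_subst_inst_σ, Term.subst, inst_var] at this
  exact this (hS.eq_refl_mem s)

theorem eq_trans_mem {s t u : LA.Term ℕ} (h : s.equal t ∈ S) (h' : t.equal u ∈ S) :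
    s.equal u ∈ S := by
  have := hS.eq_subst_mem (.equal (s.relabel Sum.inl) (y 0)) h'
  simp only [inst, relabel_subst_inst_σ, Term.subst, inst_var] at this
  exact this h

theorem add_mem {s t s' t' : LA.Term ℕ} (h : s.equal s' ∈ S) (h' : t.equal t' ∈ S) :
    (s + t).equal (s' + t') ∈ S := by
  have h₁ := hS.eq_subst_mem (.equal ((s + t).relabel Sum.inl) (y 0 + t.relabel Sum.inl)) h
  have h₂ := hS.eq_subst_mem (.equal ((s + t).relabel Sum.inl) (s'.relabel Sum.inl + y 0)) h'
  simp only [inst, relabel_subst_inst_σ, Term.subst, inst_var, term_add_subst,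
    ← term_add_relabel] at h₁ h₂
  exact h₂ (h₁ (hS.eq_refl_mem _))

theorem mul_mem {s t s' t' : LA.Term ℕ} (h : s.equal s' ∈ S) (h' : t.equal t' ∈ S) :
    (s * t).equal (s' * t') ∈ S := by
  have h₁ := hS.eq_subst_mem (.equal ((s * t).relabel Sum.inl) (y 0 * t.relabel Sum.inl)) h
  have h₂ := hS.eq_subst_mem (.equal ((s * t).relabel Sum.inl) (s'.relabel Sum.inl * y 0)) h'
  simp only [inst, relabel_subst_inst_σ, Term.subst, inst_var, term_mul_subst,
    ← term_mul_relabel] at h₁ h₂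
  exact h₂ (h₁ (hS.eq_refl_mem _))

omit hS in
theorem inst_rel (u : LA.Term ℕ) {k l : ℕ} (R : LA.Relations l)
    (ts : Fin l → LA.Term (ℕ ⊕ Fin (k + 1))) :
    inst u (.rel R ts) = .rel R fun i => (ts i).subst (inst.σ u) := by
  rw [inst]

omit hS in
theorem inst_ltF (u : LA.Term ℕ) {k : ℕ} (s t : LA.Term (ℕ ⊕ Fin (k + 1))) :
    inst u (s ≺ t) = (s.subst (inst.σ u) ≺ t.subst (inst.σ u)) := by
  refine (inst_rel u _ _).trans ?_
  refine congrArg (BoundedFormula.rel (L := LA) ArithRel.lt) ?_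
  funext i
  fin_cases i <;> rfl

theorem lt_mem {s t s' t' : LA.Term ℕ} (h : s.equal s' ∈ S) (h' : t.equal t' ∈ S)
    (hl : (s.relabel Sum.inl ≺ t.relabel Sum.inl : LA.Formula ℕ) ∈ S) :
    (s'.relabel Sum.inl ≺ t'.relabel Sum.inl : LA.Formula ℕ) ∈ S := by
  have h₁ := hS.eq_subst_mem (y 0 ≺ t.relabel Sum.inl) h
  have h₂ := hS.eq_subst_mem (s'.relabel Sum.inl ≺ y 0) h'
  simp only [inst_ltF, relabel_subst_inst_σ, Term.subst, inst_var] at h₁ h₂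
  exact h₂ (h₁ hl)

/-- Provable equality of terms. -/
def setoid : Setoid (LA.Term ℕ) where
  r s t := s.equal t ∈ S
  iseqv := ⟨hS.eq_refl_mem, hS.eq_symm_mem, hS.eq_trans_mem⟩

/-- The term model. -/
def TermModel : Type := Quotient hS.setoid

/-- The class of a term. -/
def cls (t : LA.Term ℕ) : hS.TermModel := Quotient.mk hS.setoid t

/-- The arithmetical structure on the term model. -/
@[reducible] def structureTermModel : LA.Structure hS.TermModel where
  funMap {_} f := match f with
    | .zero => fun _ => hS.cls 0
    | .one => fun _ => hS.cls 1
    | .add => fun v => Quotient.map₂ (· + ·) (fun _ _ h _ _ h' => hS.add_mem h h') (v 0) (v 1)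
    | .mul => fun v => Quotient.map₂ (· * ·) (fun _ _ h _ _ h' => hS.mul_mem h h') (v 0) (v 1)
  RelMap {_} R := match R with
    | .lt => fun v => Quotient.lift₂
      (fun s t => (s.relabel Sum.inl ≺ t.relabel Sum.inl : LA.Formula ℕ) ∈ S)
      (fun _ _ _ _ h h' => propext ⟨hS.lt_mem h h',
        hS.lt_mem (hS.eq_symm_mem h) (hS.eq_symm_mem h')⟩) (v 0) (v 1)

theorem realize_term (t : LA.Term ℕ) :
    letI := hS.structureTermModel
    t.realize (fun i => hS.cls (.var i)) = hS.cls t := by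
  let _ := hS.structureTermModel
  induction t with
  | var => rfl
  | func F ts ih =>
    simp only [Term.realize, ih]
    change ArithFunc _ at F
    cases F with
    | zero =>
      refine congrArg (fun ts => hS.cls (Term.func (L := LA) ArithFunc.zero ts)) ?_
      exact Subsingleton.elim _ _
    | one =>
      refine congrArg (fun ts => hS.cls (Term.func (L := LA) ArithFunc.one ts)) ?_
      exact Subsingleton.elim _ _
    | add =>
      refine congrArg (fun ts => hS.cls (Term.func (L := LA) ArithFunc.add ts)) ?_
      funext i
      fin_cases i <;> rfl
    | mul =>
      refine congrArg (fun ts => hS.cls (Term.func (L := LA) ArithFunc.mul ts)) ?_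
      funext i
      fin_cases i <;> rfl

omit hS in
theorem relabel_relabel_elim0 (t : LA.Term (ℕ ⊕ Fin 0)) :
    (t.relabel (Sum.elim id Fin.elim0)).relabel Sum.inl = t := by
  rw [Term.relabel_relabel]
  refine Eq.trans (congrArg (fun f => t.relabel f) ?_) (Term.relabel_id t)
  funext a
  rcases a with a | a
  · rfl
  · exact a.elim0

theorem realize_term_elim (t : LA.Term (ℕ ⊕ Fin 0)) (xs : Fin 0 → hS.TermModel) :
    letI := hS.structureTermModel
    t.realize (Sum.elim (fun i => hS.cls (.var i)) xs) =
      hS.cls (t.relabel (Sum.elim id Fin.elim0)) := by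
  let _ := hS.structureTermModel
  rw [← realize_term]
  conv_lhs => rw [← relabel_relabel_elim0 t]
  rw [Term.realize_relabel]
  rfl

omit hS in
/-- The number of logical symbols of a formula. -/
def size : ∀ {k : ℕ}, LA.BoundedFormula ℕ k → ℕ
  | _, .falsum => 0
  | _, .equal _ _ => 0
  | _, .rel _ _ => 0
  | _, .imp φ ψ => size φ + size ψ + 1
  | _, .all φ => size φ + 1

omit hS in
theorem size_inst (t : LA.Term ℕ) : ∀ {k : ℕ} (φ : LA.BoundedFormula ℕ (k + 1)),
    size (inst t φ) = size φ
  | _, .falsum => by simp only [inst, size]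
  | _, .equal _ _ => by simp only [inst, size]
  | _, .rel _ _ => by simp only [inst, size]
  | _, .imp φ ψ => by simp only [inst, size, size_inst t φ, size_inst t ψ]
  | _, .all φ => by simp only [inst, size, size_inst t φ]

/-- The truth lemma. The induction is on size, because the instances of a universal formula are not
subformulas of it but are smaller by `size_inst`. -/
theorem realize_iff_mem (n : ℕ) : ∀ φ : LA.Formula ℕ, size φ < n →
    letI := hS.structureTermModel
    (φ.Realize (fun i => hS.cls (.var i)) ↔ φ ∈ S) := by
  let _ := hS.structureTermModel
  induction n with
  | zero => exact fun φ h => absurd h (Nat.not_lt_zero _)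
  | succ n ih =>
    intro φ hφ
    match φ, hφ with
    | .falsum, _ => exact iff_of_false id hS.bot_notMem
    | .equal s t, _ =>
      rw [Formula.Realize, BoundedFormula.Realize, realize_term_elim, realize_term_elim]
      conv_rhs => rw [← relabel_relabel_elim0 s, ← relabel_relabel_elim0 t]
      exact (Quotient.eq (r := hS.setoid))
    | .rel R ts, _ =>
      rw [Formula.Realize, BoundedFormula.Realize]
      simp only [realize_term_elim]
      change ArithRel _ at R
      cases R with
      | lt =>
        have : BoundedFormula.rel (L := LA) ArithRel.lt ts =
            (((ts 0).relabel (Sum.elim id Fin.elim0)).relabel Sum.inl ≺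
              ((ts 1).relabel (Sum.elim id Fin.elim0)).relabel Sum.inl : LA.Formula ℕ) := by
          simp only [relabel_relabel_elim0]
          refine congrArg (BoundedFormula.rel (L := LA) ArithRel.lt) ?_
          funext i
          fin_cases i <;> rfl
        rw [this]
        rfl
    | .imp φ ψ, h =>
      rw [size] at h
      rw [hS.imp_mem_iff, ← ih φ (by omega), ← ih ψ (by omega)]
      rfl
    | .all φ, h =>
      rw [size] at h
      rw [hS.all_mem_iff]
      have key : ∀ t : LA.Term ℕ, inst t φ ∈ S ↔ φ.Realize (fun i => hS.cls (.var i))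
          (Fin.snoc (default : Fin 0 → hS.TermModel) (hS.cls t)) := by
        intro t
        rw [← ih (inst t φ) (by rw [size_inst]; omega), Formula.Realize, realize_inst,
          realize_term, cons_default]
      simp only [key]
      exact ⟨fun h t => h _, fun h a => Quotient.inductionOn a h⟩

end IsHenkin

/-- The completeness theorem for arithmetical theories that are closed under substitution. -/
theorem der_of_forall_realize (hA : ∀ φ ∈ A, ∀ σ : ℕ → LA.Term ℕ, φ.subst σ ∈ A)
    {ψ : LA.Formula ℕ} (h : ∀ (M : Type) [LA.Structure M],
      (∀ φ ∈ A, ∀ v : ℕ → M, φ.Realize v) → ∀ v : ℕ → M, ψ.Realize v) : Der A [] ψ := by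
  by_contra hψ
  obtain ⟨S, hS, hmem⟩ := exists_isHenkin (Γ := [ψ ⟹ ⊥]) hA fun hd => hψ (.raa hd)
  let _ := hS.structureTermModel
  have hM := h hS.TermModel (fun φ hφ v => ?_) fun i => hS.cls (.var i)
  · rw [hS.realize_iff_mem _ ψ (Nat.lt_succ_self _)] at hM
    exact hS.bot_notMem (hS.imp_mem_iff.1 (hmem _ (by simp)) hM)
  -- Every valuation in the term model comes from a substitution of terms, so the truth of an axiom
  -- under `v` is membership of a substitution instance, which is again an axiom.
  · have hv : v = fun i => (v i).out.realize fun i => hS.cls (.var i) := by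
      funext i
      rw [hS.realize_term]
      exact (Quotient.out_eq (v i)).symm
    rw [hv, Formula.Realize, ← BoundedFormula.realize_subst]
    exact (hS.realize_iff_mem _ _ (Nat.lt_succ_self _)).2
      (hS.mem_of_der (Γ := []) (by simp) (.ax (hA φ hφ _)))

end Completeness

/-! ### Definable relations and functions -/

section Definability

/-- The arithmetical structure given by the operations of `M`. -/
instance arithStructure (M : Type) [Zero M] [One M] [Add M] [Mul M] [LT M] : LA.Structure M where
  funMap {_} f := match f with
    | .zero => fun _ => 0
    | .one => fun _ => 1
    | .add => fun v => v 0 + v 1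
    | .mul => fun v => v 0 * v 1
  RelMap {_} R := match R with
    | .lt => fun v => v 0 < v 1

section Realize

variable {M α : Type} [Zero M] [One M] [Add M] [Mul M] [LT M] (v : α → M)

@[simp] theorem realize_zero : (0 : LA.Term α).realize v = 0 := rfl

@[simp] theorem realize_one : (1 : LA.Term α).realize v = 1 := rfl

@[simp] theorem realize_add (s t : LA.Term α) :
    (s + t).realize v = s.realize v + t.realize v := rfl

@[simp] theorem realize_mul (s t : LA.Term α) :
    (s * t).realize v = s.realize v * t.realize v := rfl

@[simp] theorem realize_ltF {n : ℕ} (xs : Fin n → M) (s t : LA.Term (α ⊕ Fin n)) :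
    (s ≺ t).Realize v xs ↔ s.realize (Sum.elim v xs) < t.realize (Sum.elim v xs) := Iff.rfl

end Realize

variable {M : Type}

/-- The relation `P` is definable, with parameters from `M`. -/
class Df [LA.Structure M] {n : ℕ} (P : (Fin n → M) → Prop) : Prop where
  out : ∃ φ : LA.BoundedFormula M n, ∀ v, φ.Realize id v ↔ P v

/-- The function `f` is definable, with parameters from `M`. -/
class DfF [LA.Structure M] {n : ℕ} (f : (Fin n → M) → M) : Prop where
  out : Df fun w : Fin (n + 1) → M => w (Fin.last n) = f fun i => w i.castSucc

section

variable [LA.Structure M] {n : ℕ}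

/-- Turning the arguments into free variables makes relabelling and substitution of formulas
available. -/
theorem df_iff {P : (Fin n → M) → Prop} :
    Df P ↔ ∃ φ : LA.Formula (M ⊕ Fin n), ∀ v, φ.Realize (Sum.elim id v) ↔ P v := by
  constructor
  · rintro ⟨φ, hφ⟩
    refine ⟨φ.toFormula, fun v => ?_⟩
    rw [← hφ, BoundedFormula.realize_toFormula]
    rfl
  · rintro ⟨φ, hφ⟩
    refine ⟨BoundedFormula.relabel (n := n) (k := 0) id φ, fun v => ?_⟩
    rw [← hφ]
    simp only [BoundedFormula.realize_relabel, Formula.Realize]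
    refine iff_of_eq (congrArg₂ _ ?_ (Subsingleton.elim _ _))
    funext a
    rcases a with a | a <;> rfl

theorem Df.congr {P Q : (Fin n → M) → Prop} (hP : Df P) (h : ∀ v, P v ↔ Q v) : Df Q := by
  rwa [show Q = P from funext fun v => propext (h v).symm]

instance Df.imp {P Q : (Fin n → M) → Prop} [hP : Df P] [hQ : Df Q] : Df fun v => P v → Q v := by
  obtain ⟨φ, hφ⟩ := hP
  obtain ⟨ψ, hψ⟩ := hQ
  exact ⟨φ ⟹ ψ, fun v => by rw [BoundedFormula.realize_imp, hφ, hψ]⟩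

/-- Parameters are allowed, so anything independent of the arguments is definable, by either ⊤ or ⊥.
-/
instance Df.const {p : Prop} : Df fun _ : Fin n → M => p := by
  by_cases hp : p
  · exact ⟨⊤, by simp [hp]⟩
  · exact ⟨⊥, by simp [hp]⟩

instance Df.not {P : (Fin n → M) → Prop} [hP : Df P] : Df fun v => ¬P v :=
  Df.imp (Q := fun _ => False)

instance Df.and {P Q : (Fin n → M) → Prop} [hP : Df P] [hQ : Df Q] : Df fun v => P v ∧ Q v := by
  obtain ⟨φ, hφ⟩ := hP
  obtain ⟨ψ, hψ⟩ := hQ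
  exact ⟨φ ⊓ ψ, fun v => by rw [BoundedFormula.realize_inf, hφ, hψ]⟩

instance Df.or {P Q : (Fin n → M) → Prop} [hP : Df P] [hQ : Df Q] : Df fun v => P v ∨ Q v := by
  obtain ⟨φ, hφ⟩ := hP
  obtain ⟨ψ, hψ⟩ := hQ
  exact ⟨φ ⊔ ψ, fun v => by rw [BoundedFormula.realize_sup, hφ, hψ]⟩

instance Df.iff {P Q : (Fin n → M) → Prop} [hP : Df P] [hQ : Df Q] : Df fun v => (P v ↔ Q v) :=
  Df.congr (P := fun v => (P v → Q v) ∧ (Q v → P v)) inferInstance fun _ => iff_def.symm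

omit [LA.Structure M] in
theorem snoc_castSucc (w : Fin n → M) (a : M) :
    (fun i : Fin n => (Fin.snoc w a : Fin (n + 1) → M) i.castSucc) = w :=
  funext fun _ => Fin.snoc_castSucc (α := fun _ => M) _ _ _

omit [LA.Structure M] in
theorem snoc_last (w : Fin n → M) (a : M) :
    (Fin.snoc w a : Fin (n + 1) → M) (Fin.last n) = a :=
  Fin.snoc_last (α := fun _ => M) _ _

instance Df.all {P : (Fin n → M) → M → Prop}
    [h : Df fun w : Fin (n + 1) → M => P (fun i => w i.castSucc) (w (Fin.last n))] :
    Df fun v => ∀ a, P v a := by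
  obtain ⟨φ, hφ⟩ := h
  exact ⟨∀' φ, fun v => by simp only [BoundedFormula.realize_all, hφ, snoc_castSucc, snoc_last]⟩

instance Df.ex {P : (Fin n → M) → M → Prop}
    [h : Df fun w : Fin (n + 1) → M => P (fun i => w i.castSucc) (w (Fin.last n))] :
    Df fun v => ∃ a, P v a := by
  obtain ⟨φ, hφ⟩ := h
  exact ⟨∃' φ, fun v => by simp only [BoundedFormula.realize_ex, hφ, snoc_castSucc, snoc_last]⟩

theorem Df.rename {m : ℕ} {P : (Fin m → M) → Prop} (hP : Df P) (ρ : Fin m → Fin n) :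
    Df fun w : Fin n → M => P fun i => w (ρ i) := by
  rw [df_iff] at hP ⊢
  obtain ⟨φ, hφ⟩ := hP
  refine ⟨φ.relabel (Sum.map id ρ), fun v => ?_⟩
  rw [← hφ, Formula.realize_relabel]
  refine iff_of_eq (congrArg _ ?_)
  funext a
  rcases a with a | a <;> rfl

theorem DfF.of_term (t : LA.Term (M ⊕ Fin n)) : DfF fun v => t.realize (Sum.elim id v) := by
  refine ⟨⟨.equal (.var (.inr (Fin.last n)))
    (t.relabel (Sum.map id Fin.castSucc)), fun v => ?_⟩⟩
  simp only [BoundedFormula.Realize, Term.realize_var, Sum.elim_inr, Term.realize_relabel]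
  refine iff_of_eq (congrArg _ (congrArg (fun u => t.realize u) ?_))
  funext a
  rcases a with a | a <;> rfl

instance DfF.var {i : Fin n} : DfF fun v : Fin n → M => v i :=
  DfF.of_term (.var (.inr i))

instance DfF.const {a : M} : DfF fun _ : Fin n → M => a :=
  DfF.of_term (.var (.inl a))

theorem DfF.rename {m : ℕ} {f : (Fin m → M) → M} (hf : DfF f) (ρ : Fin m → Fin n) :
    DfF fun w : Fin n → M => f fun i => w (ρ i) :=
  ⟨(hf.out.rename (Fin.snoc (α := fun _ => Fin (n + 1)) (fun i => (ρ i).castSucc)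
    (Fin.last n))).congr fun w => by simp⟩

/-- The functions have definable graphs but need not be terms; composition therefore quantifies over
their values. -/
theorem Df.comp {m : ℕ} {P : (Fin m → M) → Prop} (hP : Df P) (f : Fin m → (Fin n → M) → M)
    (hf : ∀ i, DfF (f i)) : Df fun v => P fun i => f i v := by
  rw [df_iff] at hP ⊢
  obtain ⟨φ, hφ⟩ := hP
  choose ψ hψ using fun i => df_iff.1 (hf i).out
  refine ⟨Formula.iExs (Fin m) (Formula.iInf (fun i => (ψ i).relabel
    (Sum.elim (fun a => .inl (.inl a)) (Fin.snoc (α := fun _ => (M ⊕ Fin n) ⊕ Fin m)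
      (fun j => .inl (.inr j)) (.inr i)))) ⊓ φ.relabel (Sum.elim (fun a => .inl (.inl a)) .inr)),
    fun v => ?_⟩
  rw [Formula.realize_iExs]
  simp only [Formula.realize_inf, Formula.realize_iInf, Formula.realize_relabel]
  have h₁ : ∀ (z : Fin m → M) (i : Fin m), (Sum.elim (Sum.elim id v) z ∘
      Sum.elim (fun a => Sum.inl (Sum.inl a)) (Fin.snoc (α := fun _ => (M ⊕ Fin n) ⊕ Fin m)
        (fun j => .inl (.inr j)) (.inr i)) : M ⊕ Fin (n + 1) → M) =
      Sum.elim id (Fin.snoc v (z i) : Fin (n + 1) → M) := by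
    intro z i
    funext a
    rcases a with a | a
    · rfl
    · refine Fin.lastCases ?_ (fun j => ?_) a <;> simp
  have h₂ : ∀ z : Fin m → M, (Sum.elim (Sum.elim id v) z ∘
      Sum.elim (fun a => Sum.inl (Sum.inl a)) Sum.inr : M ⊕ Fin m → M) = Sum.elim id z := by
    intro z
    funext a
    rcases a with a | a <;> rfl
  simp only [h₁, h₂, hψ, hφ, snoc_castSucc, snoc_last]
  constructor
  · rintro ⟨z, hz, hP⟩
    rwa [← funext hz]
  · exact fun h => ⟨_, fun _ => rfl, h⟩

theorem Df.comp₁ {P : M → Prop} (hP : Df fun v : Fin 1 → M => P (v 0)) {f : (Fin n → M) → M}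
    (hf : DfF f) : Df fun v => P (f v) :=
  hP.comp ![f] (by simpa using hf)

theorem Df.comp₂ {P : M → M → Prop} (hP : Df fun v : Fin 2 → M => P (v 0) (v 1))
    {f g : (Fin n → M) → M} (hf : DfF f) (hg : DfF g) : Df fun v => P (f v) (g v) :=
  hP.comp ![f, g] (by simp [Fin.forall_fin_succ, hf, hg])

theorem Df.comp₃ {P : M → M → M → Prop} (hP : Df fun v : Fin 3 → M => P (v 0) (v 1) (v 2))
    {f g h : (Fin n → M) → M} (hf : DfF f) (hg : DfF g) (hh : DfF h) :
    Df fun v => P (f v) (g v) (h v) :=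
  hP.comp ![f, g, h] (by simp [Fin.forall_fin_succ, hf, hg, hh])

theorem Df.comp₄ {P : M → M → M → M → Prop}
    (hP : Df fun v : Fin 4 → M => P (v 0) (v 1) (v 2) (v 3))
    {f g h k : (Fin n → M) → M} (hf : DfF f) (hg : DfF g) (hh : DfF h) (hk : DfF k) :
    Df fun v => P (f v) (g v) (h v) (k v) :=
  hP.comp ![f, g, h, k] (by simp [Fin.forall_fin_succ, hf, hg, hh, hk])

theorem Df.formula {m : ℕ} (φ : LA.Formula (Fin m)) : Df fun v : Fin m → M => φ.Realize v :=
  df_iff.2 ⟨φ.relabel Sum.inr, fun v => by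
    rw [Formula.realize_relabel]
    rfl⟩

instance Df.eq {f g : (Fin n → M) → M} [hf : DfF f] [hg : DfF g] : Df fun v => f v = g v :=
  Df.comp₂ (P := fun a b => a = b) ⟨.equal (y 0) (y 1), fun _ => Iff.rfl⟩ hf hg

/-- Composition with a function whose graph is definable. -/
theorem DfF.comp₁ {F : M → M} (hF : Df fun v : Fin 2 → M => v 0 = F (v 1)) {f : (Fin n → M) → M}
    (hf : DfF f) : DfF fun v => F (f v) :=
  ⟨Df.comp₂ (P := fun a b => a = F b) hF DfF.var (hf.rename Fin.castSucc)⟩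

theorem DfF.comp₂ {F : M → M → M} (hF : Df fun v : Fin 3 → M => v 0 = F (v 1) (v 2))
    {f g : (Fin n → M) → M} (hf : DfF f) (hg : DfF g) : DfF fun v => F (f v) (g v) :=
  ⟨Df.comp₃ (P := fun a b c => a = F b c) hF DfF.var (hf.rename Fin.castSucc)
    (hg.rename Fin.castSucc)⟩

end

section

variable [Zero M] [One M] [Add M] [Mul M] {n : ℕ}

instance Df.lt [LT M] {f g : (Fin n → M) → M} [hf : DfF f] [hg : DfF g] :
    Df fun v => f v < g v :=
  Df.comp₂ (P := fun a b => a < b) ⟨y 0 ≺ y 1, fun _ => Iff.rfl⟩ hf hg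

instance Df.le [LinearOrder M] {f g : (Fin n → M) → M} [hf : DfF f] [hg : DfF g] :
    Df fun v => f v ≤ g v :=
  Df.congr (P := fun v => ¬g v < f v) inferInstance fun _ => not_lt

instance DfF.add [LT M] {f g : (Fin n → M) → M} [hf : DfF f] [hg : DfF g] :
    DfF fun v => f v + g v :=
  DfF.comp₂ (F := (· + ·)) ⟨y 0 ≐ y 1 + y 2, fun _ => Iff.rfl⟩ hf hg

instance DfF.mul [LT M] {f g : (Fin n → M) → M} [hf : DfF f] [hg : DfF g] :
    DfF fun v => f v * g v :=
  DfF.comp₂ (F := (· * ·)) ⟨y 0 ≐ y 1 * y 2, fun _ => Iff.rfl⟩ hf hg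

end

end Definability

/-! ### Models of Peano Arithmetic -/

/-- Models of Peano Arithmetic, as ordered semirings. -/
class PeanoModel (M : Type) extends CommSemiring M, LinearOrder M, IsStrictOrderedRing M,
    CanonicallyOrderedAdd M, Sub M, OrderedSub M where
  add_one_le_of_lt' : ∀ a b : M, a < b → a + 1 ≤ b
  ind : ∀ P : M → Prop, (Df fun v : Fin 1 → M => P (v 0)) → P 0 → (∀ a, P a → P (a + 1)) → ∀ a, P a

section Models

section

variable {M α β : Type} [Zero M] [One M] [Add M] [Mul M] [LT M]

omit [Zero M] [One M] [Add M] [Mul M] [LT M] in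
theorem term_zero_subst (f : α → LA.Term β) : (0 : LA.Term α).subst f = 0 :=
  congrArg (Term.func (L := LA) ArithFunc.zero) (Subsingleton.elim _ _)

omit [Zero M] [One M] [Add M] [Mul M] [LT M] in
theorem term_one_subst (f : α → LA.Term β) : (1 : LA.Term α).subst f = 1 :=
  congrArg (Term.func (L := LA) ArithFunc.one) (Subsingleton.elim _ _)

/-- The substitution on terms that underlies `atSucc`. -/
def succSubst (k : ℕ) : α ⊕ Fin k → LA.Term (α ⊕ Fin k) :=
  Sum.elim (fun a => x a) fun j => if (j : ℕ) = 0 then y j + 1 else y j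

omit [Zero M] [One M] [Add M] [Mul M] [LT M] in
theorem atSucc_subst (f : α → LA.Term β) {k : ℕ} (φ : LA.BoundedFormula α k) :
    (atSucc φ).subst f = atSucc (φ.subst f) := by
  have key : ∀ {k : ℕ} (t : LA.Term (α ⊕ Fin k)),
      (t.subst (succSubst k)).subst (substLift f k) =
        (t.subst (substLift f k)).subst (succSubst k) := by
    intro k t
    rw [term_subst_subst, term_subst_subst]
    congr 1
    funext a
    rcases a with a | a
    · simp only [succSubst, substLift, Sum.elim_inl, Term.subst, Function.comp,
        term_subst_relabel]
      refine Eq.trans (b := (f a).subst (Term.var ∘ Sum.inl)) ?_ rfl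
      rw [← term_subst_relabel, term_subst_var]
    · simp only [succSubst, substLift, Sum.elim_inr, Term.subst, Function.comp]
      split_ifs
      · rw [IsHenkin.term_add_subst, term_one_subst]
        rfl
      · rfl
  induction φ with
  | falsum => rfl
  | equal s t => exact congrArg₂ BoundedFormula.equal (key s) (key t)
  | rel R ts => exact congrArg (BoundedFormula.rel R) (funext fun i => key (ts i))
  | imp φ ψ h₁ h₂ => exact congrArg₂ BoundedFormula.imp h₁ h₂
  | all φ h => exact congrArg BoundedFormula.all h

theorem realize_succSubst (v : α → M) {k : ℕ} (t : LA.Term (α ⊕ Fin k)) (xs : Fin k → M) :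
    (t.subst (succSubst k)).realize (Sum.elim v xs) =
      t.realize (Sum.elim v fun j : Fin k => if (j : ℕ) = 0 then xs j + 1 else xs j) := by
  rw [Term.realize_subst]
  congr 1
  funext a
  rcases a with a | a
  · rfl
  · by_cases h : (a : ℕ) = 0 <;> simp [h, succSubst]

theorem realize_atSucc (v : α → M) : ∀ {k : ℕ} (φ : LA.BoundedFormula α (k + 1))
    (xs : Fin (k + 1) → M), (atSucc φ).Realize v xs ↔
      φ.Realize v (fun j => if (j : ℕ) = 0 then xs j + 1 else xs j)
  | _, .falsum, _ => Iff.rfl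
  | _, .equal _ _, _ =>
    iff_of_eq (congrArg₂ Eq (realize_succSubst _ _ _) (realize_succSubst _ _ _))
  | _, .rel R _, _ =>
    iff_of_eq (congrArg (Structure.RelMap R) (funext fun _ => realize_succSubst _ _ _))
  | _, .imp φ ψ, xs => imp_congr (realize_atSucc v φ xs) (realize_atSucc v ψ xs)
  | _, .all φ, xs => by
    refine forall_congr' fun a => (realize_atSucc v φ _).trans (iff_of_eq (congrArg _ ?_))
    funext j
    refine Fin.lastCases ?_ (fun j => ?_) j
    · simp
    · simp only [Fin.val_castSucc, Fin.snoc_castSucc]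

/-- The induction axiom for `φ`, with the parameters as free variables. -/
def openInduction (φ : LA.BoundedFormula ℕ 1) : LA.Formula ℕ :=
  inst 0 φ ⟹ ((∀' (φ ⟹ atSucc φ)) ⟹ ∀' φ)

omit [Zero M] [One M] [Add M] [Mul M] [LT M] in
theorem snoc_default_eq (a : M) : (Fin.snoc (default : Fin 0 → M) a : Fin 1 → M) = fun _ => a := by
  funext i
  rw [show i = Fin.last 0 from Subsingleton.elim (α := Fin 1) _ _, Fin.snoc_last]

theorem realize_inst_zero (φ : LA.BoundedFormula α 1) (v : α → M) (xs : Fin 0 → M) :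
    (inst 0 φ).Realize v xs ↔ φ.Realize v fun _ => 0 := by
  rw [realize_inst, cons_default, snoc_default_eq]
  rfl

theorem realize_all_one (φ : LA.BoundedFormula α 1) (v : α → M) (xs : Fin 0 → M) :
    (∀' φ).Realize v xs ↔ ∀ a, φ.Realize v fun _ => a := by
  rw [BoundedFormula.realize_all]
  simp only [Subsingleton.elim xs default, snoc_default_eq]

theorem realize_imp_atSucc (φ : LA.BoundedFormula α 1) (v : α → M) (xs : Fin 0 → M) :
    (∀' (φ ⟹ atSucc φ)).Realize v xs ↔
      ∀ a, (φ.Realize v fun _ => a) → φ.Realize v fun _ => a + 1 := by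
  rw [realize_all_one]
  refine forall_congr' fun a => ?_
  rw [BoundedFormula.realize_imp, realize_atSucc]
  simp

theorem realize_openInduction (φ : LA.BoundedFormula ℕ 1) (v : ℕ → M) :
    (openInduction φ).Realize v ↔ ((φ.Realize v fun _ => 0) →
      (∀ a, (φ.Realize v fun _ => a) → φ.Realize v fun _ => a + 1) →
        ∀ a, φ.Realize v fun _ => a) := by
  rw [Formula.Realize, openInduction, BoundedFormula.realize_imp, BoundedFormula.realize_imp,
    realize_inst_zero, realize_imp_atSucc, realize_all_one]

theorem realize_inductionAxiom {n : ℕ} (φ : LA.BoundedFormula (Fin n) 1) :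
    M ⊨ inductionAxiom φ ↔ ∀ v : Fin n → M, (φ.Realize v fun _ => 0) →
      (∀ a, (φ.Realize v fun _ => a) → φ.Realize v fun _ => a + 1) →
        ∀ a, φ.Realize v fun _ => a := by
  simp only [inductionAxiom, closure, Sentence.Realize]
  rw [BoundedFormula.realize_alls]
  refine forall_congr' fun v => ?_
  rw [Formula.realize_relabel_sumInr, Formula.Realize, BoundedFormula.realize_imp,
    BoundedFormula.realize_inf, realize_inst_zero, realize_imp_atSucc, realize_all_one, and_imp]

/-- A definition mentions finitely many parameters from `M`. Numbering them makes them the free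
variables of an instance of the axiom scheme. -/
theorem ind_of_inductionAxiom
    (h : ∀ (n : ℕ) (φ : LA.BoundedFormula (Fin n) 1), M ⊨ inductionAxiom φ) (P : M → Prop)
    (hP : Df fun v : Fin 1 → M => P (v 0)) (h0 : P 0) (hs : ∀ a, P a → P (a + 1)) (a : M) :
    P a := by
  classical
  obtain ⟨φ, hφ⟩ := hP
  let e := φ.freeVarFinset.equivFin
  have key : ∀ a, (φ.restrictFreeVar e).Realize (fun i => (e.symm i : M)) (fun _ => a) ↔ P a :=
    fun a => (BoundedFormula.realize_restrictFreeVar id (by simp)).trans (hφ _)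
  have := (realize_inductionAxiom (φ.restrictFreeVar e)).1 (h _ _) fun i => (e.symm i : M)
  simp only [key] at this
  exact this h0 hs a

theorem ind_of_openInduction
    (h : ∀ (φ : LA.BoundedFormula ℕ 1) (v : ℕ → M), (openInduction φ).Realize v) (P : M → Prop)
    (hP : Df fun v : Fin 1 → M => P (v 0)) (h0 : P 0) (hs : ∀ a, P a → P (a + 1)) (a : M) :
    P a := by
  classical
  obtain ⟨φ, hφ⟩ := hP
  let e := φ.freeVarFinset.equivFin
  -- Variables beyond the numbered parameters do not occur in the formula; 0 is a dummy value.
  let v : ℕ → M := fun i => if hi : i < φ.freeVarFinset.card then (e.symm ⟨i, hi⟩ : M) else 0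
  have key : ∀ a, (φ.restrictFreeVar fun b => (e b : ℕ)).Realize v (fun _ => a) ↔ P a :=
    fun a => (BoundedFormula.realize_restrictFreeVar id (by simp [v])).trans (hφ _)
  have := (realize_openInduction (φ.restrictFreeVar fun b => (e b : ℕ)) v).1 (h _ _)
  simp only [key] at this
  exact this h0 hs a

end

/-- The arithmetical structure of a model of Peano Arithmetic. -/
abbrev PeanoModel.arith {M : Type} (_ : PeanoModel M) : LA.Structure M := arithStructure M

/-- The axioms of `PAMinus` are those of an ordered semiring, up to the choice of primitives: the
weak order and truncated subtraction have to be added. The operations of the language stay as they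
are, so the arithmetical structure is unchanged by definition. -/
theorem exists_peanoModel_of_ops (M : Type) [Zero M] [One M] [Add M] [Mul M] [LT M]
    (hm : ∀ σ, PAMinus σ → M ⊨ σ)
    (hi : ∀ P : M → Prop, (Df fun v : Fin 1 → M => P (v 0)) → P 0 → (∀ a, P a → P (a + 1)) →
      ∀ a, P a) : ∃ P : PeanoModel M, arithStructure M = P.arith := by
  classical
  have addAssoc := hm _ .addAssoc
  have addComm := hm _ .addComm
  have mulAssoc := hm _ .mulAssoc
  have mulComm := hm _ .mulComm
  have distrib := hm _ .distrib
  have zero := hm _ .zero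
  have one := hm _ .one
  have ltTrans := hm _ .ltTrans
  have ltIrrefl := hm _ .ltIrrefl
  have ltTri := hm _ .ltTri
  have ltAdd := hm _ .ltAdd
  have ltMul := hm _ .ltMul
  have sub := hm _ .sub
  have discrete := hm _ .discrete
  have nonneg := hm _ .nonneg
  simp [Sentence.Realize, Formula.Realize, Fin.snoc] at addAssoc addComm mulAssoc mulComm distrib
  simp [Sentence.Realize, Formula.Realize, Fin.snoc] at zero one ltTrans ltIrrefl ltTri ltAdd
  simp [Sentence.Realize, Formula.Realize, Fin.snoc] at ltMul sub discrete nonneg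
  let ring : CommSemiring M :=
    { add_assoc := addAssoc, add_comm := addComm, mul_assoc := mulAssoc, mul_comm := mulComm
      zero_add := fun a => by rw [addComm, (zero a).1]
      add_zero := fun a => (zero a).1
      one_mul := fun a => by rw [mulComm, one]
      mul_one := one
      zero_mul := fun a => by rw [mulComm, (zero a).2]
      mul_zero := fun a => (zero a).2
      left_distrib := distrib
      right_distrib := fun a b c => by rw [mulComm, distrib, mulComm c a, mulComm c b]
      nsmul := nsmulRec }
  let order : LinearOrder M :=
    { lt := (· < ·)
      le := fun a b => a < b ∨ a = b
      le_refl := fun a => Or.inr rfl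
      le_trans := by
        rintro a b c (h | rfl) (h' | rfl)
        exacts [Or.inl (ltTrans _ _ _ h h'), Or.inl h, Or.inl h', Or.inr rfl]
      lt_iff_le_not_ge := fun a b => by
        constructor
        · refine fun h => ⟨Or.inl h, ?_⟩
          rintro (h' | rfl)
          exacts [ltIrrefl _ (ltTrans _ _ _ h h'), ltIrrefl _ h]
        · rintro ⟨h | rfl, h'⟩
          exacts [h, (h' (Or.inr rfl)).elim]
      le_antisymm := by
        rintro a b (h | rfl) (h' | h')
        exacts [(ltIrrefl _ (ltTrans _ _ _ h h')).elim, h'.symm, rfl, rfl]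
      le_total := fun a b => by
        rcases ltTri a b with h | h | h
        exacts [Or.inl (Or.inl h), Or.inl (Or.inr h), Or.inr (Or.inl h)]
      toDecidableLE := Classical.decRel _ }
  have hle : ∀ a b : M, a ≤ b ↔ a < b ∨ a = b := fun _ _ => Iff.rfl
  have hadd : ∀ a b c : M, a ≤ b → c + a ≤ c + b := by
    rintro a b c (h | rfl)
    · rw [addComm c a, addComm c b]
      exact Or.inl (ltAdd _ _ _ h)
    · exact Or.inr rfl
  have hcancel : ∀ a b c : M, c + a ≤ c + b → a ≤ b := by
    intro a b c h
    by_contra h'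
    have := ltAdd _ _ c (not_le.1 h')
    rw [addComm b, addComm a] at this
    exact absurd h (not_le.2 this)
  have hself : ∀ a b : M, a ≤ a + b := by
    intro a b
    have := hadd 0 b a (nonneg b)
    rwa [(zero a).1] at this
  have hex : ∀ a b : M, a ≤ b → ∃ c, b = a + c := by
    rintro a b (h | rfl)
    · obtain ⟨c, hc⟩ := sub _ _ h
      exact ⟨c, hc.symm⟩
    · exact ⟨0, (zero _).1.symm⟩
  -- The difference is chosen from the subtraction axiom, with the value 0 when the subtrahend is
  -- larger.
  let subInst : Sub M := ⟨fun a b => if h : b ≤ a then (hex b a h).choose else 0⟩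
  have hsub : ∀ a b : M, b ≤ a → a = b + (a - b) := fun a b h => by
    have : a - b = (hex b a h).choose := dif_pos h
    rw [this]
    exact (hex b a h).choose_spec
  have hsub' : ∀ a b : M, ¬b ≤ a → a - b = 0 := fun a b h => dif_neg h
  have mulpos : ∀ a b c : M, 0 < c → a < b → c * a < c * b := by
    intro a b c hc h
    rw [mulComm c a, mulComm c b]
    exact ltMul _ _ _ hc h
  have strict : IsStrictOrderedRing M :=
    { add_le_add_left := fun a b h c => by
        rw [addComm a, addComm b]
        exact hadd _ _ _ h
      le_of_add_le_add_left := fun a b c h => hcancel _ _ _ h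
      le_of_add_le_add_right := fun a b c h => hcancel b c a (by rwa [addComm a b, addComm a c])
      zero_le_one := Or.inl discrete.1
      exists_pair_ne := ⟨0, 1, fun h => ltIrrefl 0 (by
        conv_rhs => rw [h]
        exact discrete.1)⟩
      mul_lt_mul_of_pos_left := fun c hc a b h => mulpos a b c hc h
      mul_lt_mul_of_pos_right := fun c hc a b h => ltMul a b c hc h }
  have canon : CanonicallyOrderedAdd M :=
    { exists_add_of_le := fun {a b} h => hex a b h
      le_self_add := fun a b => hself a b
      le_add_self := fun a b => by rw [addComm]; exact hself a b }
  have osub : OrderedSub M := ⟨fun a b c => by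
    by_cases h : b ≤ a
    · constructor
      · intro h'
        have := hadd _ _ b h'
        rwa [← hsub a b h, addComm b c] at this
      · intro h'
        rw [hsub a b h, addComm c b] at h'
        exact hcancel _ _ _ h'
    · rw [hsub' a b h]
      have h₁ : a ≤ b := (not_le.1 h).le
      have h₂ : b ≤ c + b := by rw [addComm]; exact hself b c
      exact iff_of_true (nonneg c) (h₁.trans h₂)⟩
  refine ⟨{ ring, order, subInst, strict, canon, osub with
    add_one_le_of_lt' := ?_
    ind := hi }, rfl⟩
  intro a b h
  obtain ⟨c, rfl⟩ := hex a b (Or.inl h)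
  refine hadd 1 c a ?_
  rcases nonneg c with hc | hc
  · exact discrete.2 c hc
  · rw [← hc, (zero a).1] at h
    exact (ltIrrefl _ h).elim

/-- The two alternatives are the induction schemes of `PA` and of `openPA`. -/
theorem exists_peanoModel (M : Type) [S : LA.Structure M] (hm : ∀ σ, PAMinus σ → M ⊨ σ)
    (hi : (∀ (n : ℕ) (φ : LA.BoundedFormula (Fin n) 1), M ⊨ inductionAxiom φ) ∨
      ∀ (φ : LA.BoundedFormula ℕ 1) (v : ℕ → M), (openInduction φ).Realize v) :
    ∃ P : PeanoModel M, S = P.arith := by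
  let _ : Zero M := ⟨S.funMap ArithFunc.zero ![]⟩
  let _ : One M := ⟨S.funMap ArithFunc.one ![]⟩
  let _ : Add M := ⟨fun a b => S.funMap ArithFunc.add ![a, b]⟩
  let _ : Mul M := ⟨fun a b => S.funMap ArithFunc.mul ![a, b]⟩
  let _ : LT M := ⟨fun a b => S.RelMap ArithRel.lt ![a, b]⟩
  have hS : S = arithStructure M := by
    refine Structure.ext ?_ ?_
    · funext n f v
      cases f with
      | zero => exact congrArg (S.funMap ArithFunc.zero) (Subsingleton.elim _ _)
      | one => exact congrArg (S.funMap ArithFunc.one) (Subsingleton.elim _ _)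
      | add =>
        refine congrArg (S.funMap ArithFunc.add) (funext fun i => ?_)
        fin_cases i <;> rfl
      | mul =>
        refine congrArg (S.funMap ArithFunc.mul) (funext fun i => ?_)
        fin_cases i <;> rfl
    · funext n R v
      cases R with
      | lt =>
        refine congrArg (S.RelMap ArithRel.lt) (funext fun i => ?_)
        fin_cases i <;> rfl
  rw [hS]
  rw [hS] at hm hi
  exact exists_peanoModel_of_ops M hm
    (hi.elim (fun h => ind_of_inductionAxiom h) fun h => ind_of_openInduction h)

theorem PeanoModel.realize_paMinus (M : Type) [PeanoModel M] {σ : LA.Sentence}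
    (h : PAMinus σ) : M ⊨ σ := by
  cases h <;> simp [Sentence.Realize, Formula.Realize, Fin.snoc]
  · exact add_assoc
  · exact add_comm
  · exact mul_assoc
  · exact mul_comm
  · exact mul_add
  · exact fun _ _ _ => lt_trans
  · exact lt_trichotomy
  · exact fun a b c hc h => mul_lt_mul_of_pos_right h hc
  · exact fun a b h => ⟨b - a, add_tsub_cancel_of_le h.le⟩
  · intro a h
    have := PeanoModel.add_one_le_of_lt' 0 a h
    rw [zero_add] at this
    exact this.lt_or_eq
  · exact fun a => zero_le.lt_or_eq

theorem PeanoModel.realize_ind {M : Type} [PeanoModel M] {α : Type} (φ : LA.BoundedFormula α 1)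
    (v : α → M) (h0 : φ.Realize v fun _ => 0)
    (hs : ∀ a, (φ.Realize v fun _ => a) → φ.Realize v fun _ => a + 1) (a : M) :
    φ.Realize v fun _ => a := by
  refine PeanoModel.ind _ ⟨φ.subst fun i => .var (v i), fun w => ?_⟩ h0 hs a
  rw [BoundedFormula.realize_subst]
  exact iff_of_eq (congrArg _ (funext fun i => congrArg w (Subsingleton.elim _ _)))

/-- PA proves the sentences that hold in all models of Peano Arithmetic. -/
theorem provable_iff {σ : LA.Sentence} : Provable PA σ ↔ ∀ (M : Type) [PeanoModel M], M ⊨ σ := by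
  rw [Provable, derives_iff_der]
  constructor
  · intro h M _
    refine (realize_ofSentence σ (fun _ => (0 : M))).1 (h.sound ?_ _ (by simp))
    rintro _ ⟨τ, hτ, rfl⟩ v
    rw [realize_ofSentence]
    obtain hτ | ⟨n, φ, rfl⟩ := hτ
    · exact PeanoModel.realize_paMinus M hτ
    · exact (realize_inductionAxiom φ).2 fun v => PeanoModel.realize_ind φ v
  · intro h
    refine der_of_forall_realize ?_ fun M S hA v => ?_
    · rintro _ ⟨τ, hτ, rfl⟩ s
      rw [ofSentence_subst]
      exact ⟨τ, hτ, rfl⟩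
    · have hA' : ∀ τ ∈ PA, M ⊨ τ := fun τ hτ => (realize_ofSentence τ v).1 (hA _ ⟨τ, hτ, rfl⟩ v)
      obtain ⟨P, rfl⟩ := exists_peanoModel M (fun τ hτ => hA' τ (Or.inl hτ))
        (Or.inl fun n φ => hA' _ (Or.inr ⟨n, φ, rfl⟩))
      exact (realize_ofSentence σ v).2 (h M)

/-- The axioms of Peano Arithmetic, where induction has free variables as parameters. -/
def openPA : Set (LA.Formula ℕ) :=
  {φ | (∃ σ, PAMinus σ ∧ φ = ofSentence σ) ∨ ∃ ψ, φ = openInduction ψ}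

/-- With parameters left free, the induction scheme is closed under substitution, and its instances
can be recognized by the numbered calculus without forming universal closures. -/
theorem der_openPA_of_forall_realize {σ : LA.Formula ℕ}
    (h : ∀ (M : Type) [PeanoModel M] (v : ℕ → M), σ.Realize v) : Der openPA [] σ := by
  refine der_of_forall_realize ?_ fun M S hA v => ?_
  · rintro _ (⟨τ, hτ, rfl⟩ | ⟨ψ, rfl⟩) s
    · rw [ofSentence_subst]
      exact Or.inl ⟨τ, hτ, rfl⟩
    · refine Or.inr ⟨ψ.subst s, ?_⟩
      rw [openInduction, subst_imp, subst_imp, subst_all, subst_all, subst_imp, inst_subst,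
        atSucc_subst, term_zero_subst]
      rfl
  · obtain ⟨P, rfl⟩ := exists_peanoModel M
      (fun τ hτ => (realize_ofSentence τ v).1 (hA _ (Or.inl ⟨τ, hτ, rfl⟩) v))
      (Or.inr fun φ v => hA _ (Or.inr ⟨φ, rfl⟩) v)
    exact h M v

instance : PeanoModel ℕ where
  add_one_le_of_lt' _ _ h := h
  ind _ _ h0 hs a := Nat.rec h0 hs a

end Models

/-! ### Elementary number theory inside a model of Peano Arithmetic. -/

section Arithmetic

variable {M : Type} [PeanoModel M]

/-! ### Induction -/

theorem add_one_le_of_lt {a b : M} (h : a < b) : a + 1 ≤ b := PeanoModel.add_one_le_of_lt' a b h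

theorem lt_add_one_iff' {a b : M} : a < b + 1 ↔ a ≤ b := by
  constructor
  · intro h
    have := add_one_le_of_lt h
    grind
  · intro h
    have : (0 : M) < 1 := zero_lt_one
    grind

theorem induct {P : M → Prop} [h : Df fun v : Fin 1 → M => P (v 0)] (h0 : P 0)
    (hs : ∀ a, P a → P (a + 1)) (a : M) : P a :=
  PeanoModel.ind P h h0 hs a

theorem strong_induct {P : M → Prop} (hP : Df fun v : Fin 1 → M => P (v 0))
    (h : ∀ a, (∀ b < a, P b) → P a) (a : M) : P a := by
  -- Instance search can now treat `P` as definable at any definable argument.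
  have hP' : ∀ {n : ℕ} {f : (Fin n → M) → M} [DfF f], Df fun v => P (f v) :=
    hP.comp₁ inferInstance
  have : ∀ a, ∀ b < a, P b := by
    refine induct (P := fun a => ∀ b < a, P b) ?_ ?_
    · exact fun b hb => absurd hb (not_lt.2 zero_le)
    · intro a ih b hb
      rcases (lt_add_one_iff'.1 hb).lt_or_eq with h' | rfl
      · exact ih b h'
      · exact h b ih
  exact h a (this a)

theorem exists_least {P : M → Prop} (hP : Df fun v : Fin 1 → M => P (v 0)) (h : ∃ a, P a) :
    ∃ a, P a ∧ ∀ b < a, ¬P b := by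
  by_contra! hc
  obtain ⟨a, ha⟩ := h
  refine strong_induct (P := fun a => ¬P a) Df.not (fun a ih ha => ?_) a ha
  obtain ⟨b, hb, hb'⟩ := hc a ha
  exact ih b hb hb'

theorem eq_zero_or_succ (a : M) : a = 0 ∨ ∃ b, a = b + 1 := by
  rcases eq_or_ne a 0 with h | h
  · exact Or.inl h
  · have := add_one_le_of_lt (pos_iff_ne_zero.2 h)
    rw [zero_add] at this
    exact Or.inr ⟨a - 1, (tsub_add_cancel_of_le this).symm⟩

theorem exists_div (a : M) {b : M} (hb : 0 < b) : ∃ q r, a = q * b + r ∧ r < b := by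
  refine induct (P := fun a => ∃ q r, a = q * b + r ∧ r < b) ⟨0, 0, by simp [hb]⟩ ?_ a
  rintro _ ⟨q, r, rfl, hr⟩
  rcases (add_one_le_of_lt hr).lt_or_eq with h | h
  · exact ⟨q, r + 1, by ring, h⟩
  · exact ⟨q + 1, 0, by rw [add_assoc, h]; ring, hb⟩

theorem div_unique {b q r q' r' : M} (h : q * b + r = q' * b + r') (hr : r < b) (hr' : r' < b) :
    q = q' ∧ r = r' := by
  have key : ∀ {q r q' r' : M}, q * b + r = q' * b + r' → r' < b → ¬q' < q := by
    intro q r q' r' h hr hlt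
    obtain ⟨c, rfl⟩ := exists_add_of_le (add_one_le_of_lt hlt)
    rw [show (q' + 1 + c) * b + r = q' * b + (b + (c * b + r)) by ring] at h
    exact absurd hr (not_lt.2 (add_left_cancel h ▸ le_self_add))
  have : q = q' := by
    rcases lt_trichotomy q q' with h' | h' | h'
    · exact (key h.symm hr h').elim
    · exact h'
    · exact (key h hr' h').elim
  subst this
  exact ⟨rfl, add_left_cancel h⟩

theorem four_mul_inj {a b i j : M} (h : 4 * a + i = 4 * b + j) (hi : i < 4) (hj : j < 4) :
    a = b ∧ i = j :=
  div_unique (b := 4) (by rw [mul_comm a, mul_comm b, h]) hi hj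

/-! ### Pairs -/

/-- The pairing function. -/
def pr (a b : M) : M := if a < b then b * b + a else a * a + a + b

theorem add_one_mul_add_one (s : M) : (s + 1) * (s + 1) = s * s + s + s + 1 := by ring

/-- Integer square roots decode pairs: with root s and remainder r, the pair is (r, s) if r < s, and
(s, r - s) otherwise. -/
theorem exists_sqrt (a : M) : ∃ s, s * s ≤ a ∧ a < (s + 1) * (s + 1) := by
  refine induct (P := fun a => ∃ s, s * s ≤ a ∧ a < (s + 1) * (s + 1)) ⟨0, by simp⟩ ?_ a
  rintro a ⟨s, h, h'⟩
  rcases (add_one_le_of_lt h').lt_or_eq with h'' | h''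
  · exact ⟨s, h.trans (le_add_of_nonneg_right zero_le), h''⟩
  · refine ⟨s + 1, h''.ge, ?_⟩
    rw [h'', add_one_mul_add_one (s + 1)]
    have : (0 : M) < 1 := zero_lt_one
    have : 0 ≤ s := zero_le
    grind

theorem exists_pr (a : M) : ∃ b c, a = pr b c := by
  obtain ⟨s, h, h'⟩ := exists_sqrt a
  obtain ⟨r, rfl⟩ := exists_add_of_le h
  rcases lt_or_ge r s with hr | hr
  · exact ⟨r, s, by rw [pr, if_pos hr]⟩
  · obtain ⟨t, rfl⟩ := exists_add_of_le hr
    rw [add_one_mul_add_one] at h'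
    have : t < s + 1 := by grind
    refine ⟨s, t, ?_⟩
    rw [pr, if_neg (not_lt.2 (lt_add_one_iff'.1 this))]
    ring

theorem sqrt_unique {a s t : M} (h₁ : s * s ≤ a) (h₂ : a < (t + 1) * (t + 1)) : s ≤ t := by
  by_contra! h
  have := add_one_le_of_lt h
  have := mul_le_mul' this this
  exact absurd (this.trans h₁) (not_le.2 h₂)

/-- The larger component is the integer square root of the pair, so it is determined by the pair;
this gives injectivity. -/
theorem pr_bounds (a b : M) : max a b * max a b ≤ pr a b ∧
    pr a b < (max a b + 1) * (max a b + 1) := by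
  have h1 : (0 : M) < 1 := zero_lt_one
  have ha : 0 ≤ a := zero_le
  have hb : 0 ≤ b := zero_le
  rcases lt_or_ge a b with h | h
  · rw [pr, if_pos h, max_eq_right h.le, add_one_mul_add_one]
    constructor <;> grind
  · rw [pr, if_neg (not_lt.2 h), max_eq_left h, add_one_mul_add_one]
    constructor <;> grind

theorem pr_inj {a b a' b' : M} (h : pr a b = pr a' b') : a = a' ∧ b = b' := by
  have h₁ := pr_bounds a b
  have h₂ := pr_bounds a' b'
  have hm : max a b = max a' b' :=
    le_antisymm (sqrt_unique h₁.1 (h ▸ h₂.2)) (sqrt_unique h₂.1 (h ▸ h₁.2))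
  rw [pr, pr] at h
  split_ifs at h with h₃ h₄ h₄
  · rw [max_eq_right h₃.le, max_eq_right h₄.le] at hm
    subst hm
    exact ⟨add_left_cancel h, rfl⟩
  · rw [max_eq_right h₃.le, max_eq_left (not_lt.1 h₄)] at hm
    subst hm
    have : 0 ≤ b' := zero_le
    grind
  · rw [max_eq_left (not_lt.1 h₃), max_eq_right h₄.le] at hm
    subst hm
    have : 0 ≤ b := zero_le
    grind
  · rw [max_eq_left (not_lt.1 h₃), max_eq_left (not_lt.1 h₄)] at hm
    subst hm
    exact ⟨rfl, add_left_cancel h⟩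

theorem pr_inj_iff {a b a' b' : M} : pr a b = pr a' b' ↔ a = a' ∧ b = b' :=
  ⟨pr_inj, by rintro ⟨rfl, rfl⟩; rfl⟩

/-- The first component of a pair. -/
noncomputable def fst (a : M) : M := (exists_pr a).choose

/-- The second component of a pair. -/
noncomputable def snd (a : M) : M := (exists_pr a).choose_spec.choose

theorem pr_fst_snd (a : M) : pr (fst a) (snd a) = a :=
  (exists_pr a).choose_spec.choose_spec.symm

@[simp] theorem fst_pr (a b : M) : fst (pr a b) = a := (pr_inj (pr_fst_snd (pr a b))).1

@[simp] theorem snd_pr (a b : M) : snd (pr a b) = b := (pr_inj (pr_fst_snd (pr a b))).2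

instance DfF.pr {n : ℕ} {f g : (Fin n → M) → M} [hf : DfF f] [hg : DfF g] :
    DfF fun v => pr (f v) (g v) :=
  DfF.comp₂ (F := ProvUniv.pr) (Df.congr (P := fun v : Fin 3 → M =>
    (v 1 < v 2 ∧ v 0 = v 2 * v 2 + v 1) ∨ (¬v 1 < v 2 ∧ v 0 = v 1 * v 1 + v 1 + v 2))
    inferInstance fun v => by
      unfold ProvUniv.pr
      split_ifs with h <;> simp [h]) hf hg

instance DfF.fst {n : ℕ} {f : (Fin n → M) → M} [hf : DfF f] : DfF fun v => fst (f v) :=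
  DfF.comp₁ (F := ProvUniv.fst) (Df.congr (P := fun v : Fin 2 → M => ∃ b, v 1 = ProvUniv.pr (v 0) b)
    inferInstance fun v => ⟨by rintro ⟨b, h⟩; rw [h, fst_pr], fun h => ⟨ProvUniv.snd (v 1), by
      rw [h, pr_fst_snd]⟩⟩) hf

instance DfF.snd {n : ℕ} {f : (Fin n → M) → M} [hf : DfF f] : DfF fun v => snd (f v) :=
  DfF.comp₁ (F := ProvUniv.snd) (Df.congr (P := fun v : Fin 2 → M => ∃ b, v 1 = ProvUniv.pr b (v 0))
    inferInstance fun v => ⟨by rintro ⟨b, h⟩; rw [h, snd_pr], fun h => ⟨ProvUniv.fst (v 1), by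
      rw [h, pr_fst_snd]⟩⟩) hf

instance DfF.sub {n : ℕ} {f g : (Fin n → M) → M} [hf : DfF f] [hg : DfF g] :
    DfF fun v => f v - g v :=
  DfF.comp₂ (F := (· - ·)) (Df.congr (P := fun v : Fin 3 → M =>
    (v 2 ≤ v 1 ∧ v 0 + v 2 = v 1) ∨ (v 1 ≤ v 2 ∧ v 0 = 0))
    inferInstance fun v => by
      rcases le_total (v 1) (v 2) with h | h
      · simp only [tsub_eq_zero_of_le h]
        refine ⟨?_, fun h' => Or.inr ⟨h, h'⟩⟩
        rintro (⟨h', h''⟩ | ⟨-, h'⟩)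
        · have := le_antisymm h h'
          rw [this] at h''
          simpa using h''
        · exact h'
      · simp only [eq_tsub_iff_add_eq_of_le h]
        refine ⟨?_, fun h' => Or.inl ⟨h, h'⟩⟩
        rintro (⟨-, h'⟩ | ⟨h', h''⟩)
        · exact h'
        · rw [h'', zero_add]
          exact le_antisymm h h') hf hg

end Arithmetic

section Sequences

variable {M : Type} [PeanoModel M]

/-! ### Sequences -/

/-- The entry number `i` of the sequence with the code `(a, b)` is `c`. -/
def Bt (a b i c : M) : Prop := ∃ q, a = q * (1 + (i + 1) * b) + c ∧ c < 1 + (i + 1) * b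

instance Df.bt {n : ℕ} {f g h k : (Fin n → M) → M} [hf : DfF f] [hg : DfF g] [hh : DfF h]
    [hk : DfF k] : Df fun v => Bt (f v) (g v) (h v) (k v) :=
  Df.comp₄ (P := Bt) (by unfold Bt; infer_instance) hf hg hh hk

theorem Bt.unique {a b i c c' : M} (h : Bt a b i c) (h' : Bt a b i c') : c = c' := by
  obtain ⟨q, hq, hc⟩ := h
  obtain ⟨q', hq', hc'⟩ := h'
  exact (div_unique (hq.symm.trans hq') hc hc').2

theorem exists_bt (a b i : M) : ∃ c, Bt a b i c := by
  obtain ⟨q, r, h, hr⟩ := exists_div a (b := 1 + (i + 1) * b)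
    (lt_of_lt_of_le zero_lt_one le_self_add)
  exact ⟨r, q, h, hr⟩

/-- This replaces the factorial in the construction of β-codes: a factorial would itself need coded
sequences. -/
theorem exists_common_multiple (n : M) : ∃ b, 0 < b ∧ ∀ i < n, ∃ q, b = (i + 1) * q := by
  refine induct (P := fun n => ∃ b, 0 < b ∧ ∀ i < n, ∃ q, b = (i + 1) * q) ⟨1, zero_lt_one, ?_⟩
    ?_ n
  · exact fun i hi => absurd hi (not_lt.2 zero_le)
  · rintro n ⟨b, hb, h⟩
    refine ⟨b * (n + 1), mul_pos hb (lt_of_le_of_lt zero_le (lt_add_one_iff'.2 le_rfl)), ?_⟩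
    intro i hi
    rcases (lt_add_one_iff'.1 hi).lt_or_eq with h' | rfl
    · obtain ⟨q, hq⟩ := h i h'
      exact ⟨q * (n + 1), by rw [hq]; ring⟩
    · exact ⟨b, by ring⟩

/-- The moduli of a Gödel code are invertible modulo each other. -/
theorem modulus_unit {n b : M} (hb : ∀ i < n, ∃ q, b = (i + 1) * q) {i j : M} (hi : i < n)
    (hj : j < n) (hij : i ≠ j) :
    ∃ u v, (1 + (i + 1) * b) * u = 1 + v * (1 + (j + 1) * b) := by
  -- The difference of two indices divides `b`, which is why `b` was required to be a common
  -- multiple.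
  have key : ∀ {i j : M}, i < j → j < n → ∃ d q, j = i + d ∧ b = d * q := by
    intro i j h hj
    obtain ⟨d, rfl⟩ := exists_add_of_le (add_one_le_of_lt h)
    obtain ⟨q, hq⟩ := hb d (lt_of_le_of_lt (by rw [add_comm]; exact le_self_add) hj)
    exact ⟨d + 1, q, by ring, hq⟩
  rcases lt_or_gt_of_ne hij with h | h
  · obtain ⟨d, q, rfl, hq⟩ := key h hj
    -- Write mᵢ, mⱼ for the moduli and j = i + d. Since (j+1)mᵢ - (i+1)mⱼ = d and dq = b, the
    -- product q(j+1)mᵢ is b modulo mⱼ, and a further factor j+1 gives -1.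
    have e : q * (i + d + 1) * (i + d + 1) * (1 + (i + 1) * b) + 1 =
        (q * (i + d + 1) * (i + 1) + 1) * (1 + (i + d + 1) * b) := by
      rw [hq]; ring
    generalize 1 + (i + d + 1) * b = m at e ⊢
    generalize q * (i + d + 1) * (i + 1) + 1 = K at e
    generalize q * (i + d + 1) * (i + d + 1) = W at e
    rcases eq_zero_or_succ (W * (1 + (i + 1) * b)) with h₀ | ⟨X, hX⟩
    · rw [h₀, zero_add] at e
      refine ⟨1, (i + 1) * b * K, ?_⟩
      rw [mul_assoc _ K, ← e]
      ring
    -- The product of W with the first modulus is X + 1 and is congruent to -1; its square is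
    -- congruent to 1, so negative numbers are avoided.
    · refine ⟨W * (X + 1), X * K, ?_⟩
      rw [mul_assoc X, ← e, ← mul_assoc, mul_comm _ W, hX]
      ring
  · obtain ⟨d, q, rfl, hq⟩ := key h hi
    -- With the indices in the opposite order the residue is already 1; it remains to cancel one
    -- copy of the modulus.
    have e : (1 + (j + d + 1) * b) * (q * (j + 1) * (j + 1)) + (1 + (j + 1) * b) =
        1 + q * (j + 1) * (j + d + 1) * (1 + (j + 1) * b) := by
      rw [hq]; ring
    rcases eq_zero_or_succ (q * (j + 1) * (j + d + 1)) with h₀ | ⟨C, hC⟩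
    · rw [h₀, zero_mul, add_zero] at e
      have hj : (j + 1) * b = 0 := by
        have h₁ : (0 : M) ≤ (1 + (j + d + 1) * b) * (q * (j + 1) * (j + 1)) := zero_le
        have h₂ : (0 : M) ≤ (j + 1) * b := zero_le
        grind
      exact ⟨1, (j + d + 1) * b, by rw [hj]; ring⟩
    · rw [hC] at e
      refine ⟨q * (j + 1) * (j + 1), C, add_right_cancel (b := 1 + (j + 1) * b) (e.trans ?_)⟩
      ring

/-- Gödel's β-lemma with choice: a definable relation that is total below `n` has a coded selection.
The codes come from a Chinese remainder argument carried out by internal induction. -/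
theorem exists_code {F : M → M → Prop} (hF : Df fun v : Fin 2 → M => F (v 0) (v 1)) (n : M)
    (h : ∀ i < n, ∃ c, F i c) : ∃ a b, ∀ i < n, ∃ c, F i c ∧ Bt a b i c := by
  have hF' : ∀ {n : ℕ} {f g : (Fin n → M) → M} [DfF f] [DfF g], Df fun v => F (f v) (g v) :=
    hF.comp₂ inferInstance inferInstance
  -- Collection: the values can be chosen below a common bound.
  obtain ⟨B, hB⟩ : ∃ B, ∀ i < n, ∃ c, F i c ∧ c ≤ B := by
    refine induct (P := fun k => k ≤ n → ∃ B, ∀ i < k, ∃ c, F i c ∧ c ≤ B) ?_ ?_ n le_rfl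
    · exact fun _ => ⟨0, fun i hi => absurd hi (not_lt.2 zero_le)⟩
    · intro k ih hk
      have hk' : k < n := lt_of_lt_of_le (lt_add_one_iff'.2 le_rfl) hk
      obtain ⟨B, hB⟩ := ih hk'.le
      obtain ⟨c, hc⟩ := h k hk'
      refine ⟨B + c, fun i hi => ?_⟩
      rcases (lt_add_one_iff'.1 hi).lt_or_eq with h' | rfl
      · obtain ⟨c', hc', hB'⟩ := hB i h'
        exact ⟨c', hc', hB'.trans le_self_add⟩
      · exact ⟨c, hc, le_add_self⟩
  obtain ⟨b₀, hb₀, hdvd⟩ := exists_common_multiple n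
  -- The factor `b₀` makes the moduli pairwise coprime, and `B + 1` makes them larger than all
  -- values to be coded.
  let b := b₀ * (B + 1)
  have hb : ∀ i < n, ∃ q, b = (i + 1) * q := by
    intro i hi
    obtain ⟨q, hq⟩ := hdvd i hi
    exact ⟨q * (B + 1), by simp only [b]; rw [hq]; ring⟩
  have hBb : ∀ c ≤ B, ∀ i, c < 1 + (i + 1) * b := by
    intro c hc i
    have h₁ : B + 1 ≤ b := le_mul_of_one_le_left zero_le (by
      have := add_one_le_of_lt hb₀
      rwa [zero_add] at this)
    have h₂ : b ≤ (i + 1) * b := le_mul_of_one_le_left zero_le le_add_self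
    have : (0 : M) < 1 := zero_lt_one
    grind
  -- Here `p` plays the role of the product of the first `k` moduli: it is a multiple of each of
  -- them and invertible modulo the later ones.
  suffices H : ∀ k, k ≤ n → ∃ a p, (∀ i < k, ∃ q, p = (1 + (i + 1) * b) * q) ∧
      (∀ j, k ≤ j → j < n → ∃ u v, p * u = 1 + v * (1 + (j + 1) * b)) ∧
      ∀ i < k, ∃ c, F i c ∧ Bt a b i c by
    obtain ⟨a, p, -, -, H⟩ := H n le_rfl
    exact ⟨a, b, H⟩
  refine induct ?_ ?_
  · exact fun _ => ⟨0, 1, fun i hi => absurd hi (not_lt.2 zero_le), fun j _ _ => ⟨1, 0, by ring⟩,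
      fun i hi => absurd hi (not_lt.2 zero_le)⟩
  · intro k ih hk
    have hk' : k < n := lt_of_lt_of_le (lt_add_one_iff'.2 le_rfl) hk
    obtain ⟨a, p, hp, hu, ha⟩ := ih hk'.le
    obtain ⟨c, hc, hcB⟩ := hB k hk'
    obtain ⟨u, v, huv⟩ := hu k le_rfl hk'
    obtain ⟨r, q, hq, hr⟩ := exists_bt a b k
    obtain ⟨s, hs⟩ := exists_add_of_le hr.le
    -- Modulo the new modulus, `a` has residue `r`, `r + s` is 0 and `p * u` is 1, so the new
    -- residue is `c`. The old residues do not change, since `p` vanishes modulo the old moduli.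
    refine ⟨a + p * (u * (c + s)), p * (1 + (k + 1) * b), ?_, ?_, ?_⟩
    · intro i hi
      rcases (lt_add_one_iff'.1 hi).lt_or_eq with h' | rfl
      · obtain ⟨q, rfl⟩ := hp i h'
        exact ⟨q * (1 + (k + 1) * b), by ring⟩
      · exact ⟨p, by ring⟩
    · intro j hj hjn
      obtain ⟨u₁, v₁, h₁⟩ := hu j (le_self_add.trans hj) hjn
      obtain ⟨u₂, v₂, h₂⟩ := modulus_unit hb hk' hjn
        (lt_of_lt_of_le (lt_add_one_iff'.2 le_rfl) hj).ne
      refine ⟨u₁ * u₂, v₁ + v₂ + v₁ * v₂ * (1 + (j + 1) * b), ?_⟩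
      calc p * (1 + (k + 1) * b) * (u₁ * u₂) = (p * u₁) * ((1 + (k + 1) * b) * u₂) := by ring
        _ = _ := by rw [h₁, h₂]; ring
    · intro i hi
      rcases (lt_add_one_iff'.1 hi).lt_or_eq with h' | rfl
      · obtain ⟨c', hc', q', hq', hlt⟩ := ha i h'
        obtain ⟨q'', rfl⟩ := hp i h'
        refine ⟨c', hc', q' + q'' * (u * (c + s)), ?_, hlt⟩
        rw [hq']
        ring
      · refine ⟨c, hc, q + 1 + v * (c + s), ?_, hBb c hcB _⟩
        calc a + p * (u * (c + s)) = a + p * u * (c + s) := by ring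
          _ = q * (1 + (i + 1) * b) + (r + s) + v * (1 + (i + 1) * b) * (c + s) + c := by
            rw [huv, hq]; ring
          _ = _ := by rw [← hs]; ring

end Sequences

section Evaluation

/-! ### The meaning of the formulas -/

theorem realize_app {M : Type} [LA.Structure M] {m n : ℕ} {α : Type} (φ : LA.Formula (Fin m))
    (t : Fin m → LA.Term (α ⊕ Fin n)) (v : α → M) (xs : Fin n → M) :
    (app φ t).Realize v xs ↔ φ.Realize fun i => (t i).realize (Sum.elim v xs) := by
  rw [app, BoundedFormula.realize_relabel, BoundedFormula.realize_subst, Formula.Realize]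
  refine iff_of_eq (congrArg₂ _ (funext fun i => congrArg (fun v => (t i).realize v) ?_)
    (Subsingleton.elim (α := Fin 0 → M) _ _))
  funext a
  rcases a with a | a <;> rfl

variable {M : Type} [PeanoModel M]

@[simp] theorem realize_numeral {α : Type} (v : α → M) (n : ℕ) :
    (numeral n : LA.Term α).realize v = n := by
  induction n using numeral.induct with
  | case1 => simp [numeral]
  | case2 => simp [numeral]
  | case3 n ih => simp [numeral, ih]

theorem realize_pairF (w : Fin 3 → M) : pairF.Realize w ↔ w 0 = pr (w 1) (w 2) := by
  simp only [pairF, Formula.Realize, BoundedFormula.realize_sup, BoundedFormula.realize_inf,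
    BoundedFormula.realize_not, realize_ltF, BoundedFormula.realize_bdEqual, Term.realize_var,
    Sum.elim_inl, realize_add, realize_mul, pr]
  split_ifs with h <;> simp [h]

theorem realize_betaF (w : Fin 4 → M) : betaF.Realize w ↔ Bt (w 0) (w 1) (w 2) (w 3) := by
  simp [betaF, Formula.Realize, Bt, Fin.snoc]

/-- The entry number `i` of the sequence with the code `(a, b)` is the triple `(e, s, t)`. -/
def Entry (a b i e s t : M) : Prop := Bt a b i (pr e (pr s t))

theorem realize_entryF (w : Fin 6 → M) :
    entryF.Realize w ↔ Entry (w 0) (w 1) (w 2) (w 3) (w 4) (w 5) := by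
  rw [entryF, Formula.Realize]
  simp [Entry, realize_app, realize_betaF, realize_pairF, Fin.snoc]

/-- The triple `(e, s, t)` is an entry before number `i` of the sequence with the code `(a, b)`. -/
def Before (a b i e s t : M) : Prop := ∃ j < i, Entry a b j e s t

theorem realize_beforeF (w : Fin 6 → M) :
    beforeF.Realize w ↔ Before (w 0) (w 1) (w 2) (w 3) (w 4) (w 5) := by
  rw [beforeF, Formula.Realize]
  simp [Before, realize_app, realize_entryF, Fin.snoc]

/-- The triple `(e, s, t)` follows in one step of evaluation from triples in the relation `B`. -/
def StepR (B : M → M → M → Prop) (e s t : M) : Prop :=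
  (e = 0 ∧ t = 0) ∨ (e = 1 ∧ t = s + 1) ∨ (e = 2 ∧ ∃ u, s = pr t u) ∨ (e = 3 ∧ ∃ u, s = pr u t) ∨
  (∃ f g u v, e = 4 * pr f g + 4 ∧ B f s u ∧ B g s v ∧ t = pr u v) ∨
  (∃ f g u, e = 4 * pr f g + 6 ∧ B g s u ∧ B f u t) ∨
  (∃ f g a, e = 4 * pr f g + 5 ∧ s = pr a 0 ∧ B f a t) ∨
  (∃ f g a n u, e = 4 * pr f g + 5 ∧ s = pr a (n + 1) ∧ B e (pr a n) u ∧
    B g (pr a (pr n u)) t) ∨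
  (∃ f a, e = 4 * f + 7 ∧ s = pr a t ∧ B f s 0) ∨
  (∃ f a m k, e = 4 * f + 7 ∧ s = pr a m ∧ B f s (k + 1) ∧ B e (pr a (m + 1)) t)

theorem realize_stepF (w : Fin 6 → M) :
    stepF.Realize w ↔ StepR (Before (w 0) (w 1) (w 2)) (w 3) (w 4) (w 5) := by
  rw [stepF, Formula.Realize]
  simp only [BoundedFormula.realize_sup, StepR]
  refine or_congr ?_ (or_congr ?_ (or_congr ?_ (or_congr ?_ (or_congr ?_ (or_congr ?_
    (or_congr ?_ (or_congr ?_ (or_congr ?_ ?_))))))))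
  all_goals simp [realize_app, realize_beforeF, realize_pairF, Fin.snoc]

/-- The first `l` entries of the sequence with the code `(a, b)` follow from earlier entries. -/
def Valid (a b l : M) : Prop :=
  ∀ i < l, ∃ e s t, Entry a b i e s t ∧ StepR (Before a b i) e s t

/-- The program number `e` on the input `s` halts with the output `t`. -/
def Ev (e s t : M) : Prop := ∃ a b l, Valid a b (l + 1) ∧ Entry a b l e s t

theorem realize_evalF (w : Fin 3 → M) : evalF.Realize w ↔ Ev (w 0) (w 1) (w 2) := by
  rw [evalF, Formula.Realize]
  simp [Ev, Valid, realize_app, realize_entryF, realize_stepF, Fin.snoc]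

instance Df.ev {n : ℕ} {f g h : (Fin n → M) → M} [hf : DfF f] [hg : DfF g] [hh : DfF h] :
    Df fun v => Ev (f v) (g v) (h v) :=
  Df.comp₃ (P := Ev) ((Df.formula evalF).congr fun v => realize_evalF v) hf hg hh

end Evaluation

section EvaluationRules

variable {M : Type} [PeanoModel M]

/-! ### The evaluation relation -/

theorem StepR.mono {B B' : M → M → M → Prop} (h : ∀ e s t, B e s t → B' e s t) {e s t : M}
    (hs : StepR B e s t) : StepR B' e s t := by
  refine Or.imp id (Or.imp id (Or.imp id (Or.imp id (Or.imp ?_ (Or.imp ?_ (Or.imp ?_ (Or.imp ?_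
    (Or.imp ?_ ?_)))))))) hs
  · exact fun ⟨f, g, u, v, he, h₁, h₂, ht⟩ => ⟨f, g, u, v, he, h _ _ _ h₁, h _ _ _ h₂, ht⟩
  · exact fun ⟨f, g, u, he, h₁, h₂⟩ => ⟨f, g, u, he, h _ _ _ h₁, h _ _ _ h₂⟩
  · exact fun ⟨f, g, a, he, hs, h₁⟩ => ⟨f, g, a, he, hs, h _ _ _ h₁⟩
  · exact fun ⟨f, g, a, n, u, he, hs, h₁, h₂⟩ =>
      ⟨f, g, a, n, u, he, hs, h _ _ _ h₁, h _ _ _ h₂⟩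
  · exact fun ⟨f, a, he, hs, h₁⟩ => ⟨f, a, he, hs, h _ _ _ h₁⟩
  · exact fun ⟨f, a, m, k, he, hs, h₁, h₂⟩ => ⟨f, a, m, k, he, hs, h _ _ _ h₁, h _ _ _ h₂⟩

theorem Entry.unique {a b i e s t e' s' t' : M} (h : Entry a b i e s t)
    (h' : Entry a b i e' s' t') : e = e' ∧ s = s' ∧ t = t' := by
  have := Bt.unique h h'
  simpa only [pr_inj_iff] using this

instance Df.entry {n : ℕ} {f g h k l m : (Fin n → M) → M} [DfF f] [DfF g] [DfF h] [DfF k]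
    [DfF l] [DfF m] : Df fun v => Entry (f v) (g v) (h v) (k v) (l v) (m v) :=
  inferInstanceAs (Df fun v => Bt (f v) (g v) (h v) (pr (k v) (pr (l v) (m v))))

theorem Valid.mono {a b l l' : M} (h : Valid a b l) (hl : l' ≤ l) : Valid a b l' :=
  fun i hi => h i (lt_of_lt_of_le hi hl)

theorem Valid.ev_of_before {a b l e s t : M} (h : Valid a b l) (hb : Before a b l e s t) :
    Ev e s t := by
  obtain ⟨i, hi, he⟩ := hb
  exact ⟨a, b, i, h.mono (add_one_le_of_lt hi), he⟩

/-- Concatenating two computations puts both premises of a clause into a single coded sequence. -/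
theorem Valid.append {a b l a' b' l' : M} (h : Valid a b l) (h' : Valid a' b' l') :
    ∃ a'' b'', Valid a'' b'' (l + l') ∧ (∀ e s t, Before a b l e s t →
      Before a'' b'' (l + l') e s t) ∧ ∀ e s t, Before a' b' l' e s t →
        Before a'' b'' (l + l') e s t := by
  obtain ⟨a'', b'', hc⟩ := exists_code (F := fun i c => (i < l ∧ Bt a b i c) ∨
      ∃ j, i = l + j ∧ Bt a' b' j c) inferInstance (l + l') (by
    intro i hi
    rcases lt_or_ge i l with h₁ | h₁
    · obtain ⟨c, hc⟩ := exists_bt a b i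
      exact ⟨c, Or.inl ⟨h₁, hc⟩⟩
    · obtain ⟨j, rfl⟩ := exists_add_of_le h₁
      obtain ⟨c, hc⟩ := exists_bt a' b' j
      exact ⟨c, Or.inr ⟨j, rfl, hc⟩⟩)
  have h₁ : ∀ i < l, ∀ c, Bt a b i c → Bt a'' b'' i c := by
    intro i hi c hb
    obtain ⟨c', ⟨-, hc'⟩ | ⟨j, rfl, -⟩, hb'⟩ := hc i (lt_of_lt_of_le hi le_self_add)
    · rwa [hb.unique hc']
    · exact absurd hi (not_lt.2 le_self_add)
  have h₂ : ∀ j < l', ∀ c, Bt a' b' j c → Bt a'' b'' (l + j) c := by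
    intro i hi c hb
    obtain ⟨c', ⟨hlt, -⟩ | ⟨j, hj, hc'⟩, hb'⟩ := hc (l + i) (by grind)
    · exact absurd hlt (not_lt.2 le_self_add)
    · rw [add_left_cancel hj] at hb
      rwa [hb.unique hc']
  refine ⟨a'', b'', fun i hi => ?_, ?_, ?_⟩
  · rcases lt_or_ge i l with hl | hl
    · obtain ⟨e, s, t, he, hs⟩ := h i hl
      refine ⟨e, s, t, h₁ i hl _ he, hs.mono ?_⟩
      rintro e s t ⟨j, hj, he⟩
      exact ⟨j, hj, h₁ j (hj.trans hl) _ he⟩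
    · obtain ⟨i, rfl⟩ := exists_add_of_le hl
      have hi' : i < l' := by grind
      obtain ⟨e, s, t, he, hs⟩ := h' i hi'
      refine ⟨e, s, t, h₂ i hi' _ he, hs.mono ?_⟩
      rintro e s t ⟨j, hj, he⟩
      exact ⟨l + j, by grind, h₂ j (hj.trans hi') _ he⟩
  · rintro e s t ⟨j, hj, he⟩
    exact ⟨j, lt_of_lt_of_le hj le_self_add, h₁ j hj _ he⟩
  · rintro e s t ⟨j, hj, he⟩
    exact ⟨l + j, by grind, h₂ j hj _ he⟩

/-- The new claim is appended as entry number `l` of a recoded sequence. -/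
theorem Valid.ev_of_step {a b l e s t : M} (h : Valid a b l)
    (hs : StepR (Before a b l) e s t) : Ev e s t := by
  obtain ⟨a', b', hc⟩ := exists_code (F := fun i c => (i < l ∧ Bt a b i c) ∨
      (i = l ∧ c = pr e (pr s t))) inferInstance (l + 1) (by
    intro i hi
    rcases (lt_add_one_iff'.1 hi).lt_or_eq with h₁ | h₁
    · obtain ⟨c, hc⟩ := exists_bt a b i
      exact ⟨c, Or.inl ⟨h₁, hc⟩⟩
    · exact ⟨_, Or.inr ⟨h₁, rfl⟩⟩)
  have hlt : l < l + 1 := lt_add_one_iff'.2 le_rfl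
  have h₁ : ∀ i < l, ∀ c, Bt a b i c → Bt a' b' i c := by
    intro i hi c hb
    obtain ⟨c', ⟨-, hc'⟩ | ⟨rfl, -⟩, hb'⟩ := hc i (hi.trans hlt)
    · rwa [hb.unique hc']
    · exact absurd hi (lt_irrefl _)
  have h₂ : Entry a' b' l e s t := by
    obtain ⟨c', ⟨hl, -⟩ | ⟨-, rfl⟩, hb'⟩ := hc l hlt
    · exact absurd hl (lt_irrefl _)
    · exact hb'
  have h₃ : ∀ i ≤ l, ∀ e s t, Before a b i e s t → Before a' b' i e s t := by
    rintro i hi e s t ⟨j, hj, he⟩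
    exact ⟨j, hj, h₁ j (lt_of_lt_of_le hj hi) _ he⟩
  refine ⟨a', b', l, fun i hi => ?_, h₂⟩
  rcases (lt_add_one_iff'.1 hi).lt_or_eq with hl | rfl
  · obtain ⟨e, s, t, he, hs⟩ := h i hl
    exact ⟨e, s, t, h₁ i hl _ he, hs.mono (h₃ i hl.le)⟩
  · exact ⟨e, s, t, h₂, hs.mono (h₃ i le_rfl)⟩

theorem Ev.join {e s t e' s' t' : M} (h : Ev e s t) (h' : Ev e' s' t') :
    ∃ a b l, Valid a b l ∧ Before a b l e s t ∧ Before a b l e' s' t' := by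
  obtain ⟨a, b, l, hv, he⟩ := h
  obtain ⟨a', b', l', hv', he'⟩ := h'
  obtain ⟨a'', b'', hv'', h₁, h₂⟩ := hv.append hv'
  exact ⟨a'', b'', _, hv'', h₁ _ _ _ ⟨l, lt_add_one_iff'.2 le_rfl, he⟩,
    h₂ _ _ _ ⟨l', lt_add_one_iff'.2 le_rfl, he'⟩⟩

theorem Ev.step {e s t : M} (h : Ev e s t) : StepR Ev e s t := by
  obtain ⟨a, b, l, hv, he⟩ := h
  have hlt : l < l + 1 := lt_add_one_iff'.2 le_rfl
  obtain ⟨e', s', t', he', hs⟩ := hv l hlt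
  obtain ⟨rfl, rfl, rfl⟩ := he.unique he'
  exact hs.mono fun _ _ _ hb => (hv.mono hlt.le).ev_of_before hb

theorem StepR.ev {e s t : M} (h : StepR Ev e s t) : Ev e s t := by
  have one : ∀ {e' s' t' : M}, Ev e' s' t' →
      ∃ a b l : M, Valid a b l ∧ Before a b l e' s' t' := fun h => by
    obtain ⟨a, b, l, hv, hb, -⟩ := h.join h
    exact ⟨a, b, l, hv, hb⟩
  have valid : Valid (0 : M) 0 0 := fun i hi => absurd hi (not_lt.2 zero_le)
  unfold StepR at h
  rcases h with h | h | h | h | ⟨f, g, u, v, he, h, h', ht⟩ | ⟨f, g, u, he, h, h'⟩ |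
    ⟨f, g, a, he, hs, h⟩ | ⟨f, g, a, n, u, he, hs, h, h'⟩ | ⟨f, a, he, hs, h⟩ |
    ⟨f, a, m, k, he, hs, h, h'⟩
  · exact valid.ev_of_step (by unfold StepR; simp [h])
  · exact valid.ev_of_step (by unfold StepR; simp [h])
  · exact valid.ev_of_step (by unfold StepR; simp [h])
  · exact valid.ev_of_step (by unfold StepR; simp [h])
  · obtain ⟨_, _, _, hv, hb, hb'⟩ := h.join h'
    exact hv.ev_of_step (by unfold StepR; grind only)
  · obtain ⟨_, _, _, hv, hb, hb'⟩ := h.join h'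
    exact hv.ev_of_step (by unfold StepR; grind only)
  · obtain ⟨_, _, _, hv, hb⟩ := one h
    exact hv.ev_of_step (by unfold StepR; grind only)
  · obtain ⟨_, _, _, hv, hb, hb'⟩ := h.join h'
    exact hv.ev_of_step (by unfold StepR; grind only)
  · obtain ⟨_, _, _, hv, hb⟩ := one h
    exact hv.ev_of_step (by unfold StepR; grind only)
  · obtain ⟨_, _, _, hv, hb, hb'⟩ := h.join h'
    exact hv.ev_of_step (by unfold StepR; grind only)

/-- The evaluation relation is a fixed point of its clauses. Together with `Ev.induct`, this makes
the coded sequences dispensable in what follows. -/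
theorem ev_iff_step {e s t : M} : Ev e s t ↔ StepR Ev e s t := ⟨Ev.step, StepR.ev⟩

/-- Induction on evaluation, for relations that admit strong induction along computations. -/
theorem Ev.rec_of_induct {Q : M → M → M → Prop}
    (hind : ∀ a b l : M, (∀ i, (∀ j < i, j ≤ l → ∀ e s t, Entry a b j e s t → Q e s t) → i ≤ l →
      ∀ e s t, Entry a b i e s t → Q e s t) → ∀ i ≤ l, ∀ e s t, Entry a b i e s t → Q e s t)
    (h : ∀ e s t, StepR (fun e s t => Ev e s t ∧ Q e s t) e s t → Q e s t) {e s t : M}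
    (hev : Ev e s t) : Q e s t := by
  obtain ⟨a, b, l, hv, he⟩ := hev
  refine hind a b l (fun i ih hi e s t he => h e s t ?_) l le_rfl e s t he
  obtain ⟨e', s', t', he', hs⟩ := hv i (lt_add_one_iff'.2 hi)
  obtain ⟨rfl, rfl, rfl⟩ := he.unique he'
  refine hs.mono ?_
  rintro e s t ⟨j, hj, hej⟩
  exact ⟨(hv.mono (hi.trans le_self_add)).ev_of_before ⟨j, hj, hej⟩,
    ih j hj (hj.le.trans hi) e s t hej⟩

/-- Induction on evaluation. -/
theorem Ev.induct {Q : M → M → M → Prop}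
    (hQ : Df fun v : Fin 3 → M => Q (v 0) (v 1) (v 2))
    (h : ∀ e s t, StepR (fun e s t => Ev e s t ∧ Q e s t) e s t → Q e s t) {e s t : M}
    (hev : Ev e s t) : Q e s t := by
  have hQ' : ∀ {n : ℕ} {f g h : (Fin n → M) → M} [DfF f] [DfF g] [DfF h],
      Df fun v => Q (f v) (g v) (h v) := hQ.comp₃ inferInstance inferInstance inferInstance
  exact Ev.rec_of_induct (fun a b l H => strong_induct inferInstance H) h hev

end EvaluationRules

/-! ### Inversion of the evaluation relation according to the form of the program. -/

section EvaluationCases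

variable {M : Type} [PeanoModel M]

/-- Composite programs are told apart by the remainder of their number modulo 4. -/
theorem code_ne_of_lt {i j : M} (hi : i < 4) (hj : j < 4) (hij : i ≠ j) (a b : M) :
    4 * a + (4 + i) ≠ 4 * b + (4 + j) := fun h =>
  hij (four_mul_inj (a := a + 1) (b := b + 1)
    (by rw [mul_add, mul_add, mul_one, add_assoc, add_assoc, h]) hi hj).2

/-- The numbers of the different kinds of composite programs are different. -/
theorem code_ne (a b : M) : (4 * a + 4 ≠ 4 * b + 5 ∧ 4 * a + 4 ≠ 4 * b + 6 ∧
    4 * a + 4 ≠ 4 * b + 7) ∧ (4 * a + 5 ≠ 4 * b + 4 ∧ 4 * a + 5 ≠ 4 * b + 6 ∧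
    4 * a + 5 ≠ 4 * b + 7) ∧ (4 * a + 6 ≠ 4 * b + 4 ∧ 4 * a + 6 ≠ 4 * b + 5 ∧
    4 * a + 6 ≠ 4 * b + 7) ∧ 4 * a + 7 ≠ 4 * b + 4 ∧ 4 * a + 7 ≠ 4 * b + 5 ∧
    4 * a + 7 ≠ 4 * b + 6 := by
  have h4 : (4 : M) = 4 + 0 := by norm_num
  have h5 : (5 : M) = 4 + 1 := by norm_num
  have h6 : (6 : M) = 4 + 2 := by norm_num
  have h7 : (7 : M) = 4 + 3 := by norm_num
  have h01 := code_ne_of_lt (M := M) (i := 0) (j := 1) (by norm_num) (by norm_num) (by norm_num)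
  have h02 := code_ne_of_lt (M := M) (i := 0) (j := 2) (by norm_num) (by norm_num) (by norm_num)
  have h03 := code_ne_of_lt (M := M) (i := 0) (j := 3) (by norm_num) (by norm_num) (by norm_num)
  have h12 := code_ne_of_lt (M := M) (i := 1) (j := 2) (by norm_num) (by norm_num) (by norm_num)
  have h13 := code_ne_of_lt (M := M) (i := 1) (j := 3) (by norm_num) (by norm_num) (by norm_num)
  have h23 := code_ne_of_lt (M := M) (i := 2) (j := 3) (by norm_num) (by norm_num) (by norm_num)
  rw [← h4, ← h5] at h01
  rw [← h4, ← h6] at h02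
  rw [← h4, ← h7] at h03
  rw [← h5, ← h6] at h12
  rw [← h5, ← h7] at h13
  rw [← h6, ← h7] at h23
  exact ⟨⟨h01 a b, h02 a b, h03 a b⟩, ⟨(h01 b a).symm, h12 a b, h13 a b⟩,
    ⟨(h02 b a).symm, (h12 b a).symm, h23 a b⟩, (h03 b a).symm, (h13 b a).symm, (h23 b a).symm⟩

theorem base_ne {i j : M} (h : j < i) (a : M) : 4 * a + i ≠ j ∧ j ≠ 4 * a + i :=
  have := lt_of_lt_of_le h (le_add_self (a := i) (b := 4 * a))
  ⟨this.ne', this.ne⟩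

/-- The numbers of the basic programs differ from those of the composite programs. -/
theorem code_ne_base (a : M) : ((4 * a + 4 ≠ 0 ∧ 4 * a + 4 ≠ 1 ∧ 4 * a + 4 ≠ 2 ∧ 4 * a + 4 ≠ 3) ∧
    (4 * a + 5 ≠ 0 ∧ 4 * a + 5 ≠ 1 ∧ 4 * a + 5 ≠ 2 ∧ 4 * a + 5 ≠ 3) ∧
    (4 * a + 6 ≠ 0 ∧ 4 * a + 6 ≠ 1 ∧ 4 * a + 6 ≠ 2 ∧ 4 * a + 6 ≠ 3) ∧
    4 * a + 7 ≠ 0 ∧ 4 * a + 7 ≠ 1 ∧ 4 * a + 7 ≠ 2 ∧ 4 * a + 7 ≠ 3) ∧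
    (0 ≠ 4 * a + 4 ∧ 1 ≠ 4 * a + 4 ∧ 2 ≠ 4 * a + 4 ∧ 3 ≠ 4 * a + 4) ∧
    (0 ≠ 4 * a + 5 ∧ 1 ≠ 4 * a + 5 ∧ 2 ≠ 4 * a + 5 ∧ 3 ≠ 4 * a + 5) ∧
    (0 ≠ 4 * a + 6 ∧ 1 ≠ 4 * a + 6 ∧ 2 ≠ 4 * a + 6 ∧ 3 ≠ 4 * a + 6) ∧
    0 ≠ 4 * a + 7 ∧ 1 ≠ 4 * a + 7 ∧ 2 ≠ 4 * a + 7 ∧ 3 ≠ 4 * a + 7 := by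
  refine ⟨⟨⟨?_, ?_, ?_, ?_⟩, ⟨?_, ?_, ?_, ?_⟩, ⟨?_, ?_, ?_, ?_⟩, ?_, ?_, ?_, ?_⟩,
    ⟨?_, ?_, ?_, ?_⟩, ⟨?_, ?_, ?_, ?_⟩, ⟨?_, ?_, ?_, ?_⟩, ?_, ?_, ?_, ?_⟩
  all_goals first
    | exact (base_ne (by norm_num) a).1
    | exact (base_ne (by norm_num) a).2

theorem zero_ne_succ (a : M) : 0 ≠ a + 1 :=
  (add_pos_of_nonneg_of_pos zero_le zero_lt_one).ne

theorem ev_zero {s t : M} : Ev 0 s t ↔ t = 0 := by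
  rw [ev_iff_step, StepR]
  simp [code_ne_base]

theorem ev_succ {s t : M} : Ev 1 s t ↔ t = s + 1 := by
  rw [ev_iff_step, StepR]
  simp [code_ne_base]

theorem ev_left {s t : M} : Ev 2 s t ↔ t = fst s := by
  rw [ev_iff_step, StepR]
  simp [code_ne_base]
  exact ⟨by rintro ⟨u, rfl⟩; simp, by rintro rfl; exact ⟨snd s, (pr_fst_snd s).symm⟩⟩

theorem ev_right {s t : M} : Ev 3 s t ↔ t = snd s := by
  rw [ev_iff_step, StepR]
  simp [code_ne_base]
  exact ⟨by rintro ⟨u, rfl⟩; simp, by rintro rfl; exact ⟨fst s, (pr_fst_snd s).symm⟩⟩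

theorem ev_pair {f g s t : M} :
    Ev (4 * pr f g + 4) s t ↔ ∃ u v, Ev f s u ∧ Ev g s v ∧ t = pr u v := by
  rw [ev_iff_step, StepR]
  simp [code_ne_base, code_ne, pr_inj_iff]

theorem ev_comp {f g s t : M} : Ev (4 * pr f g + 6) s t ↔ ∃ u, Ev g s u ∧ Ev f u t := by
  rw [ev_iff_step, StepR]
  simp [code_ne_base, code_ne, pr_inj_iff]

theorem ev_prec_zero {f g a t : M} : Ev (4 * pr f g + 5) (pr a 0) t ↔ Ev f a t := by
  rw [ev_iff_step, StepR]
  simp [zero_ne_succ, code_ne_base, code_ne, pr_inj_iff]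

theorem ev_prec_succ {f g a n t : M} : Ev (4 * pr f g + 5) (pr a (n + 1)) t ↔
    ∃ u, Ev (4 * pr f g + 5) (pr a n) u ∧ Ev g (pr a (pr n u)) t := by
  rw [ev_iff_step, StepR]
  simp [code_ne_base, code_ne, pr_inj_iff]

theorem ev_rfind {f a m t : M} : Ev (4 * f + 7) (pr a m) t ↔ (Ev f (pr a m) 0 ∧ t = m) ∨
    ∃ k, Ev f (pr a m) (k + 1) ∧ Ev (4 * f + 7) (pr a (m + 1)) t := by
  rw [ev_iff_step, StepR]
  simp [code_ne_base, code_ne, pr_inj_iff]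
  grind only

/-- Induction along one computation, with inversion of the other; the induction statement quantifies
over the second output. -/
theorem Ev.unique {e s t t' : M} (h : Ev e s t) (h' : Ev e s t') : t = t' := by
  refine Ev.induct (Q := fun e s t => ∀ t', Ev e s t' → t = t') inferInstance ?_ h t' h'
  rintro e s t (⟨rfl, rfl⟩ | ⟨rfl, rfl⟩ | ⟨rfl, u, rfl⟩ | ⟨rfl, u, rfl⟩ |
    ⟨f, g, u, v, rfl, ⟨-, h⟩, ⟨-, h'⟩, rfl⟩ | ⟨f, g, u, rfl, ⟨-, h⟩, ⟨-, h'⟩⟩ |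
    ⟨f, g, a, rfl, rfl, -, h⟩ | ⟨f, g, a, n, u, rfl, rfl, ⟨-, h⟩, ⟨-, h'⟩⟩ |
    ⟨f, a, rfl, rfl, -, h⟩ | ⟨f, a, m, k, rfl, rfl, ⟨-, h⟩, ⟨-, h'⟩⟩) t' ht'
  · exact (ev_zero.1 ht').symm
  · exact (ev_succ.1 ht').symm
  · rw [ev_left.1 ht', fst_pr]
  · rw [ev_right.1 ht', snd_pr]
  · obtain ⟨u', v', hu, hv, rfl⟩ := ev_pair.1 ht'
    rw [h _ hu, h' _ hv]
  · obtain ⟨u', hu, hv⟩ := ev_comp.1 ht'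
    rw [← h _ hu] at hv
    exact h' _ hv
  · exact h _ (ev_prec_zero.1 ht')
  · obtain ⟨u', hu, hv⟩ := ev_prec_succ.1 ht'
    rw [← h _ hu] at hv
    exact h' _ hv
  · obtain ⟨-, rfl⟩ | ⟨k, hk, -⟩ := ev_rfind.1 ht'
    · rfl
    · exact absurd (h _ hk) (zero_ne_succ k)
  · obtain ⟨hk, -⟩ | ⟨k, hk, hr⟩ := ev_rfind.1 ht'
    · have := h _ hk
      simp at this
    · exact h' _ hr

theorem ev_rfind_iff {f a m t : M} : Ev (4 * f + 7) (pr a m) t ↔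
    m ≤ t ∧ Ev f (pr a t) 0 ∧ ∀ i, m ≤ i → i < t → ∃ k, Ev f (pr a i) (k + 1) := by
  constructor
  · intro h
    have := Ev.induct (M := M) (Q := fun e s t => e = 4 * f + 7 → snd s ≤ t ∧ Ev f (pr (fst s) t) 0 ∧
      ∀ i, snd s ≤ i → i < t → ∃ k, Ev f (pr (fst s) i) (k + 1)) (by infer_instance) ?_ h rfl
    · simpa only [fst_pr, snd_pr] using this
    rintro e s t hstep rfl
    simp only [StepR, code_ne_base, code_ne, add_left_inj, mul_eq_mul_left_iff, false_and,
      exists_false, false_or, OfNat.ofNat_ne_zero, or_false] at hstep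
    obtain ⟨f, a, rfl, rfl, h, -⟩ | ⟨f, a, m, k, rfl, rfl, h, -, h'⟩ := hstep <;>
      simp only [fst_pr, snd_pr] at *
    · exact ⟨le_rfl, h, fun i hi hi' => absurd hi' (not_lt_of_ge hi)⟩
    · obtain ⟨hm, h0, hi⟩ := h' trivial
      refine ⟨(lt_add_one _).le.trans hm, h0, fun i hmi hit => ?_⟩
      obtain hmi | rfl := hmi.lt_or_eq
      · exact hi i (add_one_le_of_lt hmi) hit
      · exact ⟨k, h.1⟩
  · rintro ⟨hm, h0, h⟩
    obtain ⟨j, rfl⟩ := exists_add_of_le hm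
    -- The induction is on the distance from the point where the search succeeds, so the values are
    -- obtained backwards from there.
    refine induct (P := fun j' => ∀ i, m ≤ i → i + j' = m + j →
      Ev (4 * f + 7) (pr a i) (m + j)) (fun i _ hi => ?_) (fun j' ih i hi hij => ?_) j m le_rfl rfl
    · rw [add_zero] at hi
      subst hi
      exact ev_rfind.2 (.inl ⟨h0, rfl⟩)
    · rw [add_comm j', ← add_assoc] at hij
      obtain ⟨k, hk⟩ := h i hi (by
        rw [← hij]; exact (lt_add_one i).trans_le le_self_add)
      exact ev_rfind.2 (.inr ⟨k, hk, ih _ (hi.trans (lt_add_one i).le) hij⟩)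

end EvaluationCases

/-! ### Powers of two and bit strings -/

section PowersOfTwo

variable {M : Type} [PeanoModel M]

/-- `p` is the power of two with the exponent `n`, by means of a code of the sequence of the
smaller powers. -/
def Pw (n p : M) : Prop :=
  ∃ a b, Bt a b 0 1 ∧ (∀ i < n, ∃ c, Bt a b i c ∧ Bt a b (i + 1) (c + c)) ∧ Bt a b n p

theorem realize_expF (w : Fin 2 → M) : expF.Realize w ↔ Pw (w 0) (w 1) := by
  rw [expF, Formula.Realize]
  simp [Pw, realize_app, realize_betaF, Fin.snoc]

theorem pw_zero {p : M} : Pw 0 p ↔ p = 1 := by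
  constructor
  · rintro ⟨a, b, h, -, h'⟩
    exact h'.unique h
  · rintro rfl
    obtain ⟨a, b, h⟩ := exists_code (F := fun i c : M => c = 1) inferInstance 1 (by simp)
    obtain ⟨c, rfl, hc⟩ := h 0 zero_lt_one
    exact ⟨a, b, hc, fun i hi => absurd hi (not_lt_of_ge zero_le), hc⟩

theorem pw_succ {n p : M} : Pw (n + 1) p ↔ ∃ q, Pw n q ∧ p = q + q := by
  constructor
  · rintro ⟨a, b, h0, h, hp⟩
    obtain ⟨c, hc, hc'⟩ := h n (lt_add_one n)
    exact ⟨c, ⟨a, b, h0, fun i hi => h i (hi.trans (lt_add_one n)), hc⟩, hp.unique hc'⟩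
  · rintro ⟨q, ⟨a, b, h0, h, hq⟩, rfl⟩
    obtain ⟨a', b', h'⟩ := exists_code
      (F := fun i c : M => (i ≤ n ∧ Bt a b i c) ∨ (i = n + 1 ∧ c = q + q)) inferInstance
      (n + 1 + 1) (fun i hi => by
        obtain hi | rfl := (lt_add_one_iff'.1 hi).lt_or_eq
        · obtain ⟨c, hc⟩ := exists_bt a b i
          exact ⟨c, .inl ⟨lt_add_one_iff'.1 hi, hc⟩⟩
        · exact ⟨_, .inr ⟨rfl, rfl⟩⟩)
    have hle : ∀ i ≤ n, ∀ c, Bt a b i c → Bt a' b' i c := fun i hi c hc => by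
      have hi' := lt_add_one_iff'.2 hi
      obtain ⟨c', ⟨-, hc'⟩ | ⟨rfl, -⟩, hb⟩ := h' i (hi'.trans (lt_add_one _))
      · rwa [hc.unique hc']
      · exact absurd hi' (lt_irrefl _)
    have hlast : Bt a' b' (n + 1) (q + q) := by
      obtain ⟨c', ⟨hi, -⟩ | ⟨-, rfl⟩, hb⟩ := h' (n + 1) (lt_add_one _)
      · exact absurd hi (not_le_of_gt (lt_add_one n))
      · exact hb
    refine ⟨a', b', hle 0 zero_le _ h0, fun i hi => ?_, hlast⟩
    obtain hi | rfl := (lt_add_one_iff'.1 hi).lt_or_eq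
    · obtain ⟨c, hc, hc'⟩ := h i hi
      exact ⟨c, hle _ hi.le _ hc, hle _ (add_one_le_of_lt hi) _ hc'⟩
    · exact ⟨q, hle _ le_rfl _ hq, hlast⟩

theorem Pw.existsUnique (n : M) : ∃! p, Pw n p := by
  have : ∀ {k : ℕ} {f g : (Fin k → M) → M} [DfF f] [DfF g], Df fun v => Pw (f v) (g v) :=
    Df.comp₂ (P := Pw) (by unfold Pw; infer_instance) inferInstance inferInstance
  refine induct (P := fun n => ∃ p, Pw n p ∧ ∀ q, Pw n q → q = p) ?_ ?_ n
  · exact ⟨1, pw_zero.2 rfl, fun q => pw_zero.1⟩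
  · rintro n ⟨p, hp, hu⟩
    refine ⟨p + p, pw_succ.2 ⟨p, hp, rfl⟩, fun q hq => ?_⟩
    obtain ⟨r, hr, rfl⟩ := pw_succ.1 hq
    rw [hu r hr]

/-- The power of two with the exponent `n`. -/
noncomputable def pow2 (n : M) : M := (Pw.existsUnique n).choose

theorem pw_iff {n p : M} : Pw n p ↔ p = pow2 n :=
  have h := (Pw.existsUnique n).choose_spec
  ⟨h.2 p, fun hp => hp ▸ h.1⟩

instance DfF.pow2 {n : ℕ} {f : (Fin n → M) → M} [hf : DfF f] : DfF fun v => pow2 (f v) :=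
  DfF.comp₁ (F := ProvUniv.pow2) (Df.congr (P := fun v => Pw (v 1) (v 0))
    (by unfold Pw; infer_instance) fun _ => pw_iff) hf

@[simp] theorem pow2_zero : pow2 (0 : M) = 1 := (pw_iff.1 (pw_zero.2 rfl)).symm

theorem pow2_succ (n : M) : pow2 (n + 1) = pow2 n + pow2 n :=
  (pw_iff.1 (pw_succ.2 ⟨_, pw_iff.2 rfl, rfl⟩)).symm

theorem pow2_pos (n : M) : 0 < pow2 n := by
  refine induct (P := fun n : M => 0 < pow2 n) ?_ (fun n h => ?_) n
  · rw [pow2_zero]; exact zero_lt_one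
  · rw [pow2_succ]; exact add_pos h h

theorem one_le_pow2 (n : M) : 1 ≤ pow2 n := by
  simpa using add_one_le_of_lt (pow2_pos n)

theorem pow2_add (m n : M) : pow2 (m + n) = pow2 m * pow2 n := by
  refine induct (P := fun n : M => pow2 (m + n) = pow2 m * pow2 n) ?_ (fun n h => ?_) n
  · simp
  · rw [← add_assoc, pow2_succ, pow2_succ, h, mul_add]

/-- In this form the intervals from a power of two to its double are disjoint, so a number
determines its leading binary digit. -/
theorem pow2_strictMono {m n : M} (h : m < n) : pow2 m + pow2 m ≤ pow2 n := by
  obtain ⟨k, rfl⟩ := exists_add_of_le (add_one_le_of_lt h)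
  rw [pow2_add, pow2_succ]
  exact le_mul_of_one_le_right zero_le (one_le_pow2 k)

theorem lt_pow2 (n : M) : n < pow2 n := by
  refine induct (P := fun n : M => n < pow2 n) ?_ (fun n h => ?_) n
  · simp
  · rw [pow2_succ]
    exact lt_of_lt_of_le (add_lt_add_left h 1) (add_le_add_right (one_le_pow2 n) _)

theorem exists_log (a : M) (ha : 0 < a) : ∃ l, pow2 l ≤ a ∧ a < pow2 l + pow2 l := by
  obtain ⟨l, hl, hmin⟩ := exists_least (P := fun l => a < pow2 (l + 1)) inferInstance
    ⟨a, (lt_pow2 a).trans (by rw [pow2_succ]; exact lt_add_of_pos_left _ (pow2_pos a))⟩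
  rw [pow2_succ] at hl
  refine ⟨l, ?_, hl⟩
  obtain rfl | ⟨k, rfl⟩ := eq_zero_or_succ l
  · simpa using add_one_le_of_lt ha
  · exact not_lt.1 (hmin k (lt_add_one k))

theorem log_unique {a l l' : M} (h : pow2 l ≤ a ∧ a < pow2 l + pow2 l)
    (h' : pow2 l' ≤ a ∧ a < pow2 l' + pow2 l') : l = l' := by
  rcases lt_trichotomy l l' with hl | hl | hl
  · exact absurd ((pow2_strictMono hl).trans h'.1) (not_le_of_gt h.2)
  · exact hl
  · exact absurd ((pow2_strictMono hl).trans h.1) (not_le_of_gt h'.2)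

/-- The length of the bit string number `s`. -/
noncomputable def len (s : M) : M :=
  (exists_log (s + 1) (add_pos_of_nonneg_of_pos zero_le zero_lt_one)).choose

theorem len_spec (s : M) : pow2 (len s) ≤ s + 1 ∧ s + 1 < pow2 (len s) + pow2 (len s) :=
  (exists_log (s + 1) (add_pos_of_nonneg_of_pos zero_le zero_lt_one)).choose_spec

theorem len_eq_iff {s l : M} : l = len s ↔ pow2 l ≤ s + 1 ∧ s + 1 < pow2 l + pow2 l :=
  ⟨fun h => h ▸ len_spec s, fun h => log_unique h (len_spec s)⟩

theorem realize_lengthF (w : Fin 2 → M) : lengthF.Realize w ↔ w 1 = len (w 0) := by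
  rw [lengthF, Formula.Realize, len_eq_iff]
  simp [realize_app, realize_expF, Fin.snoc, pw_iff]

/-- The string number `s` is a prefix of the string number `s'`. -/
def Pfx (s s' : M) : Prop := ∃ k r, r < pow2 k ∧ s' + 1 = (s + 1) * pow2 k + r

theorem realize_prefixF (w : Fin 2 → M) : prefixF.Realize w ↔ Pfx (w 0) (w 1) := by
  rw [prefixF, Formula.Realize]
  simp [realize_app, realize_expF, Fin.snoc, pw_iff, Pfx]

/-- The domain of the program number `e` is prefix-free. -/
def PrefixFree (e : M) : Prop :=
  ∀ s s' t t', Ev e s t → Ev e s' t' → Pfx s s' → s = s'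

theorem realize_prefixFreeF (w : Fin 1 → M) : prefixFreeF.Realize w ↔ PrefixFree (w 0) := by
  rw [prefixFreeF, Formula.Realize]
  simp [realize_app, realize_evalF, realize_prefixF, Fin.snoc, PrefixFree]

/-- The program number `u` is a universal prefix-free machine. -/
def Univ (u : M) : Prop :=
  PrefixFree u ∧ ∀ e, PrefixFree e → ∃ c, ∀ s t, Ev e s t →
    ∃ s', Ev u s' t ∧ len s' ≤ len s + c

theorem realize_universalF (w : Fin 1 → M) : universalF.Realize w ↔ Univ (w 0) := by
  have h := realize_prefixFreeF w
  rw [Formula.Realize] at h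
  rw [universalF, Formula.Realize]
  simp [h, realize_app, realize_evalF, realize_lengthF, realize_prefixFreeF, Fin.snoc, Univ,
    lt_add_one_iff']

theorem realize_universalSentence (U : Nat.Partrec.Code) :
    M ⊨ universalSentence U ↔ Univ (U.encodeCode : M) := by
  rw [Sentence.Realize, Formula.Realize, universalSentence, realize_app, realize_universalF,
    realize_numeral]

end PowersOfTwo

/-! ### Functions that are computed by the same program in every model -/

section Uniform

open Nat.Partrec (Code)

/-- The function given by `F` in every model of Peano Arithmetic is computed by one program. -/
class UF (F : ∀ (M : Type) [PeanoModel M], M → M) : Prop where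
  out : ∃ c : Code, ∀ (M : Type) [PeanoModel M] (a b : M),
    Ev (c.encodeCode : M) a b ↔ b = F M a

/-- Numbers of actual programs are standard; through this cast the evaluation clauses apply to them
in every model. -/
theorem cast_pair {M : Type} [PeanoModel M] (a b : ℕ) : ((Nat.pair a b : ℕ) : M) = pr (a : M) b := by
  unfold Nat.pair pr
  by_cases h : a < b
  · simp [h]
  · simp [h]

/-! ### The numbers of actual programs inside a model. -/

section Codes

variable {M : Type} [PeanoModel M] (c c' : Code) (a b : M)

@[simp] theorem ev_code_zero : Ev (Code.zero.encodeCode : M) a b ↔ b = 0 := by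
  simp [Code.encodeCode, ev_zero]

@[simp] theorem ev_code_succ : Ev (Code.succ.encodeCode : M) a b ↔ b = a + 1 := by
  simp [Code.encodeCode, ev_succ]

@[simp] theorem ev_code_left : Ev (Code.left.encodeCode : M) a b ↔ b = fst a := by
  simp [Code.encodeCode, ev_left]

@[simp] theorem ev_code_right : Ev (Code.right.encodeCode : M) a b ↔ b = snd a := by
  simp [Code.encodeCode, ev_right]

theorem cast_pairCode :
    ((Code.pair c c').encodeCode : M) = 4 * pr (c.encodeCode : M) c'.encodeCode + 4 := by
  rw [← cast_pair, Code.encodeCode]; push_cast; ring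

theorem cast_compCode :
    ((Code.comp c c').encodeCode : M) = 4 * pr (c.encodeCode : M) c'.encodeCode + 6 := by
  rw [← cast_pair, Code.encodeCode]; push_cast; ring

theorem cast_precCode :
    ((Code.prec c c').encodeCode : M) = 4 * pr (c.encodeCode : M) c'.encodeCode + 5 := by
  rw [← cast_pair, Code.encodeCode]; push_cast; ring

theorem cast_rfindCode : ((Code.rfind' c).encodeCode : M) = 4 * (c.encodeCode : M) + 7 := by
  rw [Code.encodeCode]; push_cast; ring

end Codes

theorem UF.congr {F G : ∀ (M : Type) [PeanoModel M], M → M} (hF : UF F)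
    (h : ∀ (M : Type) [PeanoModel M] (a : M), F M a = G M a) : UF G := by
  rwa [show @G = @F from funext fun M => funext fun _ => funext fun a => (h M a).symm]

theorem UF.comp {F G : ∀ (M : Type) [PeanoModel M], M → M} (hF : UF F) (hG : UF G) :
    UF fun M _ a => F M (G M a) := by
  obtain ⟨c, hc⟩ := hF
  obtain ⟨d, hd⟩ := hG
  exact ⟨c.comp d, fun M _ a b => by simp [cast_compCode, ev_comp, hc, hd]⟩

instance UF.instPr {F G : ∀ (M : Type) [PeanoModel M], M → M} [hF : UF F] [hG : UF G] :
    UF fun M _ a => pr (F M a) (G M a) := by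
  obtain ⟨c, hc⟩ := hF
  obtain ⟨d, hd⟩ := hG
  exact ⟨c.pair d, fun M _ a b => by simp [cast_pairCode, ev_pair, hc, hd]⟩

theorem UF.comp₂ {K : ∀ (M : Type) [PeanoModel M], M → M → M}
    (hK : UF fun M _ a => K M (fst a) (snd a)) {F G : ∀ (M : Type) [PeanoModel M], M → M}
    (hF : UF F) (hG : UF G) : UF fun M _ a => K M (F M a) (G M a) := by
  simpa using hK.comp (UF.instPr (F := F) (G := G))

instance UF.left : UF @fst := ⟨Code.left, fun _ _ a b => ev_code_left a b⟩

instance UF.right : UF @snd := ⟨Code.right, fun _ _ a b => ev_code_right a b⟩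

instance UF.instFst {F : ∀ (M : Type) [PeanoModel M], M → M} [hF : UF F] :
    UF fun M _ a => fst (F M a) :=
  UF.left.comp hF

instance UF.instSnd {F : ∀ (M : Type) [PeanoModel M], M → M} [hF : UF F] :
    UF fun M _ a => snd (F M a) :=
  UF.right.comp hF

instance UF.id : UF fun _ _ a => a :=
  ⟨Code.pair .left .right, fun M _ a b => by
    simp [cast_pairCode, ev_pair, pr_fst_snd]⟩

instance UF.zero : UF fun _ _ _ => 0 := ⟨.zero, fun _ _ a b => ev_code_zero a b⟩

theorem UF.succ {F : ∀ (M : Type) [PeanoModel M], M → M} (hF : UF F) :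
    UF fun M _ a => F M a + 1 :=
  UF.comp ⟨Code.succ, fun _ _ a b => ev_code_succ a b⟩ hF

instance UF.one : UF fun _ _ _ => 1 := by simpa using UF.succ UF.zero

theorem UF.natCast (n : ℕ) : UF fun _ _ _ => (n : _) := by
  induction n with
  | zero => simpa using UF.zero
  | succ n ih => simpa using UF.succ ih

instance UF.ofNat (n : ℕ) [n.AtLeastTwo] : UF fun _ _ _ => OfNat.ofNat n := by
  have h := UF.natCast (OfNat.ofNat n)
  simp only [Nat.cast_ofNat] at h
  exact h

/-- Definition by recursion. -/
theorem UF.prec {G H : ∀ (M : Type) [PeanoModel M], M → M}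
    {F : ∀ (M : Type) [PeanoModel M], M → M → M} (hG : UF G) (hH : UF H)
    (hdf : ∀ (M : Type) [PeanoModel M], Df fun v : Fin 3 → M => v 0 = F M (v 1) (v 2))
    (hzero : ∀ (M : Type) [PeanoModel M] (a : M), F M a 0 = G M a)
    (hsucc : ∀ (M : Type) [PeanoModel M] (a n : M),
      F M a (n + 1) = H M (pr a (pr n (F M a n)))) :
    UF fun M _ a => F M (fst a) (snd a) := by
  obtain ⟨c, hc⟩ := hG
  obtain ⟨d, hd⟩ := hH
  refine ⟨c.prec d, fun M _ a => ?_⟩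
  rw [cast_precCode, ← pr_fst_snd a, fst_pr, snd_pr]
  have : ∀ {k : ℕ} {f g : (Fin k → M) → M} [DfF f] [DfF g], DfF fun v => F M (f v) (g v) :=
    DfF.comp₂ (hdf M) inferInstance inferInstance
  -- The recursion argument may be nonstandard, so the induction must be internal. This is where the
  -- definability of `F` is needed.
  refine induct (P := fun n => ∀ b,
    Ev (4 * pr (c.encodeCode : M) d.encodeCode + 5) (pr (fst a) n) b ↔ b = F M (fst a) n)
    (fun b => ?_) (fun n ih b => ?_) (snd a)
  · rw [ev_prec_zero, hc, hzero]
  · simp [ev_prec_succ, ih, hd, hsucc]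

instance UF.add {F G : ∀ (M : Type) [PeanoModel M], M → M} [hF : UF F] [hG : UF G] :
    UF fun M _ a => F M a + G M a :=
  UF.comp₂ (K := fun M _ a b => a + b) (UF.prec (G := fun _ _ a => a)
    (H := fun M _ a => snd (snd a) + 1) inferInstance
    (UF.succ inferInstance) (fun _ _ => inferInstance) (by simp)
    (by simp [add_assoc])) hF hG

instance UF.mul {F G : ∀ (M : Type) [PeanoModel M], M → M} [hF : UF F] [hG : UF G] :
    UF fun M _ a => F M a * G M a :=
  UF.comp₂ (K := fun M _ a b => a * b) (UF.prec (G := fun _ _ _ => 0)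
    (H := fun M _ a => snd (snd a) + fst a) inferInstance
    inferInstance (fun _ _ => inferInstance) (by simp)
    (by simp [mul_add])) hF hG

instance UF.sub {F G : ∀ (M : Type) [PeanoModel M], M → M} [hF : UF F] [hG : UF G] :
    UF fun M _ a => F M a - G M a := by
  have hpred : UF fun M _ a => a - 1 := by
    have : UF fun M _ a => (fun _ b => b - 1 : M → M → M) (fst a) (snd a) :=
      UF.prec (F := fun _ _ _ b => b - 1) (G := fun _ _ _ => 0)
        (H := fun M _ a => fst (snd a)) inferInstance
        inferInstance (fun _ _ => inferInstance) (by simp) (by simp)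
    simpa using this.comp (UF.instPr (F := fun _ _ a => a) (G := fun _ _ a => a))
  exact UF.comp₂ (K := fun M _ a b => a - b) (UF.prec (G := fun _ _ a => a)
    (H := fun M _ a => snd (snd a) - 1) inferInstance
    (hpred.comp inferInstance) (fun _ _ => inferInstance) (by simp)
    (by simp [tsub_add_eq_tsub_tsub])) hF hG

instance UF.instPow2 {F : ∀ (M : Type) [PeanoModel M], M → M} [hF : UF F] :
    UF fun M _ a => pow2 (F M a) :=
  UF.comp₂ (K := fun M _ _ b => pow2 b) (UF.prec (F := fun _ _ _ b => pow2 b) (G := fun _ _ _ => 1)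
    (H := fun M _ a => snd (snd a) + snd (snd a))
    inferInstance inferInstance (fun _ _ => inferInstance) (by simp)
    (by simp [pow2_succ])) hF hF

open Classical in
/-- The predicate given by `P` in every model is decided by one program. -/
class UD (P : ∀ (M : Type) [PeanoModel M], M → Prop) : Prop where
  out : UF fun M _ a => if P M a then 0 else 1

theorem UD.comp {P : ∀ (M : Type) [PeanoModel M], M → Prop} (hP : UD P)
    {F : ∀ (M : Type) [PeanoModel M], M → M} (hF : UF F) : UD fun M _ a => P M (F M a) :=
  ⟨hP.out.comp hF⟩

open Classical in
theorem UD.of_uf {P : ∀ (M : Type) [PeanoModel M], M → Prop}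
    {F : ∀ (M : Type) [PeanoModel M], M → M} (hF : UF F)
    (h : ∀ (M : Type) [PeanoModel M] (a : M), F M a = if P M a then 0 else 1) : UD P :=
  ⟨hF.congr h⟩

instance UD.and {P Q : ∀ (M : Type) [PeanoModel M], M → Prop} [hP : UD P] [hQ : UD Q] :
    UD fun M _ a => P M a ∧ Q M a := by
  obtain ⟨hP⟩ := hP
  obtain ⟨hQ⟩ := hQ
  refine UD.of_uf (UF.sub (F := fun _ _ _ => 1) (G := _) (hG := UF.mul
    (hF := UF.sub (F := fun _ _ _ => 1) (hG := hP))
    (hG := UF.sub (F := fun _ _ _ => 1) (hG := hQ)))) fun M _ a => ?_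
  by_cases h : P M a <;> by_cases h' : Q M a <;> simp [h, h']

instance UD.not {P : ∀ (M : Type) [PeanoModel M], M → Prop} [hP : UD P] :
    UD fun M _ a => ¬P M a := by
  obtain ⟨hP⟩ := hP
  refine UD.of_uf (UF.sub (F := fun _ _ _ => 1) (hG := hP)) fun M _ a => ?_
  by_cases h : P M a <;> simp [h]

theorem UD.congr {P Q : ∀ (M : Type) [PeanoModel M], M → Prop} (hP : UD P)
    (h : ∀ (M : Type) [PeanoModel M] (a : M), P M a ↔ Q M a) : UD Q := by
  rwa [show Q = P from funext fun M => funext fun _ => funext fun a => propext (h M a).symm]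

instance UD.or {P Q : ∀ (M : Type) [PeanoModel M], M → Prop} [hP : UD P] [hQ : UD Q] :
    UD fun M _ a => P M a ∨ Q M a :=
  UD.congr (P := fun M _ a => ¬(¬P M a ∧ ¬Q M a)) inferInstance fun _ _ _ => by tauto

instance UD.lt {F G : ∀ (M : Type) [PeanoModel M], M → M} [hF : UF F] [hG : UF G] :
    UD fun M _ a => F M a < G M a := by
  refine UD.of_uf (F := fun M _ a => 1 - (G M a - F M a)) inferInstance fun M _ a => ?_
  split_ifs with h
  · have h1 := add_one_le_of_lt (tsub_pos_of_lt h)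
    exact tsub_eq_zero_of_le (by simpa using h1)
  · rw [tsub_eq_zero_of_le (not_lt.1 h), tsub_zero]

instance UD.le {F G : ∀ (M : Type) [PeanoModel M], M → M} [hF : UF F] [hG : UF G] :
    UD fun M _ a => F M a ≤ G M a :=
  UD.congr (P := fun M _ a => ¬G M a < F M a) inferInstance fun _ _ _ => not_lt

instance UD.eq {F G : ∀ (M : Type) [PeanoModel M], M → M} [hF : UF F] [hG : UF G] :
    UD fun M _ a => F M a = G M a :=
  UD.congr (P := fun M _ a => F M a ≤ G M a ∧ G M a ≤ F M a) inferInstance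
    fun _ _ _ => le_antisymm_iff.symm

/-- The deciding program defines the predicate through `Ev`, which gives access to internal
induction. -/
theorem UD.df {P : ∀ (M : Type) [PeanoModel M], M → Prop} (hP : UD P) (M : Type)
    [PeanoModel M] : Df fun v : Fin 1 → M => P M (v 0) := by
  obtain ⟨c, hc⟩ := hP
  refine Df.congr (P := fun v : Fin 1 → M => Ev (c.encodeCode : M) (v 0) 0) inferInstance fun v => ?_
  rw [hc]
  split_ifs with h <;> simp [h]

open Classical in
instance UD.exLt {P : ∀ (M : Type) [PeanoModel M], M → M → Prop}
    {F : ∀ (M : Type) [PeanoModel M], M → M}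
    [hP : UD fun M _ a => P M (fst a) (snd a)] [hF : UF F] :
    UD fun M _ a => ∃ z, z < F M a ∧ P M a z := by
  have hdf : ∀ (M : Type) [PeanoModel M] {k : ℕ} {f g : (Fin k → M) → M} [DfF f] [DfF g],
      Df fun v => P M (f v) (g v) := fun M _ k f g _ _ => by
    simpa using (hP.df M).comp₁ (P := fun a => P M (fst a) (snd a)) (f := fun v => pr (f v) (g v)) inferInstance
  have h : UF fun M _ a => (fun a n => if ∃ z, z < n ∧ P M a z then 0 else 1 : M → M → M)
      (fst a) (snd a) := by
    refine UF.prec (F := fun M _ a n => if ∃ z, z < n ∧ P M a z then 0 else 1)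
      (G := fun _ _ _ => 1)
      -- Truth is coded by 0, so the product of the codes below the bound codes an existential
      -- statement.
      (H := fun M _ a => snd (snd a) *
        if P M (fst (pr (fst a) (fst (snd a))))
          (snd (pr (fst a) (fst (snd a)))) then 0 else 1)
      inferInstance (UF.mul (hG := UF.comp hP.out inferInstance)) (fun M _ => ?_) ?_ ?_
    · have := @hdf M _
      refine Df.congr (P := fun v : Fin 3 → M => ((∃ z, z < v 2 ∧ P M (v 1) z) ∧ v 0 = 0) ∨
        (¬(∃ z, z < v 2 ∧ P M (v 1) z) ∧ v 0 = 1)) inferInstance fun v => ?_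
      split_ifs with h <;> simp [h]
    · intro M _ a
      rw [if_neg]
      rintro ⟨z, hz, -⟩
      exact absurd hz (not_lt_of_ge zero_le)
    · intro M _ a n
      simp only [snd_pr, fst_pr]
      have : (∃ z, z < n + 1 ∧ P M a z) ↔ (∃ z, z < n ∧ P M a z) ∨ P M a n := by
        constructor
        · rintro ⟨z, hz, h⟩
          obtain hz | rfl := (lt_add_one_iff'.1 hz).lt_or_eq
          · exact .inl ⟨z, hz, h⟩
          · exact .inr h
        · rintro (⟨z, hz, h⟩ | h)
          · exact ⟨z, hz.trans (lt_add_one n), h⟩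
          · exact ⟨n, lt_add_one n, h⟩
      rw [this]
      by_cases h : ∃ z, z < n ∧ P M a z <;> by_cases h' : P M a n <;> simp [h, h']
  have := h.comp (UF.instPr (F := fun _ _ a => a) (G := F))
  exact ⟨by simpa using this⟩

instance UD.allLt {P : ∀ (M : Type) [PeanoModel M], M → M → Prop}
    {F : ∀ (M : Type) [PeanoModel M], M → M}
    [hP : UD fun M _ a => P M (fst a) (snd a)] [hF : UF F] :
    UD fun M _ a => ∀ z, z < F M a → P M a z :=
  UD.congr (P := fun M _ a => ¬∃ z, z < F M a ∧ ¬P M a z) inferInstance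
    fun _ _ _ => by push Not; rfl

end Uniform

/-! ### Relations that are enumerated by the same program in every model -/

section UniformlyEnumerable

open Nat.Partrec (Code)

theorem UD.df₂ {P : ∀ (M : Type) [PeanoModel M], M → M → Prop}
    (hP : UD fun M _ a => P M (fst a) (snd a)) (M : Type) [PeanoModel M] {k : ℕ}
    {f g : (Fin k → M) → M} (_ : DfF f) (_ : DfF g) : Df fun v => P M (f v) (g v) := by
  simpa using (hP.df M).comp₁ (P := fun a => P M (fst a) (snd a)) (f := fun v => pr (f v) (g v))
    inferInstance

/-- The predicate given by `P` in every model says that a search has a result, where the relation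
that is searched is decided by one program. -/
class US (P : ∀ (M : Type) [PeanoModel M], M → Prop) : Prop where
  out : ∃ R : ∀ (M : Type) [PeanoModel M], M → M → Prop, (UD fun M _ a => R M (fst a) (snd a)) ∧
    (∀ (M : Type) [PeanoModel M] (a z z' : M), z ≤ z' → R M a z → R M a z') ∧
    ∀ (M : Type) [PeanoModel M] (a : M), P M a ↔ ∃ z, R M a z

theorem US.congr {P Q : ∀ (M : Type) [PeanoModel M], M → Prop} (hP : US P)
    (h : ∀ (M : Type) [PeanoModel M] (a : M), P M a ↔ Q M a) : US Q := by
  rwa [show @Q = @P from funext fun M => funext fun _ => funext fun a => propext (h M a).symm]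

theorem US.of_ud {P : ∀ (M : Type) [PeanoModel M], M → Prop} (hP : UD P) : US P :=
  ⟨fun M _ a _ => P M a, hP.comp inferInstance, fun _ _ _ _ _ _ h => h,
    fun _ _ _ => ⟨fun h => ⟨0, h⟩, fun ⟨_, h⟩ => h⟩⟩

instance US.lt {F G : ∀ (M : Type) [PeanoModel M], M → M} [hF : UF F] [hG : UF G] :
    US fun M _ a => F M a < G M a := .of_ud inferInstance

instance US.le {F G : ∀ (M : Type) [PeanoModel M], M → M} [hF : UF F] [hG : UF G] :
    US fun M _ a => F M a ≤ G M a := .of_ud inferInstance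

instance US.eq {F G : ∀ (M : Type) [PeanoModel M], M → M} [hF : UF F] [hG : UF G] :
    US fun M _ a => F M a = G M a := .of_ud inferInstance

/-- Two search bounds are replaced by their maximum, which is why the searched relation is required
to be monotone. -/
instance US.and {P Q : ∀ (M : Type) [PeanoModel M], M → Prop} [hP : US P] [hQ : US Q] :
    US fun M _ a => P M a ∧ Q M a := by
  obtain ⟨R, hR, hm, hP⟩ := hP
  obtain ⟨S, hS, hm', hQ⟩ := hQ
  refine ⟨fun M _ a z => R M a z ∧ S M a z, inferInstance,
    fun M _ a z z' hz h => ⟨hm M a z z' hz h.1, hm' M a z z' hz h.2⟩, fun M _ a => ?_⟩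
  rw [hP, hQ]
  constructor
  · rintro ⟨⟨z, hz⟩, z', hz'⟩
    exact ⟨max z z', hm M a z _ (le_max_left _ _) hz, hm' M a z' _ (le_max_right _ _) hz'⟩
  · rintro ⟨z, hz, hz'⟩
    exact ⟨⟨z, hz⟩, z, hz'⟩

instance US.or {P Q : ∀ (M : Type) [PeanoModel M], M → Prop} [hP : US P] [hQ : US Q] :
    US fun M _ a => P M a ∨ Q M a := by
  obtain ⟨R, hR, hm, hP⟩ := hP
  obtain ⟨S, hS, hm', hQ⟩ := hQ
  refine ⟨fun M _ a z => R M a z ∨ S M a z, inferInstance,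
    fun M _ a z z' hz h => h.imp (hm M a z z' hz) (hm' M a z z' hz), fun M _ a => ?_⟩
  rw [hP, hQ, ← exists_or]

/-- A single number bounds both the witness and the search for its certificate. -/
instance US.ex {P : ∀ (M : Type) [PeanoModel M], M → M → Prop}
    [hP : US fun M _ a => P M (fst a) (snd a)] : US fun M _ a => ∃ z, P M a z := by
  obtain ⟨R, hR, hm, hP⟩ := hP
  refine ⟨fun M _ a w => ∃ z, z < w ∧ R M (pr a z) w, ?_, ?_, fun M _ a => ?_⟩
  · have : UD fun M _ a => R M (pr (fst (fst a)) (snd a)) (snd (fst a)) := by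
      simpa using hR.comp (F := fun M _ a => pr (pr (fst (fst a)) (snd a)) (snd (fst a)))
        inferInstance
    infer_instance
  · rintro M _ a w w' hw ⟨z, hz, h⟩
    exact ⟨z, hz.trans_le hw, hm M _ _ _ hw h⟩
  · have hP' : ∀ z, P M a z ↔ ∃ w, R M (pr a z) w := fun z => by simpa using hP M (pr a z)
    constructor
    · rintro ⟨z, hz⟩
      obtain ⟨w, hw⟩ := (hP' z).1 hz
      exact ⟨max (z + 1) w, z, (lt_add_one z).trans_le (le_max_left _ _),
        hm M _ _ _ (le_max_right _ _) hw⟩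
    · rintro ⟨w, z, -, h⟩
      exact ⟨z, (hP' z).2 ⟨w, h⟩⟩

/-- Σ₁ collection: by internal induction on the bound, the finitely many searches, in the sense of
the model, share one search bound. -/
instance US.allLt {P : ∀ (M : Type) [PeanoModel M], M → M → Prop}
    {F : ∀ (M : Type) [PeanoModel M], M → M}
    [hP : US fun M _ a => P M (fst a) (snd a)] [hF : UF F] :
    US fun M _ a => ∀ z, z < F M a → P M a z := by
  obtain ⟨R, hR, hm, hP⟩ := hP
  refine ⟨fun M _ a w => ∀ z, z < F M a → R M (pr a z) w, ?_, ?_, fun M _ a => ?_⟩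
  · have : UD fun M _ a => R M (pr (fst (fst a)) (snd a)) (snd (fst a)) := by
      simpa using hR.comp (F := fun M _ a => pr (pr (fst (fst a)) (snd a)) (snd (fst a)))
        inferInstance
    have := hF.comp UF.left
    infer_instance
  · exact fun M _ a w w' hw h z hz => hm M _ _ _ hw (h z hz)
  · have hP' : ∀ z, P M a z ↔ ∃ w, R M (pr a z) w := fun z => by simpa using hP M (pr a z)
    have : ∀ {k : ℕ} {f g : (Fin k → M) → M} [DfF f] [DfF g], Df fun v => R M (f v) (g v) :=
      hR.df₂ M inferInstance inferInstance
    simp only [hP']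
    refine ⟨?_, fun ⟨w, h⟩ z hz => ⟨w, h z hz⟩⟩
    refine induct (P := fun n => (∀ z, z < n → ∃ w, R M (pr a z) w) →
      ∃ w, ∀ z, z < n → R M (pr a z) w) (fun _ => ⟨0, fun z hz => ?_⟩) (fun n ih h => ?_) (F M a)
    · exact absurd hz (not_lt_of_ge zero_le)
    · obtain ⟨w, hw⟩ := ih fun z hz => h z (hz.trans (lt_add_one n))
      obtain ⟨w', hw'⟩ := h n (lt_add_one n)
      refine ⟨max w w', fun z hz => ?_⟩
      obtain hz | rfl := (lt_add_one_iff'.1 hz).lt_or_eq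
      · exact hm M _ _ _ (le_max_left _ _) (hw z hz)
      · exact hm M _ _ _ (le_max_right _ _) hw'

theorem US.comp {P : ∀ (M : Type) [PeanoModel M], M → Prop} (hP : US P)
    {F : ∀ (M : Type) [PeanoModel M], M → M} (hF : UF F) : US fun M _ a => P M (F M a) := by
  obtain ⟨R, hR, hm, hP⟩ := hP
  have := hF.comp UF.left
  refine ⟨fun M _ a z => R M (F M a) z, ?_, fun M _ _ => hm M _, fun M _ _ => hP M _⟩
  simpa using hR.comp (F := fun M _ a => pr (F M (fst a)) (snd a)) inferInstance

instance US.bt {F G H K : ∀ (M : Type) [PeanoModel M], M → M} [UF F] [UF G] [UF H] [UF K] :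
    US fun M _ a => Bt (F M a) (G M a) (H M a) (K M a) := by
  have : US fun M _ a => Bt (fst a) (fst (snd a)) (fst (snd (snd a))) (snd (snd (snd a))) := by
    unfold Bt
    infer_instance
  simpa using this.comp (F := fun M _ a => pr (F M a) (pr (G M a) (pr (H M a) (K M a))))
    inferInstance

set_option maxHeartbeats 1000000 in
set_option synthInstance.maxHeartbeats 1000000 in
set_option synthInstance.maxSize 100000 in
instance US.ev {F G H : ∀ (M : Type) [PeanoModel M], M → M} [UF F] [UF G] [UF H] :
    US fun M _ a => Ev (F M a) (G M a) (H M a) := by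
  have : US fun M _ a => Ev (fst a) (fst (snd a)) (snd (snd a)) := by
    -- Unfolded, evaluation is built from enumerable relations by existential quantifiers, bounded
    -- universal quantifiers, conjunctions and disjunctions.
    unfold Ev Valid StepR Before Entry
    infer_instance
  simpa using this.comp (F := fun M _ a => pr (F M a) (pr (G M a) (H M a))) inferInstance

/-- A uniformly enumerable relation has a uniform choice function that is computed by one program
in every model. -/
theorem US.exists_code {P : ∀ (M : Type) [PeanoModel M], M → M → Prop}
    (hP : US fun M _ a => P M (fst a) (snd a)) : ∃ c : Code, ∀ (M : Type) [PeanoModel M] (x : M),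
      (∀ t, Ev (c.encodeCode : M) x t → P M x t) ∧
      ∀ t, P M x t → ∃ t', Ev (c.encodeCode : M) x t' := by
  obtain ⟨R, hR, -, hP⟩ := hP
  have hP' : ∀ (M : Type) [PeanoModel M] (x t : M), P M x t ↔ ∃ z, R M (pr x t) z :=
    fun M _ x t => by simpa using hP M (pr x t)
  obtain ⟨d, hd⟩ := (hR.comp (F := fun M _ a => pr (pr (fst a) (fst (snd a))) (snd (snd a)))
    inferInstance).out
  classical
  replace hd : ∀ (M : Type) [PeanoModel M] (x w b : M), Ev (d.encodeCode : M) (pr x w) b ↔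
      b = if R M (pr x (fst w)) (snd w) then 0 else 1 := fun M _ x w b => by
    rw [hd]
    simp only [fst_pr, snd_pr]
  -- Pairs of an output and its certificate are searched from 0 upwards, and the output component of
  -- the first hit is returned.
  refine ⟨.comp .left (.comp (.rfind' d) (.pair (.pair .left .right) .zero)), fun M _ x => ?_⟩
  have hdf : ∀ {k : ℕ} {f g : (Fin k → M) → M} [DfF f] [DfF g], Df fun v => R M (f v) (g v) :=
    hR.df₂ M inferInstance inferInstance
  have hev : ∀ t, Ev ((Code.comp .left (.comp (.rfind' d) (.pair (.pair .left .right)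
      .zero))).encodeCode : M) x t ↔ ∃ w, Ev (4 * (d.encodeCode : M) + 7) (pr x 0) w ∧
        t = fst w := fun t => by
    simp [cast_compCode, cast_pairCode, cast_rfindCode, ev_comp, ev_pair, pr_fst_snd]
  simp only [hev, hP']
  constructor
  · rintro t ⟨w, hw, rfl⟩
    exact ⟨snd w, by simpa [hd] using (ev_rfind_iff.1 hw).2.1⟩
  · rintro t ⟨z, hz⟩
    -- The least hit exists even in nonstandard models, because the searched relation is definable.
    obtain ⟨w, hw, hmin⟩ := exists_least (P := fun w => R M (pr x (fst w)) (snd w)) inferInstance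
      ⟨pr t z, by simpa using hz⟩
    refine ⟨fst w, w, ev_rfind_iff.2 ⟨zero_le, by simp [hd, hw], fun i _ hi => ⟨0, ?_⟩⟩, rfl⟩
    simp [hd, hmin i hi]

end UniformlyEnumerable

/-! ### A provably universal machine -/

section UniversalMachine

open Nat.Partrec (Code)

/-! ### Prefixes and self-delimiting tags. -/

section Strings

variable {M : Type} [PeanoModel M]

theorem Pfx.refl (s : M) : Pfx s s := ⟨0, 0, by simp, by simp⟩

/-- Appending `k` binary digits raises the exponent of the leading digit by `k`. -/
theorem pow2_le_append {a l k r : M} (hr : r < pow2 k) (ha : pow2 l ≤ a ∧ a < pow2 l + pow2 l) :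
    pow2 (l + k) ≤ a * pow2 k + r ∧ a * pow2 k + r < pow2 (l + k) + pow2 (l + k) := by
  rw [pow2_add]
  refine ⟨(mul_le_mul_left ha.1 _).trans le_self_add, ?_⟩
  have h := mul_le_mul_left (add_one_le_of_lt ha.2) (pow2 k)
  rw [add_mul, add_mul, one_mul] at h
  exact lt_of_lt_of_le (add_lt_add_right hr _) h

theorem Pfx.eq_of_len_eq {s s' : M} (h : Pfx s s') (hl : len s = len s') : s = s' := by
  obtain ⟨k, r, hr, h⟩ := h
  have := pow2_le_append hr (len_spec s)
  rw [← h, ← len_eq_iff, ← hl, add_eq_left] at this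
  subst this
  rw [pow2_zero, ← zero_add (1 : M), lt_add_one_iff'] at hr
  rw [pow2_zero, mul_one, le_antisymm hr zero_le, add_zero] at h
  exact (add_right_cancel h).symm

/-- The bounds on both quantifiers make the prefix relation decidable by one program. -/
theorem pfx_iff {s s' : M} : Pfx s s' ↔ ∃ k, k < s' + 1 ∧ ∃ r, r < s' + 1 ∧ r < pow2 k ∧
    s' + 1 = (s + 1) * pow2 k + r := by
  constructor
  · rintro ⟨k, r, hr, h⟩
    have hk : pow2 k ≤ s' + 1 := by
      rw [h, add_mul, one_mul]
      exact (le_add_of_nonneg_left zero_le).trans le_self_add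
    exact ⟨k, (lt_pow2 k).trans_le hk, r, hr.trans_le hk, hr, h⟩
  · rintro ⟨k, -, r, -, hr, h⟩
    exact ⟨k, r, hr, h⟩

theorem pow2_add_inj {a a' b b' z z' : M} (hb : b < a) (hb' : b' < a')
    (hz : pow2 b ≤ z ∧ z < pow2 b + pow2 b) (hz' : pow2 b' ≤ z' ∧ z' < pow2 b' + pow2 b')
    (h : pow2 a + z = pow2 a' + z') : a = a' ∧ b = b' ∧ z = z' := by
  have ha : a = a' := by
    refine log_unique (a := pow2 a + z) ⟨le_self_add, ?_⟩ (h ▸ ⟨le_self_add, ?_⟩)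
    · exact add_lt_add_right (hz.2.trans_le (pow2_strictMono hb)) _
    · exact add_lt_add_right (hz'.2.trans_le (pow2_strictMono hb')) _
  subst ha
  have := add_left_cancel h
  subst this
  exact ⟨rfl, log_unique hz hz', rfl⟩

/-- The string `0ᵉ1s`. -/
noncomputable def tag (e s : M) : M := pow2 (e + 1) * pow2 (len s) + s

/-- In the binary numeral 10ᵉ1s, removing the leading 1 leaves the numeral 1s, which is `s + 1`. -/
theorem tag_add_one (e s : M) : tag e s + 1 = pow2 (e + 1 + len s) + (s + 1) := by
  rw [tag, pow2_add (e + 1), add_assoc]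

theorem lt_succ_add (e l : M) : l < e + 1 + l :=
  lt_add_of_pos_left _ (add_pos_of_nonneg_of_pos zero_le zero_lt_one)

theorem len_tag (e s : M) : len (tag e s) = e + 1 + len s := by
  refine (len_eq_iff.2 ?_).symm
  rw [tag_add_one]
  exact ⟨le_self_add,
    add_lt_add_right ((len_spec s).2.trans_le (pow2_strictMono (lt_succ_add _ _))) _⟩

/-- The first two ones of the numeral determine e and the length of s (`pow2_add_inj`). Appending
digits changes neither e nor the initial part, so a prefix relation between tagged strings descends
to the untagged ones. -/
theorem Pfx.of_tag {e e' s s' : M} (h : Pfx (tag e s) (tag e' s')) : e = e' ∧ Pfx s s' := by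
  obtain ⟨k, r, hr, h⟩ := h
  rw [tag_add_one, tag_add_one, add_mul, ← pow2_add, add_assoc (e + 1),
    add_assoc (pow2 _)] at h
  obtain ⟨h₁, h₂, h₃⟩ := pow2_add_inj (lt_succ_add _ _) (lt_succ_add _ _) (len_spec s')
    (pow2_le_append hr (len_spec s)) h
  rw [h₂, add_left_inj, add_left_inj] at h₁
  exact ⟨h₁.symm, k, r, hr, h₃⟩

theorem tag_inj {e e' s s' : M} (h : tag e s = tag e' s') : e = e' ∧ s = s' := by
  have hp : Pfx (tag e s) (tag e' s') := by rw [h]; exact Pfx.refl _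
  obtain ⟨he, hs⟩ := hp.of_tag
  refine ⟨he, hs.eq_of_len_eq ?_⟩
  have := congrArg len h
  rwa [len_tag, len_tag, he, add_right_inj] at this

end Strings

instance UD.pfx {F G : ∀ (M : Type) [PeanoModel M], M → M} [UF F] [UF G] :
    UD fun M _ a => Pfx (F M a) (G M a) := by
  have : UD fun M _ a => Pfx (fst a) (snd a) := by
    simp only [pfx_iff]
    infer_instance
  simpa using this.comp (F := fun M _ a => pr (F M a) (G M a)) inferInstance

/-- The program is fixed before the model is, and the machine `e` that it simulates may be a
nonstandard number. By `provable_iff`, such a U is provably universal. -/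
theorem exists_provablyUniversal : ∃ U : Code, ∀ (M : Type) [PeanoModel M],
    Univ (U.encodeCode : M) := by
  obtain ⟨R, hR, -, hev⟩ :=
    (inferInstance : US fun M _ a => Ev (fst a) (fst (snd a)) (snd (snd a)))
  replace hev : ∀ (M : Type) [PeanoModel M] (e s t : M),
      Ev e s t ↔ ∃ k, R M (pr e (pr s t)) k := fun M _ e s t => by
    simpa using hev M (pr e (pr s t))
  replace hR : ∀ {F G : ∀ (M : Type) [PeanoModel M], M → M} [UF F] [UF G],
      UD fun M _ a => R M (F M a) (G M a) := fun {F G} _ _ => by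
    simpa using hR.comp (F := fun M _ a => pr (F M a) (G M a)) inferInstance
  -- A certified run is accepted unless a certified run with a smaller number has a different input
  -- that is comparable with `s`. The quantifier is bounded by the number of the run, so acceptance
  -- is decidable.
  let acc (M : Type) [PeanoModel M] (e s t k : M) : Prop := R M (pr e (pr s t)) k ∧
    ∀ w, w < pr s (pr t k) → ¬R M (pr e (pr (fst w) (fst (snd w)))) (snd (snd w)) ∨
      fst w = s ∨ ¬(Pfx (fst w) s ∨ Pfx s (fst w))
  have hacc : ∀ {F G H K : ∀ (M : Type) [PeanoModel M], M → M} [UF F] [UF G] [UF H] [UF K],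
      US fun M _ a => acc M (F M a) (G M a) (H M a) (K M a) := fun {F G H K} _ _ _ _ => by
    have : US fun M _ a => acc M (fst a) (fst (snd a)) (fst (snd (snd a))) (snd (snd (snd a))) :=
      US.of_ud (by unfold acc; infer_instance)
    simpa using this.comp (F := fun M _ a => pr (F M a) (pr (G M a) (pr (H M a) (K M a))))
      inferInstance
  -- The length of `s` enters through its defining inequalities, which are visibly decidable;
  -- afterwards the input is recognized as a tagged string.
  obtain ⟨U, hU⟩ := US.exists_code (P := fun M _ x t => ∃ e s l k,
    (pow2 l ≤ s + 1 ∧ s + 1 < pow2 l + pow2 l) ∧ x = pow2 (e + 1) * pow2 l + s ∧ acc M e s t k)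
    inferInstance
  refine ⟨U, fun M _ => ?_⟩
  replace hU : ∀ x : M, (∀ t, Ev (U.encodeCode : M) x t → ∃ e s k, x = tag e s ∧ acc M e s t k) ∧
      ∀ e s t k, x = tag e s → acc M e s t k → ∃ t', Ev (U.encodeCode : M) x t' := by
    refine fun x => ⟨fun t ht => ?_, fun e s t k hx h => ?_⟩
    · obtain ⟨e, s, l, k, hl, hx, h⟩ := (hU M x).1 t ht
      rw [← len_eq_iff] at hl
      exact ⟨e, s, k, by rw [hx, hl, tag], h⟩
    · exact (hU M x).2 t ⟨e, s, len s, k, len_spec s, hx, h⟩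
  have hlt : ∀ {e s t k s' t' k' : M}, acc M e s t k → acc M e s' t' k' →
      pr s (pr t k) < pr s' (pr t' k') → s = s' ∨ ¬(Pfx s s' ∨ Pfx s' s) := by
    intro e s t k s' t' k' h h' hw
    have := h'.2 _ hw
    simp only [fst_pr, snd_pr] at this
    exact this.resolve_left (not_not.2 h.1)
  constructor
  · intro x x' t t' hx hx' hp
    obtain ⟨e, s, k, rfl, h⟩ := (hU x).1 t hx
    obtain ⟨e', s', k', rfl, h'⟩ := (hU x').1 t' hx'
    obtain ⟨rfl, hs⟩ := hp.of_tag
    suffices s = s' by rw [this]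
    -- Of two accepted runs with comparable inputs, the one with the larger number would have been
    -- rejected unless the inputs agree.
    rcases lt_trichotomy (pr s (pr t k)) (pr s' (pr t' k')) with hw | hw | hw
    · exact (hlt h h' hw).resolve_right (not_not.2 (.inl hs))
    · exact (pr_inj hw).1
    · exact ((hlt h' h hw).resolve_right (not_not.2 (.inr hs))).symm
  · intro e he
    -- The overhead is the length of the tag 0ᵉ1.
    refine ⟨e + 1, fun s t hst => ⟨tag e s, ?_, by rw [len_tag, add_comm]⟩⟩
    obtain ⟨k, hk⟩ := (hev M e s t).1 hst
    -- For a prefix-free `e` no conflict ever arises, so every certified run is accepted.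
    have h : acc M e s t k := by
      refine ⟨hk, fun w _ => ?_⟩
      by_cases hw : R M (pr e (pr (fst w) (fst (snd w)))) (snd (snd w))
      · have hev' := (hev M _ _ _).2 ⟨_, hw⟩
        refine .inr (or_iff_not_imp_right.2 fun hp => ?_)
        rcases not_not.1 hp with hp | hp
        · exact he _ _ _ _ hev' hst hp
        · exact (he _ _ _ _ hst hev' hp).symm
      · exact .inl hw
    -- The selecting program may find another accepted run on the same input, but evaluation is
    -- single-valued, so its output is the same.
    obtain ⟨t', ht'⟩ := (hU (tag e s)).2 e s t k rfl h
    obtain ⟨e', s', k', hx, h'⟩ := (hU _).1 t' ht'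
    obtain ⟨rfl, rfl⟩ := tag_inj hx
    rwa [hst.unique ((hev M _ _ _).2 ⟨k', h'.1⟩)]

end UniversalMachine

/-! ### The meaning of the formulas in the standard model -/

section StandardModel

open Nat.Partrec (Code)

theorem pr_nat (a b : ℕ) : pr a b = Nat.pair a b := by
  have := cast_pair (M := ℕ) a b
  simpa only [Nat.cast_id] using this.symm

theorem mem_eval_rfind' {c : Code} {a m t : ℕ} : t ∈ (Code.rfind' c).eval (Nat.pair a m) ↔
    m ≤ t ∧ 0 ∈ c.eval (Nat.pair a t) ∧ ∀ i, m ≤ i → i < t → ∃ k, k + 1 ∈ c.eval (Nat.pair a i) := by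
  simp only [Code.eval, Nat.unpaired, Nat.unpair_pair, Part.mem_map_iff, Part.map_eq_map]
  constructor
  · rintro ⟨n, hn, rfl⟩
    obtain ⟨h0, h⟩ := Nat.mem_rfind.1 hn
    obtain ⟨z, hz, h0⟩ := (Part.mem_map_iff _).1 h0
    refine ⟨Nat.le_add_left m n, ?_, fun i hi hit => ?_⟩
    · rwa [of_decide_eq_true h0] at hz
    · obtain ⟨j, rfl⟩ := Nat.exists_eq_add_of_le' hi
      obtain ⟨k, hk, hk0⟩ := (Part.mem_map_iff _).1 (h (show j < n by omega))
      obtain ⟨k, rfl⟩ := Nat.exists_eq_succ_of_ne_zero (of_decide_eq_false hk0)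
      exact ⟨k, hk⟩
  · rintro ⟨hm, h0, h⟩
    obtain ⟨n, rfl⟩ := Nat.exists_eq_add_of_le' hm
    refine ⟨n, Nat.mem_rfind.2 ⟨(Part.mem_map_iff _).2 ⟨0, h0, by simp⟩, fun {j} hj => ?_⟩, rfl⟩
    obtain ⟨k, hk⟩ := h (j + m) (by omega) (by omega)
    exact (Part.mem_map_iff _).2 ⟨k + 1, hk, by simp⟩

/-- In ℕ, internal evaluation and `Nat.Partrec.Code.eval` satisfy the same recursion on programs. -/
theorem ev_iff_mem_eval (c : Code) (s t : ℕ) : Ev c.encodeCode s t ↔ t ∈ c.eval s := by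
  have hpair := fun c c' => cast_pairCode (M := ℕ) c c'
  have hcomp := fun c c' => cast_compCode (M := ℕ) c c'
  have hprec := fun c c' => cast_precCode (M := ℕ) c c'
  have hrfind := fun c => cast_rfindCode (M := ℕ) c
  simp only [Nat.cast_id] at hpair hcomp hprec hrfind
  have hfst : ∀ a : ℕ, fst a = a.unpair.1 := fun a => by
    conv_lhs => rw [← Nat.pair_unpair a, ← pr_nat, fst_pr]
  have hsnd : ∀ a : ℕ, snd a = a.unpair.2 := fun a => by
    conv_lhs => rw [← Nat.pair_unpair a, ← pr_nat, snd_pr]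
  induction c generalizing s t with
  | zero => exact (ev_code_zero (M := ℕ) s t).trans Part.mem_some_iff.symm
  | succ => simpa [Code.eval] using ev_code_succ (M := ℕ) s t
  | left => simpa [Code.eval, hfst] using ev_code_left (M := ℕ) s t
  | right => simpa [Code.eval, hsnd] using ev_code_right (M := ℕ) s t
  | pair c d hc hd =>
    rw [hpair, ev_pair]
    simp only [hc, hd, pr_nat, Code.eval, Seq.seq, Part.mem_bind_iff, Part.map_eq_map,
      Part.mem_map_iff]
    constructor
    · rintro ⟨u, v, hu, hv, rfl⟩
      exact ⟨_, ⟨u, hu, rfl⟩, v, hv, rfl⟩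
    · rintro ⟨_, ⟨u, hu, rfl⟩, v, hv, rfl⟩
      exact ⟨u, v, hu, hv, rfl⟩
  | comp c d hc hd =>
    rw [hcomp, ev_comp]
    simp only [hc, hd]
    exact Part.mem_bind_iff.symm
  | prec c d hc hd =>
    obtain ⟨a, n, rfl⟩ : ∃ a n, s = Nat.pair a n := ⟨_, _, (Nat.pair_unpair s).symm⟩
    induction n generalizing t with
    | zero =>
      have h := ev_prec_zero (f := c.encodeCode) (g := d.encodeCode) (a := a) (t := t)
      rw [pr_nat a 0, ← hprec] at h
      rw [Code.eval_prec_zero]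
      exact h.trans (hc a t)
    | succ n ih =>
      rw [Code.eval_prec_succ, hprec, ← pr_nat, ev_prec_succ]
      rw [← hprec]
      simp only [pr_nat, ih, hd, Part.mem_bind_iff, Part.bind_eq_bind]
  | rfind' c hc =>
    obtain ⟨a, n, rfl⟩ : ∃ a n, s = Nat.pair a n := ⟨_, _, (Nat.pair_unpair s).symm⟩
    rw [mem_eval_rfind', hrfind, ← pr_nat, ev_rfind_iff]
    simp only [pr_nat, hc]

theorem pow2_nat (n : ℕ) : pow2 n = 2 ^ n := by
  induction n with
  | zero => exact pow2_zero
  | succ n ih => rw [pow2_succ, ih]; omega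

theorem strNum_append_singleton (s : List Bool) (b : Bool) :
    strNum (s ++ [b]) = 2 * strNum s + 1 + b.toNat := by
  simp [strNum]

/-- The numeral 1u is `2 ^ u.length` plus the digits of `u`; this power is moved to the left side to
avoid subtraction. -/
theorem strNum_append (s u : List Bool) :
    strNum (s ++ u) + 2 ^ u.length = (strNum s + 1) * 2 ^ u.length + strNum u := by
  induction u using List.reverseRecOn with
  | nil => simp [strNum]
  | append_singleton u b ih =>
    rw [← List.append_assoc, strNum_append_singleton, strNum_append_singleton, List.length_append,
      List.length_singleton, pow_succ]
    linarith

theorem strNum_bounds (s : List Bool) :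
    2 ^ s.length ≤ strNum s + 1 ∧ strNum s + 1 < 2 ^ s.length + 2 ^ s.length := by
  induction s using List.reverseRecOn with
  | nil => simp [strNum]
  | append_singleton u b ih =>
    rw [strNum_append_singleton, List.length_append, List.length_singleton, pow_succ]
    have := b.toNat_le
    omega

theorem len_strNum (s : List Bool) : len (strNum s) = s.length :=
  (len_eq_iff.2 (by rw [pow2_nat]; exact strNum_bounds s)).symm

theorem strNum_surjective : Function.Surjective strNum := by
  intro n
  induction n using Nat.strong_induction_on with
  | _ n ih =>
    rcases n with - | n
    · exact ⟨[], rfl⟩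
    · obtain ⟨s, hs⟩ := ih (n / 2) (by omega)
      refine ⟨s ++ [decide (n % 2 = 1)], ?_⟩
      rw [strNum_append_singleton, hs]
      rcases Nat.mod_two_eq_zero_or_one n with h | h <;> simp [h] <;> omega

theorem strNum_injective : Function.Injective strNum := by
  intro s
  induction s using List.reverseRecOn with
  | nil =>
    intro s' h
    have := congrArg len h
    rw [len_strNum, len_strNum] at this
    exact (List.eq_nil_of_length_eq_zero this.symm).symm
  | append_singleton u b ih =>
    intro s' h
    induction s' using List.reverseRecOn with
    | nil => simp [strNum] at h
    | append_singleton u' b' _ =>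
      rw [strNum_append_singleton, strNum_append_singleton] at h
      have hb := b.toNat_le
      have hb' := b'.toNat_le
      have hbb : b = b' := by cases b <;> cases b' <;> simp at h ⊢ <;> omega
      rw [ih (a₂ := u') (by omega), hbb]

theorem pfx_strNum {s s' : List Bool} : Pfx (strNum s) (strNum s') ↔ s <+: s' := by
  constructor
  · rintro ⟨k, r, hr, h⟩
    rw [pow2_nat] at hr h
    -- The string whose digits are `r`, padded with zeros to length `k`: its numeral with a leading
    -- 1 is 2ᵏ + r.
    obtain ⟨u, hu⟩ := strNum_surjective (2 ^ k + r - 1)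
    have hk : u.length = k := by
      rw [← len_strNum, hu, eq_comm, len_eq_iff, pow2_nat]
      have := Nat.one_le_two_pow (n := k)
      omega
    refine ⟨u, strNum_injective ?_⟩
    have := strNum_append s u
    rw [hk, hu] at this
    have := Nat.one_le_two_pow (n := k)
    omega
  · rintro ⟨u, rfl⟩
    have h := strNum_append s u
    have hb := strNum_bounds u
    refine ⟨u.length, strNum u + 1 - 2 ^ u.length, ?_, ?_⟩ <;> rw [pow2_nat] <;> omega

theorem computes_iff {c : Code} {s t : List Bool} :
    Computes c s t ↔ Ev c.encodeCode (strNum s) (strNum t) := (ev_iff_mem_eval _ _ _).symm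

theorem prefixFree_nat (c : Code) : PrefixFree c.encodeCode ↔ IsPrefixFree c := by
  simp only [PrefixFree, IsPrefixFree, strNum_surjective.forall, computes_iff, pfx_strNum,
    strNum_injective.eq_iff]

/-- Every natural number is the number of a program, so the internal quantifier over machines is the
external one. -/
theorem encodeCode_surjective : Function.Surjective Code.encodeCode := fun n =>
  ⟨Denumerable.ofNat Code n, by rw [← Code.encodeCode_eq, Denumerable.encode_ofNat]⟩

theorem univ_nat (c : Code) : Univ c.encodeCode ↔ IsUniversal c := by
  rw [Univ, IsUniversal, prefixFree_nat, encodeCode_surjective.forall]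
  refine and_congr_right fun _ => forall_congr' fun V => ?_
  rw [prefixFree_nat]
  refine imp_congr_right fun _ => exists_congr fun k => ?_
  simp only [strNum_surjective.forall, computes_iff, len_strNum]
  refine forall_congr' fun s => forall_congr' fun t => imp_congr_right fun _ => ?_
  simp only [strNum_surjective.exists, len_strNum]

end StandardModel

/-! ### Inductively generated sets -/

section Generated

/-- The sequence of length `l` with the code `(a, b)` is a derivation, in which every entry is an
axiom or follows by the rule `R` from two later entries. -/
def IsDerivation {M : Type} [PeanoModel M] (A : M → Prop) (R : M → M → M → Prop) (a b l : M) :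
    Prop :=
  ∀ i, i < l → ∃ c, Bt a b i c ∧ (A c ∨ ∃ j k p q, (i < j ∧ j < l) ∧ (i < k ∧ k < l) ∧
    Bt a b j p ∧ Bt a b k q ∧ R p q c)

/-- The set generated from the axioms `A` by the rule `R`. -/
def Gen {M : Type} [PeanoModel M] (A : M → Prop) (R : M → M → M → Prop) (x : M) : Prop :=
  ∃ a b l, IsDerivation A R a b l ∧ 0 < l ∧ Bt a b 0 x

set_option synthInstance.maxHeartbeats 1000000 in
set_option synthInstance.maxSize 100000 in
theorem US.gen {A : ∀ (M : Type) [PeanoModel M], M → Prop}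
    {R : ∀ (M : Type) [PeanoModel M], M → M → M → Prop} (hA : US A)
    (hR : US fun M _ a => R M (fst a) (fst (snd a)) (snd (snd a)))
    {F : ∀ (M : Type) [PeanoModel M], M → M} [hF : UF F] :
    US fun M _ a => Gen (A M) (R M) (F M a) := by
  have hA' : ∀ {F : ∀ (M : Type) [PeanoModel M], M → M} [UF F], US fun M _ a => A M (F M a) :=
    hA.comp inferInstance
  have hR' : ∀ {F G H : ∀ (M : Type) [PeanoModel M], M → M} [UF F] [UF G] [UF H],
      US fun M _ a => R M (F M a) (G M a) (H M a) := fun {F G H} _ _ _ => by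
    simpa using hR.comp (F := fun M _ a => pr (F M a) (pr (G M a) (H M a))) inferInstance
  have : US fun M _ a => Gen (A M) (R M) a := by
    unfold Gen IsDerivation
    infer_instance
  exact this.comp hF

variable {A : ℕ → Prop} {R : ℕ → ℕ → ℕ → Prop}

/-- Premises occur later in the sequence, so the induction runs on the distance from the end. It is
external, which suffices in ℕ and imposes no definability condition on `Q`. -/
theorem Gen.rec {Q : ℕ → Prop} (hA : ∀ c, A c → Q c) (hR : ∀ p q c, R p q c → Q p → Q q → Q c)
    {x : ℕ} (h : Gen A R x) : Q x := by
  obtain ⟨a, b, l, hd, hl, hx⟩ := h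
  suffices ∀ n i, i < l → l - i ≤ n → ∀ c, Bt a b i c → Q c from this l 0 hl (by omega) x hx
  intro n
  induction n with
  | zero => intro i hi hn; omega
  | succ n ih =>
    intro i hi hn c hc
    obtain ⟨c', hc', h⟩ := hd i hi
    obtain rfl := hc.unique hc'
    obtain h | ⟨j, k, p, q, hj, hk, hp, hq, h⟩ := h
    · exact hA c h
    · exact hR p q c h (ih j hj.2 (by omega) p hp) (ih k hk.2 (by omega) q hq)

/-- Every entry of the list is an axiom or follows by the rule from two later entries. -/
inductive ListDerivation (A : ℕ → Prop) (R : ℕ → ℕ → ℕ → Prop) : List ℕ → Prop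
  | nil : ListDerivation A R []
  | ax {c : ℕ} {l : List ℕ} : A c → ListDerivation A R l → ListDerivation A R (c :: l)
  | rule {p q c : ℕ} {l : List ℕ} : R p q c → p ∈ l → q ∈ l → ListDerivation A R l →
      ListDerivation A R (c :: l)

theorem ListDerivation.append {l l' : List ℕ} (h : ListDerivation A R l)
    (h' : ListDerivation A R l') : ListDerivation A R (l ++ l') := by
  induction h with
  | nil => exact h'
  | ax hc _ ih => exact .ax hc ih
  | rule hc hp hq _ ih =>
    exact .rule hc (List.mem_append_left _ hp) (List.mem_append_left _ hq) ih

theorem ListDerivation.entry {l : List ℕ} (h : ListDerivation A R l) (i : ℕ) (c : ℕ)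
    (hi : l[i]? = some c) : A c ∨ ∃ j k p q, i < j ∧ i < k ∧ l[j]? = some p ∧ l[k]? = some q ∧
      R p q c := by
  induction h generalizing i with
  | nil => simp at hi
  | @ax d l hd _ ih =>
    rcases i with - | i
    · simp only [List.getElem?_cons_zero, Option.some.injEq] at hi
      exact .inl (hi ▸ hd)
    · obtain h | ⟨j, k, p, q, hj, hk, h⟩ := ih i (by simpa using hi)
      · exact .inl h
      · exact .inr ⟨j + 1, k + 1, p, q, by omega, by omega, by simpa using h⟩
  | @rule p q d l hd hp hq _ ih =>
    rcases i with - | i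
    · simp only [List.getElem?_cons_zero, Option.some.injEq] at hi
      obtain ⟨j, hj⟩ := List.mem_iff_getElem?.1 hp
      obtain ⟨k, hk⟩ := List.mem_iff_getElem?.1 hq
      exact .inr ⟨j + 1, k + 1, p, q, by omega, by omega, by simpa using hj, by simpa using hk,
        hi ▸ hd⟩
    · obtain h | ⟨j, k, p, q, hj, hk, h⟩ := ih i (by simpa using hi)
      · exact .inl h
      · exact .inr ⟨j + 1, k + 1, p, q, by omega, by omega, by simpa using h⟩

theorem bt_nat {a b i c : ℕ} : Bt a b i c ↔ c = a % ((i + 1) * b + 1) := by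
  have h : ∃ q, a = q * (1 + (i + 1) * b) + a % ((i + 1) * b + 1) ∧
      a % ((i + 1) * b + 1) < 1 + (i + 1) * b := by
    refine ⟨a / ((i + 1) * b + 1), ?_, ?_⟩
    · rw [add_comm 1, mul_comm]
      exact (Nat.div_add_mod _ _).symm
    · rw [add_comm 1]
      exact Nat.mod_lt _ (Nat.succ_pos _)
  exact ⟨fun hc => hc.unique h, fun hc => hc ▸ h⟩

theorem bt_unbeta (l : List ℕ) {i c : ℕ} (h : l[i]? = some c) :
    Bt (Nat.unbeta l).unpair.1 (Nat.unbeta l).unpair.2 i c := by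
  obtain ⟨hi, rfl⟩ := List.getElem?_eq_some_iff.1 h
  rw [bt_nat]
  exact (Nat.beta_unbeta_coe l ⟨i, hi⟩).symm

/-- A list of formulas is coded by `Nat.unbeta`; conversely, derivations of two premises are
concatenated. This makes `Gen.ax` and `Gen.rule` immediate. -/
theorem gen_iff {x : ℕ} : Gen A R x ↔ ∃ l, ListDerivation A R (x :: l) := by
  constructor
  · refine Gen.rec (Q := fun x => ∃ l, ListDerivation A R (x :: l))
      (fun c hc => ⟨[], .ax hc .nil⟩) fun p q c hc hp hq => ?_
    obtain ⟨l, hl⟩ := hp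
    obtain ⟨l', hl'⟩ := hq
    exact ⟨_, .rule hc (by simp) (by simp) (hl.append hl')⟩
  · rintro ⟨l, hl⟩
    refine ⟨_, _, l.length + 1, fun i hi => ?_, by omega, bt_unbeta (x :: l) (i := 0) (by simp)⟩
    obtain ⟨c, hc⟩ : ∃ c, (x :: l)[i]? = some c :=
      ⟨_, List.getElem?_eq_getElem (l := x :: l) (i := i) (by simpa using hi)⟩
    refine ⟨c, bt_unbeta _ hc, ?_⟩
    obtain h | ⟨j, k, p, q, hj, hk, hp, hq, h⟩ := hl.entry i c hc
    · exact .inl h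
    · have hj' := (List.getElem?_eq_some_iff.1 hp).1
      have hk' := (List.getElem?_eq_some_iff.1 hq).1
      simp only [List.length_cons] at hj' hk'
      exact .inr ⟨j, k, p, q, ⟨hj, hj'⟩, ⟨hk, hk'⟩, bt_unbeta _ hp, bt_unbeta _ hq, h⟩

theorem Gen.ax {c : ℕ} (h : A c) : Gen A R c := gen_iff.2 ⟨[], .ax h .nil⟩

theorem Gen.rule {p q c : ℕ} (h : R p q c) (hp : Gen A R p) (hq : Gen A R q) : Gen A R c := by
  obtain ⟨l, hl⟩ := gen_iff.1 hp
  obtain ⟨l', hl'⟩ := gen_iff.1 hq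
  exact gen_iff.2 ⟨_, .rule h (by simp) (by simp) (hl.append hl')⟩

end Generated

/-! ### The calculus on numbers of formulas

Terms and formulas are numbered by pairs of a tag and the numbers of the parts: `0` and `1` have
the tags `0` and `1`, the free and the bound variables `2` and `3`, sums and products `4` and `5`,
falsity, equations, inequalities, implications and quantifiers `6` to `10`. Contexts of sequents are
nested conjunctions, with the tag `11`. -/

section NumberedCalculus

section Rules

variable {M : Type} [PeanoModel M]

abbrev nImp (a b : M) : M := pr 9 (pr a b)

abbrev nCons (a b : M) : M := pr 11 (pr a b)

/-- The substitutions of numbered terms for variables and constants. The modes of substitution are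
`(0, t)` for the instantiation of the outermost bound variable by `t`, `(1, 0)` for the shift of the
free variables, and `(2, 0)` for the successor on the outermost bound variable. -/
def SubAx (c : M) : Prop :=
  (∃ m x, c = pr m (pr x x) ∧ (x = pr 0 0 ∨ x = pr 1 0 ∨ x = pr 6 0)) ∨
  (∃ t i, c = pr (pr 0 t) (pr (pr 2 i) (pr 2 i))) ∨
  (∃ t, c = pr (pr 0 t) (pr (pr 3 0) t) ∧ fst t < 6) ∨
  (∃ t j, c = pr (pr 0 t) (pr (pr 3 (j + 1)) (pr 3 j))) ∨
  (∃ i, c = pr (pr 1 0) (pr (pr 2 i) (pr 2 (i + 1)))) ∨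
  (∃ j, c = pr (pr 1 0) (pr (pr 3 j) (pr 3 j))) ∨
  (∃ i, c = pr (pr 2 0) (pr (pr 2 i) (pr 2 i))) ∨
  c = pr (pr 2 0) (pr (pr 3 0) (pr 4 (pr (pr 3 0) (pr 1 0)))) ∨
  ∃ j, c = pr (pr 2 0) (pr (pr 3 (j + 1)) (pr 3 (j + 1)))

/-- Substitution in compound terms and formulas. -/
def SubRule (p q c : M) : Prop :=
  (∃ m τ a a' b b', (τ = 4 ∨ τ = 5 ∨ τ = 7 ∨ τ = 8 ∨ τ = 9 ∨ τ = 11) ∧ p = pr m (pr a a') ∧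
    q = pr m (pr b b') ∧ c = pr m (pr (pr τ (pr a b)) (pr τ (pr a' b')))) ∨
  ∃ m a a', p = pr m (pr a a') ∧ c = pr m (pr (pr 10 a) (pr 10 a'))

/-- The substitution of mode `m` turns the numbered term or formula `a` into `b`. -/
def NSub (m a b : M) : Prop := Gen SubAx SubRule (pr m (pr a b))

/-- No bound variable occurs in the numbered term `t`. -/
def NTerm (t : M) : Prop := NSub (pr 0 (pr 0 0)) t t

/-- The sequents with no premises, where the numbers in the list `l` are taken as axioms. -/
def SeqAx (l : List ℕ) (c : M) : Prop :=
  (∃ Γ a, c = pr Γ a ∧ ∃ n ∈ l, a = n) ∨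
  (∃ Γ a b d, c = pr Γ (nImp b (nImp (pr 10 (nImp a d)) (pr 10 a))) ∧
    NSub (pr 0 (pr 0 0)) a b ∧ NSub (pr 2 0) a d) ∨
  (∃ Γ a, c = pr (nCons a Γ) a) ∨
  ∃ Γ t, c = pr Γ (pr 7 (pr t t))

/-- The rules of inference for sequents. -/
def SeqRule (p q c : M) : Prop :=
  (∃ Γ a b, p = pr Γ a ∧ c = pr (nCons b Γ) a) ∨
  (∃ Γ a b, p = pr (nCons a Γ) b ∧ c = pr Γ (nImp a b)) ∨
  (∃ Γ a b, p = pr Γ (nImp a b) ∧ q = pr Γ a ∧ c = pr Γ b) ∨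
  (∃ Γ a, p = pr (nCons (nImp a (pr 6 0)) Γ) (pr 6 0) ∧ c = pr Γ a) ∨
  (∃ Γ Γ' a b d, p = pr Γ' d ∧ NSub (pr 1 0) Γ Γ' ∧ NSub (pr 1 0) a b ∧
    NSub (pr 0 (pr 2 0)) b d ∧ c = pr Γ (pr 10 a)) ∨
  (∃ Γ a b t, p = pr Γ (pr 10 a) ∧ NTerm t ∧ NSub (pr 0 t) a b ∧ c = pr Γ b) ∨
  ∃ Γ a b d s t, p = pr Γ (pr 7 (pr s t)) ∧ q = pr Γ b ∧ NTerm s ∧ NTerm t ∧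
    NSub (pr 0 s) a b ∧ NSub (pr 0 t) a d ∧ c = pr Γ d

/-- The sequent `Γ ⊢ a` is derivable from the axioms in the list `l`. -/
def NDer (l : List ℕ) (Γ a : M) : Prop := Gen (SeqAx l) SeqRule (pr Γ a)

end Rules

set_option synthInstance.maxHeartbeats 1000000 in
set_option synthInstance.maxSize 100000 in
instance US.nSub {F G H : ∀ (M : Type) [PeanoModel M], M → M} [UF F] [UF G] [UF H] :
    US fun M _ a => NSub (F M a) (G M a) (H M a) := by
  refine US.gen (A := fun M _ => SubAx) (R := fun M _ => SubRule) ?_ ?_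
  · unfold SubAx
    infer_instance
  · unfold SubRule
    infer_instance

instance US.nTerm {F : ∀ (M : Type) [PeanoModel M], M → M} [UF F] :
    US fun M _ a => NTerm (F M a) := by
  unfold NTerm
  infer_instance

theorem US.mem (l : List ℕ) {F : ∀ (M : Type) [PeanoModel M], M → M} [UF F] :
    US fun M _ a => ∃ n ∈ l, F M a = (n : M) := by
  induction l with
  | nil => exact US.congr (P := fun M _ _ => (0 : M) < 0) inferInstance (by simp)
  | cons n l ih =>
    have := UF.natCast n
    exact US.congr (P := fun M _ a => F M a = (n : M) ∨ ∃ n ∈ l, F M a = (n : M)) inferInstance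
      (by simp)

set_option synthInstance.maxHeartbeats 1000000 in
set_option synthInstance.maxSize 100000 in
instance US.nDer (l : List ℕ) {F G : ∀ (M : Type) [PeanoModel M], M → M} [UF F] [UF G] :
    US fun M _ a => NDer l (F M a) (G M a) := by
  have := @US.mem l
  refine US.gen (A := fun M _ => SeqAx l) (R := fun M _ => SeqRule) ?_ ?_
  · unfold SeqAx
    infer_instance
  · unfold SeqRule
    infer_instance

end NumberedCalculus

/-! ### Soundness of the calculus on numbers -/

section NumberedSemantics

theorem fst_le (a : ℕ) : fst a ≤ a := by
  conv_rhs => rw [← pr_fst_snd a, pr_nat]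
  exact Nat.left_le_pair _ _

theorem snd_le (a : ℕ) : snd a ≤ a := by
  conv_rhs => rw [← pr_fst_snd a, pr_nat]
  exact Nat.right_le_pair _ _

theorem snd_lt {a : ℕ} (h : fst a ≠ 0) : snd a < a := by
  have := Nat.add_le_pair (fst a) (snd a)
  rw [← pr_nat, pr_fst_snd] at this
  omega

open Classical in
/-- The value of a numbered term, where `v` gives the values of the free variables and `r` those of
the bound ones. -/
noncomputable def tval (v r : ℕ → ℕ) (a : ℕ) : ℕ :=
  if _ : fst a = 1 then 1
  else if _ : fst a = 2 then v (snd a)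
  else if _ : fst a = 3 then r (snd a)
  else if _ : fst a = 4 then tval v r (fst (snd a)) + tval v r (snd (snd a))
  else if _ : fst a = 5 then tval v r (fst (snd a)) * tval v r (snd (snd a))
  else 0
termination_by a
decreasing_by all_goals first
  | exact (fst_le _).trans_lt (snd_lt (by omega))
  | exact (snd_le _).trans_lt (snd_lt (by omega))

open Classical in
/-- The truth of a numbered formula below `k` quantifiers. Numbers that are not those of formulas
count as true. -/
noncomputable def Holds (v r : ℕ → ℕ) (k : ℕ) (a : ℕ) : Prop :=
  if _ : fst a = 6 then False
  else if _ : fst a = 7 then tval v r (fst (snd a)) = tval v r (snd (snd a))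
  else if _ : fst a = 8 then tval v r (fst (snd a)) < tval v r (snd (snd a))
  else if _ : fst a = 9 then Holds v r k (fst (snd a)) → Holds v r k (snd (snd a))
  else if _ : fst a = 10 then ∀ b, Holds v (Function.update r k b) (k + 1) (snd a)
  else if _ : fst a = 11 then Holds v r k (fst (snd a)) ∧ Holds v r k (snd (snd a))
  else True
termination_by a
decreasing_by all_goals first
  | exact (fst_le _).trans_lt (snd_lt (by omega))
  | exact (snd_le _).trans_lt (snd_lt (by omega))
  | exact snd_lt (by omega)

section Equations

variable (v r : ℕ → ℕ) (k a b : ℕ)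

@[simp] theorem tval_zero : tval v r (pr 0 a) = 0 := by rw [tval]; simp
@[simp] theorem tval_one : tval v r (pr 1 a) = 1 := by rw [tval]; simp
@[simp] theorem tval_free : tval v r (pr 2 a) = v a := by rw [tval]; simp
@[simp] theorem tval_bound : tval v r (pr 3 a) = r a := by rw [tval]; simp
@[simp] theorem tval_add : tval v r (pr 4 (pr a b)) = tval v r a + tval v r b := by
  rw [tval]; simp
@[simp] theorem tval_mul : tval v r (pr 5 (pr a b)) = tval v r a * tval v r b := by
  rw [tval]; simp
theorem tval_of_lt (h : 5 < fst a) : tval v r a = 0 := by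
  rw [tval]; simp [show fst a ≠ 1 by omega, show fst a ≠ 2 by omega, show fst a ≠ 3 by omega,
    show fst a ≠ 4 by omega, show fst a ≠ 5 by omega]

@[simp] theorem holds_falsum : ¬Holds v r k (pr 6 a) := by rw [Holds]; simp
@[simp] theorem holds_equal : Holds v r k (pr 7 (pr a b)) ↔ tval v r a = tval v r b := by
  rw [Holds]; simp
@[simp] theorem holds_less : Holds v r k (pr 8 (pr a b)) ↔ tval v r a < tval v r b := by
  rw [Holds]; simp
@[simp] theorem holds_imp : Holds v r k (pr 9 (pr a b)) ↔ (Holds v r k a → Holds v r k b) := by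
  rw [Holds]; simp
@[simp] theorem holds_all :
    Holds v r k (pr 10 a) ↔ ∀ b, Holds v (Function.update r k b) (k + 1) a := by
  rw [Holds]; simp
@[simp] theorem holds_cons : Holds v r k (pr 11 (pr a b)) ↔ Holds v r k a ∧ Holds v r k b := by
  rw [Holds]; simp
theorem holds_of_lt (h : fst a < 6) : Holds v r k a := by
  rw [Holds]; simp [show fst a ≠ 6 by omega, show fst a ≠ 7 by omega, show fst a ≠ 8 by omega,
    show fst a ≠ 9 by omega, show fst a ≠ 10 by omega, show fst a ≠ 11 by omega]

end Equations

/-- Substitutions whose effect on variables is a change `V`, `P` of the assignments have this effect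
on all terms and formulas. -/
theorem NSub.sound {m : ℕ} {V : (ℕ → ℕ) → ℕ → ℕ} {P : (ℕ → ℕ) → (ℕ → ℕ) → ℕ → ℕ} {d n : ℕ}
    (hP : ∀ v r k b, n ≤ k → P v (Function.update r k b) = Function.update (P v r) (k + d) b)
    (hvar : ∀ a b, SubAx (pr m (pr a b)) → ∀ v r, tval v r b = tval (V v) (P v r) a) {a b : ℕ}
    (h : NSub m a b) : (∀ v r, tval v r b = tval (V v) (P v r) a) ∧
      ∀ v r k, n ≤ k → (Holds v r k b ↔ Holds (V v) (P v r) (k + d) a) := by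
  -- The number `d` counts the bound variables that the substitution removes, and `n` is the
  -- quantifier depth from which the change of assignment leaves newly bound variables alone.
  refine Gen.rec (Q := fun c => ∀ a b, c = pr m (pr a b) →
    (∀ v r, tval v r b = tval (V v) (P v r) a) ∧
      ∀ v r k, n ≤ k → (Holds v r k b ↔ Holds (V v) (P v r) (k + d) a)) ?_ ?_ h a b rfl
  · rintro c hc a b rfl
    refine ⟨hvar a b hc, ?_⟩
    -- Apart from falsity, the base cases relate terms, which count as true formulas, so the
    -- equivalence is trivial for them.
    have : (fst a < 6 ∧ fst b < 6) ∨ (a = pr 6 0 ∧ b = pr 6 0) := by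
      simp only [SubAx, pr_inj_iff] at hc
      rcases hc with ⟨m, x, ⟨rfl, rfl, rfl⟩, rfl | rfl | rfl⟩ | ⟨t, i, -, rfl, rfl⟩ |
        ⟨t, ⟨-, rfl, rfl⟩, ht⟩ | ⟨t, j, -, rfl, rfl⟩ | ⟨i, -, rfl, rfl⟩ | ⟨j, -, rfl, rfl⟩ |
        ⟨i, -, rfl, rfl⟩ | ⟨-, rfl, rfl⟩ | ⟨j, -, rfl, rfl⟩ <;> simp
      exact .inl ht
    rcases this with ⟨ha, hb⟩ | ⟨rfl, rfl⟩
    · simp [holds_of_lt, ha, hb]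
    · simp
  · rintro p q c (⟨m', τ, a, a', b, b', hτ, rfl, rfl, rfl⟩ | ⟨m', a, a', rfl, rfl⟩) hp hq x y hxy
    · rw [pr_inj_iff, pr_inj_iff] at hxy
      obtain ⟨rfl, rfl, rfl⟩ := hxy
      obtain ⟨h₁, h₂⟩ := hp _ _ rfl
      obtain ⟨h₃, h₄⟩ := hq _ _ rfl
      refine ⟨fun v r => ?_, fun v r k hk => ?_⟩
      · rcases hτ with rfl | rfl | rfl | rfl | rfl | rfl
        · simp [h₁, h₃]
        · simp [h₁, h₃]
        all_goals rw [tval_of_lt _ _ _ (by simp), tval_of_lt _ _ _ (by simp)]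
      · have := h₂ v r k hk
        have := h₄ v r k hk
        rcases hτ with rfl | rfl | rfl | rfl | rfl | rfl
        · simp [holds_of_lt]
        · simp [holds_of_lt]
        all_goals simp_all
    · rw [pr_inj_iff, pr_inj_iff] at hxy
      obtain ⟨rfl, rfl, rfl⟩ := hxy
      obtain ⟨h₁, h₂⟩ := hp _ _ rfl
      refine ⟨fun v r => ?_, fun v r k hk => ?_⟩
      · rw [tval_of_lt _ _ _ (by simp), tval_of_lt _ _ _ (by simp)]
      · simp only [holds_all]
        refine forall_congr' fun b => ?_
        rw [h₂ _ _ _ (hk.trans (Nat.le_succ k)), hP _ _ _ _ hk, Nat.add_right_comm]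

/-- A bound variable could not survive the instantiation unchanged: the outermost one would become
the constant 0, and any other would be renumbered. Numbers with tags of formulas have the value 0
anyway. -/
theorem NTerm.tval_eq {t : ℕ} (h : NTerm t) (v r r' : ℕ → ℕ) : tval v r t = tval v r' t := by
  refine Gen.rec (Q := fun c => ∀ a, c = pr (pr 0 (pr 0 0)) (pr a a) → tval v r a = tval v r' a)
    ?_ ?_ h t rfl
  · rintro c hc a rfl
    simp only [SubAx, pr_inj_iff] at hc
    rcases hc with ⟨m, x, ⟨-, rfl, -⟩, rfl | rfl | rfl⟩ | ⟨t, i, -, rfl, -⟩ |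
        ⟨t, ⟨⟨-, rfl⟩, rfl, h⟩, ht⟩ | ⟨t, j, -, rfl, h⟩ | ⟨i, h, -⟩ | ⟨j, h, -⟩ |
        ⟨i, h, -⟩ | ⟨h, -⟩ | ⟨j, h, -⟩
    all_goals simp_all [pr_inj_iff, tval_of_lt]
  · rintro p q c (⟨m', τ, a, a', b, b', hτ, rfl, rfl, rfl⟩ | ⟨m', a, a', rfl, rfl⟩) hp hq x hx
    · simp only [pr_inj_iff] at hx
      obtain ⟨rfl, rfl, hx⟩ := hx
      simp only [pr_inj_iff] at hx
      obtain ⟨-, rfl, rfl⟩ := hx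
      have h₁ := hp _ rfl
      have h₂ := hq _ rfl
      rcases hτ with rfl | rfl | rfl | rfl | rfl | rfl <;> simp_all [tval_of_lt]
    · simp only [pr_inj_iff] at hx
      obtain ⟨-, rfl, -⟩ := hx
      simp [tval_of_lt]

theorem NSub.shift_sound {a b : ℕ} (h : NSub (pr 1 0) a b) (v r : ℕ → ℕ) (k : ℕ) :
    Holds v r k b ↔ Holds (fun i => v (i + 1)) r k a := by
  refine (NSub.sound (V := fun v i => v (i + 1)) (P := fun _ r => r) (d := 0) (n := 0)
    (fun _ _ _ _ _ => rfl) (fun a b hc v r => ?_) h).2 v r k (Nat.zero_le k)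
  simp only [SubAx, pr_inj_iff] at hc
  rcases hc with ⟨m, x, ⟨-, rfl, rfl⟩, rfl | rfl | rfl⟩ | ⟨t, i, h, -⟩ |
        ⟨t, ⟨h, -⟩, ht⟩ | ⟨t, j, h, -⟩ | ⟨i, -, rfl, rfl⟩ | ⟨j, -, rfl, rfl⟩ |
        ⟨i, h, -⟩ | ⟨h, -⟩ | ⟨j, h, -⟩
  all_goals simp_all [tval_of_lt]

theorem NSub.inst_sound {t a b : ℕ} (ht : ∀ v r r', tval v r t = tval v r' t)
    (h : NSub (pr 0 t) a b) (v : ℕ → ℕ) :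
    Holds v 0 0 b ↔ Holds v (Function.update 0 0 (tval v 0 t)) 1 a := by
  -- The value of `t` is inserted in front of the values of the bound variables.
  let P (v r : ℕ → ℕ) : ℕ → ℕ
    | 0 => tval v r t
    | i + 1 => r i
  have h := (NSub.sound (V := id) (P := P) (d := 1) (n := 0)
    (fun v r k b _ => ?_) (fun a b hc v r => ?_) h).2 v 0 0 le_rfl
  · rwa [show P v 0 = (Function.update 0 0 (tval v 0 t) : ℕ → ℕ) from ?_] at h
    funext i
    rcases i with - | i <;> simp [P]
  · funext i
    rcases i with - | i
    · simp [P, ht v _ r]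
    · simp [P, Function.update_apply]
  · simp only [SubAx, pr_inj_iff] at hc
    rcases hc with ⟨m, x, ⟨-, rfl, rfl⟩, rfl | rfl | rfl⟩ | ⟨t, i, -, rfl, rfl⟩ |
        ⟨t, ⟨⟨-, rfl⟩, rfl, rfl⟩, -⟩ | ⟨t, j, -, rfl, rfl⟩ | ⟨i, h, -⟩ | ⟨j, h, -⟩ |
        ⟨i, h, -⟩ | ⟨h, -⟩ | ⟨j, h, -⟩
    all_goals simp_all [tval_of_lt, P]

theorem NSub.succ_sound {a b : ℕ} (h : NSub (pr 2 0) a b) (v r : ℕ → ℕ) (k : ℕ) :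
    Holds v r (k + 1) b ↔ Holds v (Function.update r 0 (r 0 + 1)) (k + 1) a := by
  refine (NSub.sound (V := id) (P := fun _ r => Function.update r 0 (r 0 + 1)) (d := 0) (n := 1)
    (fun v r k b hk => ?_) (fun a b hc v r => ?_) h).2 v r (k + 1) (Nat.succ_le_succ (Nat.zero_le k))
  · rw [Function.update_comm (by omega), Function.update_of_ne (by omega)]
    rfl
  · simp only [SubAx, pr_inj_iff] at hc
    rcases hc with ⟨m, x, ⟨-, rfl, rfl⟩, rfl | rfl | rfl⟩ | ⟨t, i, h, -⟩ |
        ⟨t, ⟨h, -⟩, ht⟩ | ⟨t, j, h, -⟩ | ⟨i, h, -⟩ | ⟨j, h, -⟩ |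
        ⟨i, h, rfl, rfl⟩ | ⟨h, rfl, rfl⟩ | ⟨j, h, rfl, rfl⟩
    all_goals simp_all [tval_of_lt]

/-- Truth in ℕ is preserved by every rule. Since `Holds` is defined for all numbers, the rules need
no check that a number really is a formula. -/
theorem NDer.sound {l : List ℕ} (hl : ∀ n ∈ l, ∀ v, Holds v 0 0 n) {Γ a : ℕ} (h : NDer l Γ a)
    (v : ℕ → ℕ) (hΓ : Holds v 0 0 Γ) : Holds v 0 0 a := by
  have key := Gen.rec (Q := fun c => ∀ v, Holds v 0 0 (fst c) → Holds v 0 0 (snd c)) ?_ ?_ h v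
  · simpa using key (by simpa using hΓ)
  · rintro c (⟨Γ, a, rfl, n, hn, rfl⟩ | ⟨Γ, a, b, d, rfl, hb, hd⟩ | ⟨Γ, a, rfl⟩ | ⟨Γ, t, rfl⟩) v hΓ
    · simpa using hl _ hn v
    · rw [snd_pr, nImp, holds_imp, nImp, holds_imp, holds_all, holds_all]
      intro h0 hs n
      rw [hb.inst_sound (by simp), tval_zero] at h0
      induction n with
      | zero => exact h0
      | succ n ih =>
        have := hs n
        rw [nImp, holds_imp, hd.succ_sound v _ 0, Function.update_idem, Function.update_self] at this
        exact this ih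
    · rw [fst_pr, nCons, holds_cons] at hΓ
      simpa using hΓ.1
    · simp
  · rintro p q c (⟨Γ, a, b, rfl, rfl⟩ | ⟨Γ, a, b, rfl, rfl⟩ | ⟨Γ, a, b, rfl, rfl, rfl⟩ |
      ⟨Γ, a, rfl, rfl⟩ | ⟨Γ, Γ', a, b, d, rfl, hΓ', hab, hbd, rfl⟩ | ⟨Γ, a, b, t, rfl, ht, hb, rfl⟩ |
      ⟨Γ, a, b, d, s, t, rfl, rfl, hs, ht, hb, hd, rfl⟩) hp hq v hΓ
    · simp_all
    · simp_all
    · simp_all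
    · by_contra hc
      simp_all
    · simp only [fst_pr, snd_pr, holds_all] at *
      intro n
      -- The generalized value goes to the fresh variable 0, and the shift restores the original
      -- valuation for the context.
      have := hp fun | 0 => n | i + 1 => v i
      rwa [hΓ'.shift_sound, hbd.inst_sound (by simp), hab.shift_sound, tval_free,
        imp_iff_right hΓ] at this
    · simp only [fst_pr, snd_pr, holds_all] at *
      rw [hb.inst_sound ht.tval_eq]
      exact hp v hΓ _
    · simp only [fst_pr, snd_pr, holds_equal] at *
      have h := hq v hΓ
      rw [hb.inst_sound hs.tval_eq] at h
      rw [hd.inst_sound ht.tval_eq]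
      rwa [← hp v hΓ]

end NumberedSemantics

/-! ### Numbers of terms and formulas -/

section Numbering

/-- The number of a compound term, from the numbers of its parts. -/
def funcNum : ∀ {n : ℕ}, ArithFunc n → (Fin n → ℕ) → ℕ
  | _, .zero, _ => pr 0 0
  | _, .one, _ => pr 1 0
  | _, .add, w => pr 4 (pr (w 0) (w 1))
  | _, .mul, w => pr 5 (pr (w 0) (w 1))

/-- The number of a term, from the numbers of the variables. -/
def termNum {α : Type} (f : α → ℕ) : LA.Term α → ℕ
  | .var a => f a
  | .func F ts => funcNum F fun i => termNum f (ts i)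

/-- The number of a variable of a formula. -/
def varNum {k : ℕ} : ℕ ⊕ Fin k → ℕ := Sum.elim (fun i => pr 2 i) fun j => pr 3 (j : ℕ)

/-- The number of an atomic formula, from the numbers of its parts. -/
def relNum : ∀ {n : ℕ}, ArithRel n → (Fin n → ℕ) → ℕ
  | _, .lt, w => pr 8 (pr (w 0) (w 1))

/-- The number of a formula. -/
def formulaNum : ∀ {k : ℕ}, LA.BoundedFormula ℕ k → ℕ
  | _, .falsum => pr 6 0
  | _, .equal s t => pr 7 (pr (termNum varNum s) (termNum varNum t))
  | _, .rel R ts => relNum R fun i => termNum varNum (ts i)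
  | _, .imp φ ψ => pr 9 (pr (formulaNum φ) (formulaNum ψ))
  | _, .all φ => pr 10 (formulaNum φ)

theorem tval_termNum {α : Type} {f : α → ℕ} {v r : ℕ → ℕ} {u : α → ℕ}
    (hf : ∀ a, tval v r (f a) = u a) (t : LA.Term α) : tval v r (termNum f t) = t.realize u := by
  induction t with
  | var a => exact hf a
  | func F ts ih =>
    cases F with
    | zero =>
      change tval v r (pr 0 0) = 0
      exact tval_zero _ _ _
    | one =>
      change tval v r (pr 1 0) = 1
      exact tval_one _ _ _
    | add => exact (tval_add _ _ _ _).trans (congrArg₂ _ (ih 0) (ih 1))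
    | mul => exact (tval_mul _ _ _ _).trans (congrArg₂ _ (ih 0) (ih 1))

theorem tval_varNum {k : ℕ} (v r : ℕ → ℕ) (a : ℕ ⊕ Fin k) :
    tval v r (varNum a) = Sum.elim v (fun j : Fin k => r j) a := by
  rcases a with i | j
  · exact tval_free _ _ _
  · exact tval_bound _ _ _

theorem holds_formulaNum {k : ℕ} (φ : LA.BoundedFormula ℕ k) (v r : ℕ → ℕ) :
    Holds v r k (formulaNum φ) ↔ φ.Realize v fun j => r j := by
  induction φ generalizing r with
  | falsum => exact iff_of_false (holds_falsum _ _ _ _) id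
  | equal s t =>
    rw [formulaNum, holds_equal, tval_termNum (tval_varNum v r), tval_termNum (tval_varNum v r)]
    rfl
  | rel R ts =>
    cases R with
    | lt =>
      change Holds v r _ (pr 8 (pr (termNum varNum (ts 0)) (termNum varNum (ts 1)))) ↔ _
      rw [holds_less, tval_termNum (tval_varNum v r), tval_termNum (tval_varNum v r)]
      rfl
  | imp φ ψ ih₁ ih₂ => rw [formulaNum, holds_imp, ih₁, ih₂, BoundedFormula.realize_imp]
  | @all n φ ih =>
    rw [formulaNum, holds_all, BoundedFormula.realize_all]
    refine forall_congr' fun b => ?_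
    rw [ih]
    refine iff_of_eq (congrArg _ (funext fun j => ?_))
    refine Fin.lastCases ?_ (fun j => ?_) j
    · simp
    · simp [j.2.ne]

/-- This is the side condition that `SubAx` imposes on an inserted term. -/
theorem fst_termNum {k : ℕ} (t : LA.Term (ℕ ⊕ Fin k)) : fst (termNum varNum t) < 6 := by
  cases t with
  | var a => rcases a with a | a <;> simp [termNum, varNum]
  | func F ts => cases F <;> simp [termNum, funcNum]

theorem NSub.binary {m a a' b b' : ℕ} (τ : ℕ)
    (hτ : τ = 4 ∨ τ = 5 ∨ τ = 7 ∨ τ = 8 ∨ τ = 9 ∨ τ = 11) (h : NSub m a a') (h' : NSub m b b') :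
    NSub m (pr τ (pr a b)) (pr τ (pr a' b')) :=
  Gen.rule (.inl ⟨m, τ, a, a', b, b', hτ, rfl, rfl, rfl⟩) h h'

theorem NSub.quantifier {m a a' : ℕ} (h : NSub m a a') : NSub m (pr 10 a) (pr 10 a') :=
  Gen.rule (.inr ⟨m, a, a', rfl, rfl⟩) h h

theorem NSub.const (m : ℕ) {a : ℕ} (ha : a = pr 0 0 ∨ a = pr 1 0 ∨ a = pr 6 0) : NSub m a a :=
  Gen.ax (.inl ⟨m, a, rfl, ha⟩)

theorem NSub.term {α β : Type} {m : ℕ} {f : α → ℕ} {g : β → ℕ} {σ : α → LA.Term β}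
    (h : ∀ a, NSub m (f a) (termNum g (σ a))) (t : LA.Term α) :
    NSub m (termNum f t) (termNum g (t.subst σ)) := by
  induction t with
  | var a => exact h a
  | func F ts ih =>
    cases F with
    | zero => exact .const m (.inl rfl)
    | one => exact .const m (.inr (.inl rfl))
    | add => exact .binary 4 (by simp) (ih 0) (ih 1)
    | mul => exact .binary 5 (by simp) (ih 0) (ih 1)

theorem termNum_relabel {α β : Type} (f : β → ℕ) (g : α → β) (t : LA.Term α) :
    termNum f (t.relabel g) = termNum (fun a => f (g a)) t := by
  induction t with
  | var a => rfl
  | func F ts ih => simp only [Term.relabel, termNum, ih]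

theorem nTerm_termNum (t : LA.Term ℕ) : NTerm (termNum (fun i => pr 2 i) t) := by
  have := NSub.term (m := pr 0 (pr 0 0)) (f := fun i => pr 2 i) (g := fun i => pr 2 i)
    (σ := Term.var) (fun i => Gen.ax (.inr (.inl ⟨_, i, rfl⟩))) t
  rwa [term_subst_var] at this

theorem nSub_inst_term (t : LA.Term ℕ) {k : ℕ} (s : LA.Term (ℕ ⊕ Fin (k + 1))) :
    NSub (pr 0 (termNum (fun i => pr 2 i) t)) (termNum varNum s)
      (termNum varNum (s.subst (inst.σ t))) := by
  refine NSub.term (fun a => ?_) s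
  rcases a with i | j
  · exact Gen.ax (.inr (.inl ⟨_, i, rfl⟩))
  · refine Fin.cases ?_ (fun j => ?_) j
    · have h := fst_termNum (k := k) (t.relabel Sum.inl)
      have e : termNum (varNum (k := k)) (t.relabel Sum.inl) = termNum (fun i => pr 2 i) t :=
        termNum_relabel _ _ _
      rw [e] at h
      exact Gen.ax (.inr (.inr (.inl ⟨termNum (fun i => pr 2 i) t,
        congrArg (fun z => pr (pr 0 (termNum (fun i => pr 2 i) t)) (pr (pr 3 0) z)) e, h⟩)))
    · exact Gen.ax (.inr (.inr (.inr (.inl ⟨termNum (fun i => pr 2 i) t, (j : ℕ),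
        by simp [inst.σ, varNum, termNum]⟩))))

theorem nSub_inst (t : LA.Term ℕ) : ∀ {k : ℕ} (φ : LA.BoundedFormula ℕ (k + 1)),
    NSub (pr 0 (termNum (fun i => pr 2 i) t)) (formulaNum φ) (formulaNum (inst t φ))
  | _, .falsum => by
    rw [inst]
    exact .const _ (.inr (.inr rfl))
  | _, .equal s s' => by
    rw [inst]
    exact .binary 7 (by simp) (nSub_inst_term t s) (nSub_inst_term t s')
  | _, .rel R ts => by
    rw [inst]
    cases R with
    | lt => exact .binary 8 (by simp) (nSub_inst_term t (ts 0)) (nSub_inst_term t (ts 1))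
  | _, .imp φ ψ => by
    rw [inst]
    exact .binary 9 (by simp) (nSub_inst t φ) (nSub_inst t ψ)
  | _, .all φ => by
    rw [inst]
    exact .quantifier (nSub_inst t φ)

theorem nSub_shift {k : ℕ} (φ : LA.BoundedFormula ℕ k) :
    NSub (pr 1 0) (formulaNum φ) (formulaNum (shift φ)) := by
  have ht : ∀ {k : ℕ} (s : LA.Term (ℕ ⊕ Fin k)), NSub (pr 1 0) (termNum varNum s)
        (termNum varNum (s.subst (substLift (fun i => .var (i + 1)) k))) := by
    intro k
    refine NSub.term fun a => ?_
    rcases a with i | j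
    · exact Gen.ax (.inr (.inr (.inr (.inr (.inl ⟨i, rfl⟩)))))
    · exact Gen.ax (.inr (.inr (.inr (.inr (.inr (.inl ⟨j, rfl⟩))))))
  induction φ with
  | falsum => exact .const _ (by simp [formulaNum])
  | equal s t => exact .binary 7 (by simp) (ht s) (ht t)
  | rel R ts =>
    cases R with
    | lt => exact .binary 8 (by simp) (ht (ts 0)) (ht (ts 1))
  | imp φ ψ ih₁ ih₂ => exact .binary 9 (by simp) ih₁ ih₂
  | all φ ih => exact .quantifier ih

theorem nSub_atSucc {k : ℕ} (φ : LA.BoundedFormula ℕ k) :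
    NSub (pr 2 0) (formulaNum φ) (formulaNum (atSucc φ)) := by
  have ht : ∀ {k : ℕ} (s : LA.Term (ℕ ⊕ Fin k)), NSub (pr 2 0) (termNum varNum s)
        (termNum varNum (s.subst
          (Sum.elim (fun a => x a) fun j : Fin k => if (j : ℕ) = 0 then y j + 1 else y j))) := by
    intro k
    refine NSub.term fun a => ?_
    rcases a with i | j
    · exact Gen.ax (.inr (.inr (.inr (.inr (.inr (.inr (.inl ⟨i, rfl⟩)))))))
    · obtain ⟨j, hj⟩ := j
      rcases j with - | j
      · exact Gen.ax (.inr (.inr (.inr (.inr (.inr (.inr (.inr (.inl rfl))))))))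
      · exact Gen.ax (.inr (.inr (.inr (.inr (.inr (.inr (.inr (.inr ⟨j, rfl⟩))))))))
  induction φ with
  | falsum => exact .const _ (by simp [formulaNum])
  | equal s t => exact .binary 7 (by simp) (ht s) (ht t)
  | rel R ts =>
    cases R with
    | lt => exact .binary 8 (by simp) (ht (ts 0)) (ht (ts 1))
  | imp φ ψ ih₁ ih₂ => exact .binary 9 (by simp) ih₁ ih₂
  | all φ ih => exact .quantifier ih

/-- The number of a context. -/
def contextNum : List (LA.Formula ℕ) → ℕ
  | [] => pr 0 0
  | φ :: Γ => nCons (formulaNum φ) (contextNum Γ)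

theorem nSub_context (Γ : List (LA.Formula ℕ)) :
    NSub (pr 1 0) (contextNum Γ) (contextNum (Γ.map shift)) := by
  induction Γ with
  | nil => exact .const _ (.inl rfl)
  | cons φ Γ ih => exact .binary 11 (by simp) (nSub_shift φ) ih

theorem formulaNum_term_equal (s t : LA.Term ℕ) : formulaNum (s.equal t) =
    pr 7 (pr (termNum (fun i => pr 2 i) s) (termNum (fun i => pr 2 i) t)) := by
  simp [Term.equal, Term.bdEqual, formulaNum, termNum_relabel, varNum]

/-- Each rule is simulated by its numbered version. `SeqRule` always has two premises, so the only
premise of a unary rule is supplied twice. -/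
theorem Der.nDer {l : List ℕ} (hl : ∀ σ, PAMinus σ → formulaNum (ofSentence σ) ∈ l)
    {Γ : List (LA.Formula ℕ)} {φ : LA.Formula ℕ} (h : Der openPA Γ φ) :
    NDer l (contextNum Γ) (formulaNum φ) := by
  induction h with
  | ax h =>
    rcases h with ⟨σ, hσ, rfl⟩ | ⟨ψ, rfl⟩
    · exact Gen.ax (.inl ⟨_, _, rfl, _, hl σ hσ, rfl⟩)
    · exact Gen.ax (.inr (.inl ⟨_, _, _, _, rfl, nSub_inst 0 ψ, nSub_atSucc ψ⟩))
  | @hyp Γ φ h =>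
    -- The numbered axiom yields only the head of the context; the other assumptions are reached by
    -- the weakening rule.
    induction Γ with
    | nil => simp at h
    | cons ψ Γ ih =>
      by_cases hφ : φ = ψ
      · subst hφ
        exact Gen.ax (.inr (.inr (.inl ⟨_, _, rfl⟩)))
      · have := ih ((List.mem_cons.1 h).resolve_left hφ)
        exact Gen.rule (.inl ⟨_, _, _, rfl, rfl⟩) this this
  | impI _ ih => exact Gen.rule (.inr (.inl ⟨_, _, _, rfl, rfl⟩)) ih ih
  | impE _ _ ih₁ ih₂ => exact Gen.rule (.inr (.inr (.inl ⟨_, _, _, rfl, rfl, rfl⟩))) ih₁ ih₂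
  | raa _ ih => exact Gen.rule (.inr (.inr (.inr (.inl ⟨_, _, rfl, rfl⟩)))) ih ih
  | allI _ ih =>
    exact Gen.rule (.inr (.inr (.inr (.inr (.inl ⟨_, _, _, _, _, rfl, nSub_context _, nSub_shift _,
      nSub_inst (.var 0) _, rfl⟩))))) ih ih
  | allE t _ ih =>
    exact Gen.rule (.inr (.inr (.inr (.inr (.inr (.inl ⟨_, _, _, _, rfl, nTerm_termNum t,
      nSub_inst t _, rfl⟩)))))) ih ih
  | eqRefl t => exact Gen.ax (.inr (.inr (.inr ⟨_, _, by rw [formulaNum_term_equal]⟩)))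
  | eqSubst φ _ _ ih₁ ih₂ =>
    rw [formulaNum_term_equal] at ih₁
    exact Gen.rule (.inr (.inr (.inr (.inr (.inr (.inr ⟨_, _, _, _, _, _, rfl, rfl,
      nTerm_termNum _, nTerm_termNum _, nSub_inst _ φ, nSub_inst _ φ, rfl⟩)))))) ih₁ ih₂

end Numbering

/-! ### Provable universality is enumerable, universality is not -/

section Incompleteness

open Nat.Partrec (Code)

/-- The finitely many axioms can be built into a program as a list of numbers. -/
theorem exists_list_PAMinus : ∃ l : List LA.Sentence, ∀ σ, σ ∈ l ↔ PAMinus σ := by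
  have hcons : ∀ {σ : LA.Sentence} {l : List LA.Sentence}, PAMinus σ → (∀ τ ∈ l, PAMinus τ) →
      ∀ τ ∈ σ :: l, PAMinus τ := fun h h' => List.forall_mem_cons.2 ⟨h, h'⟩
  refine ⟨_, fun σ => ⟨(hcons .addAssoc <| hcons .addComm <| hcons .mulAssoc <| hcons .mulComm <|
    hcons .distrib <| hcons .zero <| hcons .one <| hcons .ltTrans <| hcons .ltIrrefl <|
    hcons .ltTri <| hcons .ltAdd <| hcons .ltMul <| hcons .sub <| hcons .discrete <|
    hcons .nonneg (l := []) (by simp)) σ, fun h => ?_⟩⟩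
  cases h <;> repeat first | exact List.mem_cons_self | apply List.mem_cons_of_mem

/-- A term for the number `n`. -/
def numTerm : ℕ → LA.Term ℕ
  | 0 => 0
  | n + 1 => numTerm n + 1

theorem realize_numTerm {M : Type} [PeanoModel M] (v : ℕ → M) (n : ℕ) :
    (numTerm n).realize v = n := by
  induction n with
  | zero => simp [numTerm]
  | succ n ih => simp [numTerm, ih]

/-- The graph of the function that gives the number of the term for `n`. -/
def NNum {M : Type} [PeanoModel M] (n t : M) : Prop :=
  Gen (fun c => c = pr 0 (pr 0 0))
    (fun p _ c => ∃ n t, p = pr n t ∧ c = pr (n + 1) (pr 4 (pr t (pr 1 0)))) (pr n t)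

instance US.nNum {F G : ∀ (M : Type) [PeanoModel M], M → M} [UF F] [UF G] :
    US fun M _ a => NNum (F M a) (G M a) :=
  US.gen (A := fun _ _ c => c = pr 0 (pr 0 0))
    (R := fun _ _ p _ c => ∃ n t, p = pr n t ∧ c = pr (n + 1) (pr 4 (pr t (pr 1 0))))
    inferInstance inferInstance

theorem nNum_iff {n t : ℕ} : NNum n t ↔ t = termNum (fun i => pr 2 i) (numTerm n) := by
  constructor
  · intro h
    refine Gen.rec (Q := fun c => ∀ n t, c = pr n t →
      t = termNum (fun i => pr 2 i) (numTerm n)) ?_ ?_ h n t rfl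
    · rintro c rfl n t h
      obtain ⟨rfl, rfl⟩ := pr_inj h
      rfl
    · rintro p q c ⟨n, t, rfl, rfl⟩ hp - n' t' h
      obtain ⟨rfl, rfl⟩ := pr_inj h
      rw [hp n t rfl]
      rfl
  · rintro rfl
    induction n with
    | zero => exact Gen.ax rfl
    | succ n ih => exact Gen.rule ⟨n, _, rfl, rfl⟩ ih ih

theorem holds_formula (φ : LA.Formula ℕ) (v : ℕ → ℕ) :
    Holds v 0 0 (formulaNum φ) ↔ φ.Realize v :=
  (holds_formulaNum φ v 0).trans
    (iff_of_eq (congrArg (BoundedFormula.Realize φ v) (Subsingleton.elim (α := Fin 0 → ℕ) _ _)))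

/-- A formula which says that `n` is the number of a universal machine. -/
def univFormula (n : ℕ) : LA.Formula ℕ :=
  (Term.var 0).equal (numTerm n) ⟹ app (n := 0) universalF fun _ => x 0

theorem realize_univFormula {M : Type} [PeanoModel M] (n : ℕ) (v : ℕ → M) :
    (univFormula n).Realize v ↔ (v 0 = n → Univ (v 0)) := by
  rw [univFormula, Formula.Realize, BoundedFormula.realize_imp, ← Formula.Realize,
    Formula.realize_equal, realize_app, realize_universalF, realize_numTerm]
  rfl

/-- There is a program that halts on the numbers of provably universal machines, and on the numbers
of universal machines only. -/
theorem exists_enumeration : ∃ c : Code, ∀ U : Code,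
    (ProvablyUniversal U → (c.eval U.encodeCode).Dom) ∧
      ((c.eval U.encodeCode).Dom → IsUniversal U) := by
  obtain ⟨l, hl⟩ := exists_list_PAMinus
  obtain ⟨axs, haxs⟩ : ∃ axs, axs = l.map fun σ => formulaNum (ofSentence σ) := ⟨_, rfl⟩
  obtain ⟨K, hK'⟩ : ∃ K, K = formulaNum (app (n := 0) universalF fun _ =>
    (x 0 : LA.Term (ℕ ⊕ Fin 0))) := ⟨_, rfl⟩
  have hK := UF.natCast K
  -- The program looks for a term for `n` together with a derivation of `univFormula n`. As the
  -- numeral stands in an equation, its number only has to be inserted there and no substitution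
  -- into the fixed formula has to be computed.
  obtain ⟨c, hc⟩ := US.exists_code (P := fun M _ n t => NNum n t ∧
    NDer axs (pr 0 0) (nImp (pr 7 (pr (pr 2 0) t)) (K : M))) inferInstance
  have hc := hc ℕ
  simp only [Nat.cast_id, ev_iff_mem_eval] at hc
  have hnum : ∀ n, nImp (pr 7 (pr (pr 2 0) (termNum (fun i => pr 2 i) (numTerm n)))) K =
      formulaNum (univFormula n) := fun n => by
    rw [univFormula, formulaNum, formulaNum_term_equal, hK']
    rfl
  refine ⟨c, fun U => ⟨fun h => ?_, fun h => ?_⟩⟩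
  -- Provability is carried from `PA` to `openPA` semantically, through soundness and completeness.
  · have hder : Der openPA [] (univFormula U.encodeCode) :=
      der_openPA_of_forall_realize fun M _ v => (realize_univFormula _ v).2 fun hv => by
        rw [hv, ← realize_universalSentence]
        exact provable_iff.1 h M
    have h := hder.nDer (l := axs) fun σ hσ => haxs ▸ List.mem_map_of_mem ((hl σ).2 hσ)
    obtain ⟨t, ht⟩ := (hc U.encodeCode).2 _ ⟨nNum_iff.2 rfl, by rw [hnum]; exact h⟩
    exact Part.dom_iff_mem.2 ⟨t, ht⟩
  · obtain ⟨t, ht⟩ := Part.dom_iff_mem.1 h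
    obtain ⟨hn, hd⟩ := (hc U.encodeCode).1 t ht
    rw [nNum_iff.1 hn, hnum] at hd
    -- The variable 0 gets the number of U as its value. The empty context has a tag below 6 and
    -- therefore counts as true.
    have := hd.sound (fun n hn v => ?_) (fun _ => U.encodeCode) (holds_of_lt _ _ _ _ (by simp))
    · rw [holds_formula] at this
      exact (univ_nat U).1 ((realize_univFormula _ _).1 this rfl)
    · obtain ⟨σ, hσ, rfl⟩ := List.mem_map.1 (haxs ▸ hn)
      rw [holds_formula]
      exact (realize_ofSentence σ v).2 (PeanoModel.realize_paMinus ℕ ((hl σ).1 hσ))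

/-! ### Machines whose universality encodes the halting problem. -/

theorem IsUniversal.congr {U V : Code} (h : U.eval = V.eval) (hU : IsUniversal U) :
    IsUniversal V := by
  have : Computes U = Computes V := by
    funext s t
    rw [Computes, Computes, h]
  unfold IsUniversal IsPrefixFree at *
  rwa [this] at hU

/-- A machine that halts on the empty string only is prefix-free; such machines force a universal
machine to have every output. -/
theorem exists_code_const (t : ℕ) : ∃ V : Code, IsPrefixFree V ∧ t ∈ V.eval 0 := by
  have hp : Nat.Partrec fun n => if n = 0 then Part.some t else Part.none := by
    have : Partrec fun n : ℕ => cond (n == 0) (Part.some t) Part.none :=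
      Partrec.cond (Primrec.beq.comp .id (.const 0)).to_comp (Computable.const t).partrec
        Partrec.none
    refine Partrec.nat_iff.1 (this.of_eq fun n => ?_)
    rcases n with - | n <;> rfl
  obtain ⟨V, hV⟩ := Code.exists_code.1 hp
  refine ⟨V, fun s s' u u' h h' _ => strNum_injective ?_, by simp [hV]⟩
  have hz : ∀ {s u : List Bool}, Computes V s u → strNum s = 0 := fun {s u} h => by
    rw [Computes, hV] at h
    by_contra hs
    simp [hs] at h
  rw [hz h, hz h']

/-- The domain of a universal machine is infinite. -/
theorem IsUniversal.exists_dom {U : Code} (hU : IsUniversal U) (k : ℕ) :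
    ∃ n, k ≤ n ∧ (U.eval n).Dom := by
  -- Fewer than `k` + 1 inputs would have to produce infinitely many different outputs.
  by_contra! hk
  have h : ∀ t : ℕ, ∃ n : Fin k, t ∈ U.eval n := fun t => by
    obtain ⟨V, hV, ht⟩ := exists_code_const t
    obtain ⟨c, hc⟩ := hU.2 V hV
    obtain ⟨u, rfl⟩ := strNum_surjective t
    obtain ⟨s, hs, -⟩ := hc [] u ht
    exact ⟨⟨strNum s, not_le.1 fun hle => hk _ hle (Part.dom_iff_mem.2 ⟨_, hs⟩)⟩, hs⟩
  choose f hf using h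
  refine not_injective_infinite_finite f fun t t' htt => Part.mem_unique (hf t) ?_
  rw [htt]
  exact hf t'

/-- Machines `V e` that agree with `U` as long as the program `e` has not halted on the input `0`,
and diverge from then on. -/
theorem exists_computable_cutoff (U : Code) : ∃ V : Code → Code, Computable V ∧
    ∀ e n, (V e).eval n = if (Code.evaln n e 0).isSome then Part.none else U.eval n := by
  have hp : Partrec fun a : Code × ℕ =>
      cond (Code.evaln a.2 a.1 0).isSome Part.none (U.eval a.2) :=
    Partrec.cond (Primrec.option_isSome.comp (Code.primrec_evaln.comp
      ((Primrec.snd.pair Primrec.fst).pair (Primrec.const 0)))).to_comp Partrec.none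
      (Code.eval_part.comp (Computable.const U) Computable.snd)
  obtain ⟨c, hc⟩ := Code.exists_code.1 hp
  obtain ⟨S, hS, hc'⟩ := Code.smn
  refine ⟨fun e => S c (Encodable.encode e),
    hS.comp (Computable.const c) Computable.encode, fun e n => ?_⟩
  rw [hc', hc]
  simp only [Encodable.decode_prod_val, Nat.unpair_pair, Encodable.encodek]
  have hid : ∀ p : Part ℕ, Part.map Encodable.encode p = p := fun p => Part.map_id' (fun _ => rfl) p
  by_cases h : (Code.evaln n e 0).isSome = true <;> simp [h, hid]

/-- If truth implied provability here, the enumeration would halt on V e exactly for the programs e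
that diverge on 0, contradicting the fact that divergence is not recursively enumerable. -/
theorem exists_not_provablyUniversal {U : Code} (hU : IsUniversal U) :
    ∃ V : Code, IsUniversal V ∧ ¬ProvablyUniversal V := by
  by_contra! hall
  obtain ⟨c, hc⟩ := exists_enumeration
  obtain ⟨V, hV, hVe⟩ := exists_computable_cutoff U
  have hdom : ∀ e, (c.eval (V e).encodeCode).Dom ↔ ¬(e.eval 0).Dom := by
    intro e
    refine ⟨fun h he => ?_, fun he => (hc _).1 (hall _ (hU.congr (funext fun n => ?_)))⟩
    -- If `e` halts within the bound `k`, then V e diverges on all inputs from `k` on, whereas a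
    -- universal machine has arbitrarily large inputs in its domain.
    · obtain ⟨t, ht⟩ := Part.dom_iff_mem.1 he
      obtain ⟨k, hk⟩ := Code.evaln_complete.1 ht
      obtain ⟨n, hn, hd⟩ := ((hc _).2 h).exists_dom k
      rw [hVe, if_pos (Option.isSome_iff_exists.2 ⟨t, Code.evaln_mono hn hk⟩)] at hd
      exact hd
    · rw [hVe, if_neg]
      intro h
      obtain ⟨t, ht⟩ := Option.isSome_iff_exists.1 h
      exact he (Part.dom_iff_mem.2 ⟨t, Code.evaln_sound ht⟩)
  refine ComputablePred.halting_problem_not_re 0 (REPred.of_eq (p := fun e =>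
    (c.eval (V e).encodeCode).Dom) ?_ hdom)
  have : Partrec fun e : Code => c.eval (V e).encodeCode := by
    rw [← Code.encodeCode_eq]
    exact Code.eval_part.comp (Computable.const c) (Computable.encode.comp hV)
  exact this.dom_re

end Incompleteness

end ProvUniv

theorem mainTheorem9 :
    (∃ U : Nat.Partrec.Code, ProvUniv.IsUniversal U ∧ ProvUniv.ProvablyUniversal U) ∧
      ∃ V : Nat.Partrec.Code, ProvUniv.IsUniversal V ∧ ¬ ProvUniv.ProvablyUniversal V := by
  obtain ⟨U, hU⟩ := ProvUniv.exists_provablyUniversal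
  have hU' : ProvUniv.IsUniversal U := (ProvUniv.univ_nat U).1 (by simpa using hU ℕ)
  exact ⟨⟨U, hU', ProvUniv.provable_iff.2 fun M _ =>
    (ProvUniv.realize_universalSentence U).2 (hU M)⟩, ProvUniv.exists_not_provablyUniversal hU'⟩
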